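/- Let $M$ be a smooth (Hausdorff, second countable) manifold of dimension $n\ge 2$ with a projective structure $\boldsymbol p=[\nabla]$, i.e. an equivalence class of torsion-free affine connections, where $\nabla'\sim\nabla$ iff $\nabla'_a v^b=\nabla_a v^b+\Upsilon_a v^b+\Upsilon_c v^c\delta_a^b$ for some $1$-form $\Upsilon$. Let $\mathcal E(w)=((\Lambda^nTM)^2)^{w/(2n+2)}$, and for a bundle $\mathcal B$ write $\mathcal B(w)=\mathcal B\otimes\mathcal E(w)$. Let $\mathcal T^*=J^1\mathcal E(1)$ be the cotractor bundle, with canonical inclusion $Z_A{}^a:T^*M(1)\to\mathcal T^*$. A connection $\nabla\in\boldsymbol p$ splits $\mathcal T^*$ as $\mathcal E(1)\oplus T^*M(1)$, the $1$-jet of a density $\sigma$ corresponding to $(\sigma,\nabla_b\sigma)$; let $Y_A:\mathcal E(1)\to\mathcal T^*$ be the corresponding inclusion. The normal projective tractor connection, which does not depend on the choice of $\nabla\in\boldsymbol p$, is $$\nabla_a(\sigma,\mu_b)=(\nabla_a\sigma-\mu_a,\ \nabla_a\mu_b+\mathsf P_{ab}\sigma),$$ where $\mathsf P$ is the projective Schouten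 tensor of $\nabla$: with $[\nabla_a,\nabla_b]v^c=R_{ab}{}^c{}_dv^d$ and $R_{bd}=R_{cb}{}^c{}_d$, $(n^2-1)\mathsf P_{ab}=nR_{ab}+R_{ba}$. For a tractor field $V$ of weight $w$ put $\mathbb D_AV=wY_AV+Z_A{}^a\nabla_aV$; this too does not depend on the choice of $\nabla\in\boldsymbol p$. Let $r\ge1$. Let $\mathcal T_{(r,r)}\subset\otimes^{2r}\mathcal T^*$ consist of the tensors $T_{B_1\cdots B_rC_1\cdots C_r}$ that are symmetric in the $B_i$, symmetric in the $C_i$, and satisfy $T_{(B_1\cdots B_rC_1)C_2\cdots C_r}=0$. Let $P_{(r,r)}=S_{(1,\dots,r)}\circ S_{(r+1,\dots,2r)}\circ S_{[1,r+1]}\circ\cdots\circ S_{[r,2r]}$, where $S_{(\dots)}$ denotes symmetrisation over the listed index positions and $S_{[i,j]}$ skew-symmetrisation over positions $i,j$. The splitting operator is the linear map $$\mathcal L:\Gamma(S^rT^*M(2r))\to\Gamma(\mathcal T_{(r,r)}),\qquad k_{c_1\cdots c_r}\mapsto P_{(r,r)}\big(\mathbb D_{B_1}\cdots\mathbb D_{B_r}(Z_{C_1}{}^{c_1}\cdots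 Z_{C_r}{}^{c_r}k_{c_1\cdots c_r})\big).$$ A Killing tensor of rank $r$ is a section $k$ of $S^rT^*M(2r)$ with $\nabla_{(a_0}k_{a_1\cdots a_r)}=0$ for $\nabla\in\boldsymbol p$. **Theorem.** If $(M,\boldsymbol p)$ is projectively flat, i.e. the curvature of the normal projective tractor connection vanishes, then $\mathcal L$ is well defined (it takes values in $\Gamma(\mathcal T_{(r,r)})$ and does not depend on the choice of $\nabla\in\boldsymbol p$), and it restricts to a linear isomorphism from the space of Killing tensors of rank $r$ onto the space of sections of $\mathcal T_{(r,r)}$ that are parallel for the normal projective tractor connection. -/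

import Mathlib

open Set Filter Topology Bundle
open scoped Manifold ContDiff

noncomputable section

namespace ProjTractor

/-- The model space `ℝⁿ` of an `n`-dimensional manifold. -/
abbrev Coord (n : ℕ) : Type := EuclideanSpace ℝ (Fin n)

/-- The `i`-th standard basis vector of `ℝⁿ`. -/
abbrev stdVec {n : ℕ} (i : Fin n) : Coord n := EuclideanSpace.single i 1

/-- The trace `∑ᵢ (f eᵢ)ⁱ` of an endomorphism of `ℝⁿ`. -/
def tr {n : ℕ} (f : Coord n → Coord n) : ℝ := ∑ i, f (stdVec i) i

/-! ### Affine connections and projective structures -/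

section Connections

variable (n : ℕ) (M : Type*) [TopologicalSpace M] [ChartedSpace (Coord n) M]
  [IsManifold 𝓘(ℝ, Coord n) ∞ M]

/-- A smooth torsion-free affine connection `∇` on `TM`. In the notation of Mathlib,
`∇.cov Y x u` is `(∇_u Y)(x)`. -/
structure TorsionFreeConnection where
  cov : CovariantDerivative 𝓘(ℝ, Coord n) (Coord n)
    (TangentSpace 𝓘(ℝ, Coord n) : M → Type _)
  smooth : CovariantDerivative.ContMDiffCovariantDerivative cov ∞
  torsion_eq_zero : cov.torsion = 0

/-- Smooth vector fields on `M`. -/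
abbrev SmoothVectorField :=
  ContMDiffSection 𝓘(ℝ, Coord n) (Coord n) ∞ (TangentSpace 𝓘(ℝ, Coord n) : M → Type _)

/-- Smooth `1`-forms on `M`. -/
abbrev SmoothOneForm :=
  ContMDiffSection 𝓘(ℝ, Coord n) (Coord n →L[ℝ] ℝ) ∞
    (fun x : M ↦ TangentSpace 𝓘(ℝ, Coord n) x →L[ℝ] Trivial M ℝ x)

variable {n M}

/-- `∇` and `∇'` are projectively equivalent: there is a smooth `1`-form `Υ` with
`∇'_u Y = ∇_u Y + Υ(u) Y + Υ(Y) u`. -/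
def ProjEquiv (D D' : TorsionFreeConnection n M) : Prop :=
  ∃ Υ : SmoothOneForm n M, ∀ (Y : SmoothVectorField n M) (x : M)
    (u : TangentSpace 𝓘(ℝ, Coord n) x),
    D'.cov Y x u = D.cov Y x u + (Υ x u : ℝ) • Y x + (Υ x (Y x) : ℝ) • u

theorem projEquiv_refl (D : TorsionFreeConnection n M) : ProjEquiv D D :=
  ⟨0, fun Y x u ↦ by simp⟩

theorem projEquiv_symm {D D' : TorsionFreeConnection n M} (h : ProjEquiv D D') :
    ProjEquiv D' D := by
  obtain ⟨Υ, h⟩ := h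
  refine ⟨-Υ, fun Y x u ↦ ?_⟩
  rw [h Y x u]
  simp only [ContMDiffSection.coe_neg, Pi.neg_apply, _root_.neg_apply]
  module

theorem projEquiv_trans {D D' D'' : TorsionFreeConnection n M} (h : ProjEquiv D D')
    (h' : ProjEquiv D' D'') : ProjEquiv D D'' := by
  obtain ⟨Υ, h⟩ := h
  obtain ⟨Υ', h'⟩ := h'
  refine ⟨Υ + Υ', fun Y x u ↦ ?_⟩
  rw [h' Y x u, h Y x u]
  simp only [ContMDiffSection.coe_add, Pi.add_apply, _root_.add_apply]
  module

variable (n M)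

/-- Projective equivalence of torsion-free connections. -/
instance projSetoid : Setoid (TorsionFreeConnection n M) where
  r := ProjEquiv
  iseqv := ⟨projEquiv_refl, projEquiv_symm, projEquiv_trans⟩

/-- A projective structure on `M`: a projective equivalence class of torsion-free connections. -/
abbrev ProjectiveStructure := Quotient (projSetoid n M)

variable {n M}

/-- `∇ ∈ 𝒑`. -/
def ProjectiveStructure.Contains (p : ProjectiveStructure n M)
    (D : TorsionFreeConnection n M) : Prop := Quotient.mk _ D = p

end Connections

/-! ### The objects attached to a connection in a chart -/

section Local

variable {n : ℕ} {M : Type*} [TopologicalSpace M] [ChartedSpace (Coord n) M]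
  [IsManifold 𝓘(ℝ, Coord n) ∞ M]

/-- The vector field on the domain of the chart `φ` whose coordinates are constantly `a`. -/
def coordField (φ : OpenPartialHomeomorph M (Coord n)) (a : Coord n) (x : M) :
    TangentSpace 𝓘(ℝ, Coord n) x :=
  VectorField.mpullback 𝓘(ℝ, Coord n) 𝓘(ℝ, Coord n) φ (fun _ ↦ a) x

/-- The Christoffel symbols of `∇` in the chart `φ`, as the bilinear map
`Γ(a, b) = ∇_a b = aⁱ bʲ ∇_{∂ᵢ} ∂ⱼ` (for constant coordinate fields `a`, `b`), at the point with
coordinates `y`. -/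
def christoffel (D : TorsionFreeConnection n M) (φ : OpenPartialHomeomorph M (Coord n))
    (y a b : Coord n) : Coord n :=
  ∑ i, ∑ j, (a i * b j) •
    (mfderiv 𝓘(ℝ, Coord n) 𝓘(ℝ, Coord n) φ (φ.symm y)
      (D.cov (coordField φ (stdVec j)) (φ.symm y) (coordField φ (stdVec i) (φ.symm y))) : Coord n)

variable (Γ : Coord n → Coord n → Coord n → Coord n)

/-- The connection form of `∇` on the density bundle `𝓔(1) = ((Λⁿ TM)²)^{1/(2n+2)}`, trivialised
by the coordinates: `θ(a) = Γ_{ab}{}^b / (n + 1)`. On `𝓔(w)` the connection form is `w θ`. -/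
def densForm (y a : Coord n) : ℝ := tr (fun b ↦ Γ y a b) / (n + 1)

/-- The curvature `R(a, b) c`, that is `R_{ab}{}^c{}_d` with `[∇_a, ∇_b] v^c = R_{ab}{}^c{}_d v^d`. -/
def curv (y a b c : Coord n) : Coord n :=
  fderiv ℝ (fun z ↦ Γ z b c) y a - fderiv ℝ (fun z ↦ Γ z a c) y b
    + Γ y a (Γ y b c) - Γ y b (Γ y a c)

/-- The Ricci curvature `R_{bd} = R_{cb}{}^c{}_d`. -/
def ricci (y b d : Coord n) : ℝ := tr (fun c ↦ curv Γ y c b d)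

/-- The projective Schouten tensor: the solution
`P_{ab} = (n R_{ab} + R_{ba}) / (n² - 1)` of
`(n - 1) P_{ab} = R_{ab} + β_{ab}`, `β_{ab} = - P_{ab} + P_{ba}`. -/
def schouten (y a b : Coord n) : ℝ :=
  ((n : ℝ) * ricci Γ y a b + ricci Γ y b a) / ((n : ℝ) ^ 2 - 1)

end Local

/-! ### Covariant differentiation of tensors

For a vector bundle with fibre `F`, trivialised over a chart domain, a covariant tensor field of
valence `m` is represented by a function `T : ℝⁿ → (Fin m → F) → ℝ` which is multilinear in the
second argument. -/

section Tensors

variable {n : ℕ} {F : Type*}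

/-- The covariant derivative `(∇_a T)(v₁, …, v_m)` of a tensor of density weight `w`, where the
connection on the bundle with fibre `F` is `∂_a + A_a` and that on `𝓔(1)` is `∂_a + θ_a`. -/
def covDeriv (A : Coord n → Coord n → F → F) (θ : Coord n → Coord n → ℝ) (w : ℝ) {m : ℕ}
    (T : Coord n → (Fin m → F) → ℝ) (y a : Coord n) (v : Fin m → F) : ℝ :=
  fderiv ℝ (fun z ↦ T z v) y a - ∑ i, T y (Function.update v i (A y a (v i)))
    + w * θ y a * T y v

variable {m : ℕ}

/-- Symmetrisation (with the factor `1 / |s|!`) over the indices in `s`. -/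
def symmOver (s : Finset (Fin m)) (T : (Fin m → F) → ℝ) (v : Fin m → F) : ℝ :=
  ((s.card.factorial : ℝ))⁻¹ *
    ∑ σ ∈ Finset.univ.filter (fun σ : Equiv.Perm (Fin m) ↦ ∀ i, i ∉ s → σ i = i), T (v ∘ σ)

/-- Skew-symmetrisation (with the factor `1 / 2`) over the two indices `i` and `j`. -/
def skewOver (i j : Fin m) (T : (Fin m → F) → ℝ) (v : Fin m → F) : ℝ :=
  (T v - T (v ∘ Equiv.swap i j)) / 2

variable {r : ℕ}

/-- The first `r` of `2r` indices. -/
def firstIdx (r : ℕ) : Finset (Fin (r + r)) := Finset.univ.filter (fun i ↦ i.val < r)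

/-- The last `r` of `2r` indices. -/
def lastIdx (r : ℕ) : Finset (Fin (r + r)) := Finset.univ.filter (fun i ↦ r ≤ i.val)

/-- The first `r + 1` of `2r` indices. -/
def firstSuccIdx (r : ℕ) : Finset (Fin (r + r)) := Finset.univ.filter (fun i ↦ i.val ≤ r)

/-- Young symmetry `(r, r)`: `T` is symmetric in the first `r` indices, symmetric in the last `r`
indices, and symmetrisation over the first `r + 1` indices annihilates `T`. -/
def HasYoungSymmetry (r : ℕ) (T : (Fin (r + r) → F) → ℝ) : Prop :=
  symmOver (firstIdx r) T = T ∧ symmOver (lastIdx r) T = T ∧ symmOver (firstSuccIdx r) T = 0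

/-- The Young projection
`P_{(r,r)} = S_{(1,…,r)} ∘ S_{(r+1,…,2r)} ∘ S_{[1,r+1]} ∘ ⋯ ∘ S_{[r,2r]}`. -/
def youngProj (r : ℕ) (T : (Fin (r + r) → F) → ℝ) : (Fin (r + r) → F) → ℝ :=
  symmOver (firstIdx r) (symmOver (lastIdx r)
    ((List.finRange r).foldr
      (fun i S ↦ skewOver (Fin.castAdd r i) (Fin.natAdd r i) S) T))

end Tensors

/-! ### Tractors in a chart

The cotractor bundle is `𝓣* = J¹𝓔(1)`. A chart identifies its fibre with pairs `(σ, ν)`, the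
`1`-jet of a density `σ` being `(σ, dσ)` in coordinates, so the fibre of the tractor bundle `𝓣` is
`ℝ × ℝⁿ`, with `(s, u)` pairing with `(σ, ν)` to `σ s + ν(u)`. In this frame
`X = (1, 0)`, and `Z : 𝓣 → TM(-1)` is `(s, u) ↦ u`. -/

/-- The fibre of the tractor bundle in a chart. -/
abbrev Tr (n : ℕ) : Type := ℝ × Coord n

section Tractors

variable {n : ℕ} (Γ : Coord n → Coord n → Coord n → Coord n)

/-- `Y_A`: the splitting `Y : 𝓣 → 𝓔(-1)` determined by the connection. A cotractor `(σ, ν)` has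
components `σ` and `μ = ν + θ σ` (the covariant derivative of the density if it is a `1`-jet) with
respect to this splitting, and a tractor `(s, u)` has components `ρ = Y(s, u) = s - θ(u)` and `u`.
-/
def splitY (y : Coord n) (v : Tr n) : ℝ := v.1 - densForm Γ y v.2

/-- The connection form of the normal tractor connection on `𝓣`: the derivative in direction `a`
of the tractor field with constant coordinates `v = (s, u)`. In the splitting, with
`ρ = s - θ(u)`, this is `(∇_a u + ρ a, ∇_a ρ - P(a, u))`, where `u` and `ρ` have weight `-1`. -/
def tractorForm (y a : Coord n) (v : Tr n) : Tr n :=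
  let θ := densForm Γ
  let ρ : ℝ := splitY Γ y v
  let u' : Coord n := (Γ y a v.2 - θ y a • v.2) + ρ • a
  let ρ' : ℝ := (-(fderiv ℝ (fun z ↦ θ z v.2) y a) - θ y a * ρ) - schouten Γ y a v.2
  (ρ' + θ y u', u')

/-- The curvature `κ(a, b) v` of the tractor connection on `𝓣`. -/
def tractorCurv (y a b : Coord n) (v : Tr n) : Tr n :=
  fderiv ℝ (fun z ↦ tractorForm Γ z b v) y a - fderiv ℝ (fun z ↦ tractorForm Γ z a v) y b
    + tractorForm Γ y a (tractorForm Γ y b v) - tractorForm Γ y b (tractorForm Γ y a v)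

/-- The Thomas `𝔻`-operator `𝔻_A V = w Y_A V + Z_A{}^a ∇_a V` on tractors of valence `m` and weight
`w`. The new index is the first one. -/
def thomasD (w : ℝ) {m : ℕ} (V : Coord n → (Fin m → Tr n) → ℝ) (y : Coord n)
    (v : Fin (m + 1) → Tr n) : ℝ :=
  w * splitY Γ y (v 0) * V y (Fin.tail v)
    + covDeriv (tractorForm Γ) (densForm Γ) w V y (v 0).2 (Fin.tail v)

/-- The iterate `𝔻_{B₁} ⋯ 𝔻_{B_j} V` on tractors of valence `m` and weight `w`. -/
def iterThomasD (w : ℝ) {m : ℕ} (V : Coord n → (Fin m → Tr n) → ℝ) :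
    (j : ℕ) → Coord n → (Fin (m + j) → Tr n) → ℝ
  | 0 => V
  | j + 1 => thomasD Γ (w - j) (iterThomasD w V j)

/-- `K_{B ⋯ C} = Z_B{}^b ⋯ Z_C{}^c k_{b ⋯ c}`. -/
def liftK {r : ℕ} (k : Coord n → (Fin r → Coord n) → ℝ) (y : Coord n) (v : Fin r → Tr n) : ℝ :=
  k y (fun i ↦ (v i).2)

/-- The local expression `P_{(r,r)} (𝔻_{B₁} ⋯ 𝔻_{B_r} K_{C₁ ⋯ C_r})`, where `K` has weight `r`. -/
def splittingFormula (r : ℕ) (k : Coord n → (Fin r → Coord n) → ℝ) (y : Coord n) :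
    (Fin (r + r) → Tr n) → ℝ :=
  youngProj r (iterThomasD Γ r (liftK k) r y)

end Tractors

/-! ### Sections of bundles

A section of a bundle is given by its local representatives in the charts of `M`, which are
related by the transition functions of the bundle. Local representatives are extended by `0`
outside the target of the chart. -/

section Sections

variable {n : ℕ} {M : Type*} [TopologicalSpace M]

/-- The transition map `φ' ∘ φ⁻¹`. -/
def transMap (φ φ' : OpenPartialHomeomorph M (Coord n)) (y : Coord n) : Coord n := φ' (φ.symm y)

/-- `|det D(φ' ∘ φ⁻¹)|`. -/
def absJac (φ φ' : OpenPartialHomeomorph M (Coord n)) (y : Coord n) : ℝ :=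
  |(fderiv ℝ (transMap φ φ') y).det|

/-- Transition function of the density bundle `𝓔(w) = ((Λⁿ TM)²)^{w/(2n+2)}`: representatives
`τ`, `τ'` of a density in the charts `φ`, `φ'` satisfy `τ(y) = densTrans w y * τ'(φ' φ⁻¹ y)`. -/
def densTrans (w : ℝ) (φ φ' : OpenPartialHomeomorph M (Coord n)) (y : Coord n) : ℝ :=
  absJac φ φ' y ^ (-(w / (n + 1)))

/-- Transition function of `TM`. -/
def tangentTrans (φ φ' : OpenPartialHomeomorph M (Coord n)) (y u : Coord n) : Coord n :=
  fderiv ℝ (transMap φ φ') y u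

/-- Transition function of `𝓣`, dual to that of `1`-jets of sections of `𝓔(1)`: if
`σ = δ · (σ' ∘ ψ)` with `ψ = φ' φ⁻¹`, then
`(σ, dσ) = (δ σ', σ' dδ + δ dσ' ∘ dψ)`. -/
def tractorTrans (φ φ' : OpenPartialHomeomorph M (Coord n)) (y : Coord n) (v : Tr n) : Tr n :=
  (densTrans 1 φ φ' y * v.1 + fderiv ℝ (densTrans 1 φ φ') y v.2,
    densTrans 1 φ φ' y • tangentTrans φ φ' y v.2)

/-- `tractorTrans` is the transpose of the transition function of `J¹𝓔(1)`. -/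
theorem tractorTrans_dual (φ φ' : OpenPartialHomeomorph M (Coord n)) (y : Coord n) (v : Tr n)
    (σ' : Coord n → ℝ) (hδ : DifferentiableAt ℝ (densTrans 1 φ φ') y)
    (hψ : DifferentiableAt ℝ (transMap φ φ') y)
    (hσ : DifferentiableAt ℝ σ' (transMap φ φ' y)) :
    (densTrans 1 φ φ' y * σ' (transMap φ φ' y)) * v.1
        + fderiv ℝ (fun z ↦ densTrans 1 φ φ' z * σ' (transMap φ φ' z)) y v.2
      = σ' (transMap φ φ' y) * (tractorTrans φ φ' y v).1
        + fderiv ℝ σ' (transMap φ φ' y) (tractorTrans φ φ' y v).2 := by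
  have h : HasFDerivAt (fun z ↦ σ' (transMap φ φ' z))
      ((fderiv ℝ σ' (transMap φ φ' y)).comp (fderiv ℝ (transMap φ φ') y)) y :=
    hσ.hasFDerivAt.comp y hψ.hasFDerivAt
  rw [show (fun z ↦ densTrans 1 φ φ' z * σ' (transMap φ φ' z))
      = densTrans 1 φ φ' * fun z ↦ σ' (transMap φ φ' z) from rfl,
    (hδ.hasFDerivAt.mul h).fderiv]
  simp [tractorTrans, tangentTrans]
  ring

variable (M) [ChartedSpace (Coord n) M]

/-- Families of local representatives, one for each chart, of covariant tensors of valence `m` on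
a bundle with fibre `F`. -/
abbrev LocalFamily (F : Type*) [AddCommGroup F] [Module ℝ F] (m : ℕ) :=
  atlas (Coord n) M → Coord n → MultilinearMap ℝ (fun _ : Fin m ↦ F) ℝ

/-- Smooth sections of `⊗ᵐ B* ⊗ 𝓔(w)`, where `B` is the bundle with fibre `F` and transition
functions `G`. -/
def tensorSections {F : Type*} [AddCommGroup F] [Module ℝ F]
    (G : OpenPartialHomeomorph M (Coord n) → OpenPartialHomeomorph M (Coord n) →
      Coord n → F → F) (m : ℕ) (w : ℝ) : Submodule ℝ (LocalFamily (n := n) M F m) where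
  carrier := {T |
    (∀ φ v, ContDiffOn ℝ ∞ (fun y ↦ T φ y v) φ.1.target) ∧
    (∀ φ, ∀ y ∉ φ.1.target, T φ y = 0) ∧
    (∀ φ φ', ∀ y ∈ (φ.1.symm.trans φ'.1).source, ∀ v,
      T φ y v = densTrans w φ.1 φ'.1 y
        * T φ' (transMap φ.1 φ'.1 y) (fun i ↦ G φ.1 φ'.1 y (v i)))}
  zero_mem' := ⟨fun φ v ↦ by simpa using contDiffOn_const, by simp, by simp⟩
  add_mem' := by
    rintro S T ⟨hS, hS', hS''⟩ ⟨hT, hT', hT''⟩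
    refine ⟨fun φ v ↦ by simpa using (hS φ v).add (hT φ v), fun φ y hy ↦ ?_,
      fun φ φ' y hy v ↦ ?_⟩
    · simp [hS' φ y hy, hT' φ y hy]
    · simp [hS'' φ φ' y hy v, hT'' φ φ' y hy v, mul_add]
  smul_mem' := by
    rintro c T ⟨hT, hT', hT''⟩
    refine ⟨fun φ v ↦ by simpa using contDiffOn_const.mul (hT φ v), fun φ y hy ↦ ?_,
      fun φ φ' y hy v ↦ ?_⟩
    · simp [hT' φ y hy]
    · simp [hT'' φ φ' y hy v]; ring

theorem symmOver_add {F : Type*} {m : ℕ} (s : Finset (Fin m)) (S T : (Fin m → F) → ℝ) :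
    symmOver s (S + T) = symmOver s S + symmOver s T := by
  funext v; simp [symmOver, Finset.sum_add_distrib, mul_add]

theorem symmOver_smul {F : Type*} {m : ℕ} (s : Finset (Fin m)) (c : ℝ) (T : (Fin m → F) → ℝ) :
    symmOver s (c • T) = c • symmOver s T := by
  funext v; simp only [symmOver, Pi.smul_apply, smul_eq_mul, ← Finset.mul_sum]; ring

theorem symmOver_zero {F : Type*} {m : ℕ} (s : Finset (Fin m)) :
    symmOver s (0 : (Fin m → F) → ℝ) = 0 := by
  funext v; simp [symmOver]

/-- `Γ(Sʳ T*M (w))`: symmetric covariant tensors of rank `r` and projective weight `w`. -/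
def symTensors (r : ℕ) (w : ℝ) : Submodule ℝ (LocalFamily (n := n) M (Coord n) r) where
  carrier := {k | k ∈ tensorSections M tangentTrans r w ∧
    ∀ φ y, symmOver Finset.univ (k φ y) = k φ y}
  zero_mem' := ⟨zero_mem _, fun φ y ↦ symmOver_zero _⟩
  add_mem' := by
    rintro S T ⟨hS, hS'⟩ ⟨hT, hT'⟩
    refine ⟨add_mem hS hT, fun φ y ↦ ?_⟩
    change symmOver _ (⇑(S φ y) + ⇑(T φ y)) = ⇑(S φ y) + ⇑(T φ y)
    rw [symmOver_add, hS', hT']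
  smul_mem' := by
    rintro c T ⟨hT, hT'⟩
    refine ⟨Submodule.smul_mem _ c hT, fun φ y ↦ ?_⟩
    change symmOver _ (c • ⇑(T φ y)) = c • ⇑(T φ y)
    rw [symmOver_smul, hT']

/-- `Γ(𝓣_{(r,r)})`: cotractors of valence `2r` (and weight `0`) with Young symmetry `(r, r)`. -/
def youngTractors (r : ℕ) : Submodule ℝ (LocalFamily (n := n) M (Tr n) (r + r)) where
  carrier := {L | L ∈ tensorSections M tractorTrans (r + r) 0 ∧
    ∀ φ y, HasYoungSymmetry r (L φ y)}
  zero_mem' := ⟨zero_mem _, fun φ y ↦ ⟨symmOver_zero _, symmOver_zero _, symmOver_zero _⟩⟩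
  add_mem' := by
    rintro S T ⟨hS, hS'⟩ ⟨hT, hT'⟩
    refine ⟨add_mem hS hT, fun φ y ↦ ?_⟩
    obtain ⟨h1, h2, h3⟩ := hS' φ y
    obtain ⟨h1', h2', h3'⟩ := hT' φ y
    change HasYoungSymmetry r (⇑(S φ y) + ⇑(T φ y))
    refine ⟨?_, ?_, ?_⟩ <;> rw [symmOver_add]
    · rw [h1, h1']
    · rw [h2, h2']
    · rw [h3, h3', add_zero]
  smul_mem' := by
    rintro c T ⟨hT, hT'⟩
    refine ⟨Submodule.smul_mem _ c hT, fun φ y ↦ ?_⟩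
    obtain ⟨h1, h2, h3⟩ := hT' φ y
    change HasYoungSymmetry r (c • ⇑(T φ y))
    refine ⟨?_, ?_, ?_⟩ <;> rw [symmOver_smul]
    · rw [h1]
    · rw [h2]
    · rw [h3, smul_zero]

end Sections

/-! ### Flatness, Killing tensors, parallel tractors, the splitting operator -/

section Main

variable {n : ℕ} {M : Type*} [TopologicalSpace M] [ChartedSpace (Coord n) M]
  [IsManifold 𝓘(ℝ, Coord n) ∞ M]

/-- The projective structure is flat: the tractor curvature vanishes. -/
def ProjectiveStructure.IsFlat (p : ProjectiveStructure n M) : Prop :=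
  ∀ D : TorsionFreeConnection n M, p.Contains D → ∀ φ ∈ atlas (Coord n) M, ∀ y ∈ φ.target,
    ∀ a b v, tractorCurv (christoffel D φ) y a b v = 0

/-- `k ∈ Γ(Sʳ T*M (2r))` is a Killing tensor: `∇_{(a₀} k_{a₁ ⋯ a_r)} = 0` for `∇ ∈ 𝒑`. -/
def IsKilling (p : ProjectiveStructure n M) {r : ℕ} (k : symTensors (n := n) M r (2 * r)) :
    Prop :=
  ∀ D : TorsionFreeConnection n M, p.Contains D → ∀ φ : atlas (Coord n) M, ∀ y ∈ φ.1.target,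
    symmOver Finset.univ (fun v : Fin (r + 1) → Coord n ↦
      covDeriv (christoffel D φ.1) (densForm (christoffel D φ.1)) (2 * r)
        (fun z ↦ ⇑(k.1 φ z)) y (v 0) (Fin.tail v)) = 0

/-- `L ∈ Γ(𝓣_{(r,r)})` is parallel for the normal projective tractor connection. -/
def IsParallel (p : ProjectiveStructure n M) {r : ℕ} (L : youngTractors (n := n) M r) : Prop :=
  ∀ D : TorsionFreeConnection n M, p.Contains D → ∀ φ : atlas (Coord n) M, ∀ y ∈ φ.1.target,
    ∀ a v, covDeriv (tractorForm (christoffel D φ.1)) (densForm (christoffel D φ.1)) 0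
      (fun z ↦ ⇑(L.1 φ z)) y a v = 0

/-- `𝓛` is the splitting operator
`k_{c₁ ⋯ c_r} ↦ P_{(r,r)} (𝔻_{B₁} ⋯ 𝔻_{B_r} Z_{C₁}{}^{c₁} ⋯ Z_{C_r}{}^{c_r} k_{c₁ ⋯ c_r})`
from `Γ(Sʳ T*M (2r))` to `Γ(𝓣_{(r,r)})`, computed with any connection in the projective class
and in any chart. -/
def IsSplittingOperator (p : ProjectiveStructure n M) (r : ℕ)
    (𝓛 : symTensors (n := n) M r (2 * r) →ₗ[ℝ] youngTractors (n := n) M r) : Prop :=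
  ∀ k, ∀ D : TorsionFreeConnection n M, p.Contains D → ∀ φ : atlas (Coord n) M,
    ∀ y ∈ φ.1.target, ∀ v,
      (𝓛 k).1 φ y v = splittingFormula (christoffel D φ.1) r (fun z ↦ ⇑(k.1 φ z)) y v

end Main

end ProjTractor

end

/-!
Write `K = Z ⋯ Z k` for the lift of `k` to a cotractor of weight `r`. In the frame given by
coordinates, the connection form of the densities cancels in the Thomas operator, and
`(𝔻 V)(s, u) = w s V + ∇_u V`, where `∇` is the tractor connection alone (`thomas`,
`iterThomasD_eq`). Everything follows from two properties of this connection: `∇_a X = a`, and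
flatness (`IsFlatTractorForm`). Flatness makes the operators `𝔻` commute (`thomas_comm`).

The Killing equation for `k` is `𝔻_{(A} K_{B₁ ⋯ B_r)} = 0` (`symmOver_covDeriv_eq_zero_iff`). For a
Killing tensor, `𝔻^r K` is symmetric in the `r` new indices, as the operators commute, and in the
`r` old ones, and symmetrising the latter with one new index gives zero, so that it has Young
symmetry `(r, r)` (`isYoung_iterThomas`). The Young projection then only multiplies it by
`(r + 1) / 2 ^ r` (`IsYoung.youngProj_apply`). As `𝔻^r K` has weight `0`, its tractor derivative is
`𝔻^{r+1} K`, a tensor symmetric in `r + 1` and in `r` indices whose symmetrisation over the latter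
and one of the former vanishes. Such tensors are zero (`IsMultilin.eq_zero_of_symm_succ`), hence
`𝓛 k` is parallel (`tractorDeriv_iterThomas_eq_zero`).

Contracting the new indices of `𝔻^r K` with `X` gives `r! K` (`iterThomas_apply_one`), so `𝓛` is
injective on Killing tensors. Conversely, contract a parallel `L` with `r` copies of `X`. By the
Young symmetry the result vanishes when one more argument is `X`, so it is the lift of a tensor `k`
on `TM`. Differentiating with `∇L = 0` and `∇_a X = a` shows that each application of `𝔻` replaces
one `X` by the new argument (`iterThomas_withX`). After one step, the Young symmetry gives the
Killing equation (`thomas_withX_diagZero`), and after `r` steps `L` is recovered up to a factor.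

That `𝓛 k` depends neither on the chart nor on the connection in the projective class also uses
flatness. The transition maps of `𝓣` intertwine the tractor connections in two charts modulo `X`, by
the transformation law of the Christoffel symbols, and similarly for two projectively equivalent
connections. The defect is of the form `e_a ⊗ X`. Its covariant exterior derivative vanishes since
both connections are flat, and the component of this derivative in `TM`, given by `∇_a X = a`,
forces `e = 0` if `n ≥ 2` (`gaugeDefect_eq_zero`). No Bianchi identities are needed.
-/


noncomputable section

namespace ProjTractor

/-! ### Symmetry in a set of indices -/

section Symmetry

variable {F : Type*} {m : ℕ}

/-- `T` is invariant under permutations of the indices in `s`. -/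
def SymmOn (s : Finset (Fin m)) (T : (Fin m → F) → ℝ) : Prop :=
  ∀ σ : Equiv.Perm (Fin m), (∀ i, i ∉ s → σ i = i) → ∀ v, T (v ∘ σ) = T v

/-- `T` vanishes whenever all arguments in the positions `s` are equal. -/
def DiagZero (s : Finset (Fin m)) (T : (Fin m → F) → ℝ) : Prop :=
  ∀ x v, (∀ i ∈ s, v i = x) → T v = 0

theorem SymmOn.mono {s t : Finset (Fin m)} {T : (Fin m → F) → ℝ} (h : SymmOn s T) (hts : t ⊆ s) :
    SymmOn t T := fun σ hσ v ↦ h σ (fun i hi ↦ hσ i fun hi' ↦ hi (hts hi')) v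

theorem SymmOn.swap {s : Finset (Fin m)} {T : (Fin m → F) → ℝ} (h : SymmOn s T) {i j : Fin m}
    (hi : i ∈ s) (hj : j ∈ s) (v : Fin m → F) : T (v ∘ Equiv.swap i j) = T v :=
  h _ (fun k hk ↦ Equiv.swap_apply_of_ne_of_ne (by rintro rfl; exact hk hi)
    (by rintro rfl; exact hk hj)) v

/-- A permutation supported in a finite set maps this set to itself. -/
theorem perm_mem {s : Finset (Fin m)} {σ : Equiv.Perm (Fin m)} (hσ : ∀ i, i ∉ s → σ i = i)
    {i : Fin m} (hi : i ∈ s) : σ i ∈ s := by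
  by_contra h
  have h1 := σ.injective (hσ _ h)
  exact h (h1.symm ▸ hi)

/-- Invariance under permutations of `s \ {p}` and under one transposition `(p q)` with `q ∈ s`
gives invariance under permutations of `s`. -/
theorem SymmOn.of_erase {s : Finset (Fin m)} {T : (Fin m → F) → ℝ} {p q : Fin m}
    (h : SymmOn (s.erase p) T) (hq : q ∈ s.erase p)
    (hpq : ∀ v, T (v ∘ Equiv.swap p q) = T v) : SymmOn s T := by
  have hne : ∀ j ∈ s.erase p, ∀ v, T (v ∘ Equiv.swap p j) = T v := by
    intro j hj v
    by_cases hjq : j = q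
    · subst hjq; exact hpq v
    have hj' := Finset.mem_erase.1 hj
    have hq' := Finset.mem_erase.1 hq
    have h1 : Equiv.swap p j = Equiv.swap q j * Equiv.swap p q * Equiv.swap q j := by
      ext i
      simp only [Equiv.Perm.mul_apply, Equiv.swap_apply_def]
      grind
    have h2 : v ∘ ⇑(Equiv.swap p j)
        = ((v ∘ Equiv.swap q j) ∘ Equiv.swap p q) ∘ Equiv.swap q j := by
      rw [h1]; rfl
    rw [h2, h.swap hq hj, hpq, h.swap hq hj]
  intro σ hσ v
  by_cases hp : σ p = p
  · refine h σ (fun i hi ↦ ?_) v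
    by_cases hip : i = p
    · rw [hip, hp]
    · exact hσ i fun hi' ↦ hi (Finset.mem_erase.2 ⟨hip, hi'⟩)
  · have hps : p ∈ s := by
      by_contra hps
      exact hp (hσ p hps)
    have hσp : σ p ∈ s.erase p := Finset.mem_erase.2 ⟨hp, perm_mem hσ hps⟩
    have h1 : v ∘ σ = (v ∘ Equiv.swap p (σ p)) ∘ (Equiv.swap p (σ p) * σ) := by
      funext i; simp
    rw [h1, h, hne _ hσp]
    intro i hi
    by_cases hip : i = p
    · subst hip; simp
    · have his : i ∉ s := fun hi' ↦ hi (Finset.mem_erase.2 ⟨hip, hi'⟩)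
      rw [Equiv.Perm.mul_apply, hσ i his]
      refine Equiv.swap_apply_of_ne_of_ne hip ?_
      rintro rfl
      exact his (perm_mem hσ hps)

theorem card_permsOver (s : Finset (Fin m)) :
    (Finset.univ.filter (fun σ : Equiv.Perm (Fin m) ↦ ∀ i, i ∉ s → σ i = i)).card
      = s.card.factorial := by
  classical
  have h := Fintype.card_congr (Equiv.Perm.subtypeEquivSubtypePerm (fun i ↦ i ∈ s))
  rw [Fintype.card_perm, Fintype.card_coe, Fintype.card_subtype] at h
  rw [h]

theorem symmOver_eq_self {s : Finset (Fin m)} {T : (Fin m → F) → ℝ} (h : SymmOn s T) :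
    symmOver s T = T := by
  funext v
  have h1 : ∀ σ ∈ Finset.univ.filter (fun σ : Equiv.Perm (Fin m) ↦ ∀ i, i ∉ s → σ i = i),
      T (v ∘ σ) = T v := fun σ hσ ↦ h σ (by simpa using hσ) v
  rw [symmOver, Finset.sum_congr rfl h1, Finset.sum_const, card_permsOver, nsmul_eq_mul,
    inv_mul_cancel_left₀ (by positivity)]

theorem symmOn_symmOver (s : Finset (Fin m)) (T : (Fin m → F) → ℝ) : SymmOn s (symmOver s T) := by
  intro σ hσ v
  simp only [symmOver]
  congr 1
  refine Finset.sum_bij' (fun τ _ ↦ σ * τ) (fun τ _ ↦ σ⁻¹ * τ) ?_ ?_ ?_ ?_ ?_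
  · intro τ hτ
    simp only [Finset.mem_filter, Finset.mem_univ, true_and] at hτ ⊢
    intro i hi
    rw [Equiv.Perm.mul_apply, hτ i hi, hσ i hi]
  · intro τ hτ
    simp only [Finset.mem_filter, Finset.mem_univ, true_and] at hτ ⊢
    intro i hi
    rw [Equiv.Perm.mul_apply, hτ i hi, Equiv.Perm.inv_eq_iff_eq, hσ i hi]
  · intro τ _; simp
  · intro τ _; simp
  · intro τ _; rfl

theorem symmOn_iff_symmOver_eq {s : Finset (Fin m)} {T : (Fin m → F) → ℝ} :
    SymmOn s T ↔ symmOver s T = T :=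
  ⟨symmOver_eq_self, fun h ↦ h ▸ symmOn_symmOver s T⟩

theorem symmOver_apply_of_const {s : Finset (Fin m)} {T : (Fin m → F) → ℝ} {x : F}
    {v : Fin m → F} (hv : ∀ i ∈ s, v i = x) : symmOver s T v = T v := by
  have h1 : ∀ σ ∈ Finset.univ.filter (fun σ : Equiv.Perm (Fin m) ↦ ∀ i, i ∉ s → σ i = i),
      T (v ∘ σ) = T v := by
    intro σ hσ
    replace hσ : ∀ i, i ∉ s → σ i = i := by simpa using hσ
    congr 1
    funext i
    by_cases hi : i ∈ s
    · rw [Function.comp_apply, hv i hi, hv _ (perm_mem hσ hi)]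
    · rw [Function.comp_apply, hσ i hi]
  rw [symmOver, Finset.sum_congr rfl h1, Finset.sum_const, card_permsOver, nsmul_eq_mul,
    inv_mul_cancel_left₀ (by positivity)]

end Symmetry

/-! ### Multilinear functions and polarisation -/

section Multilinear

variable {F : Type*} [AddCommGroup F] [Module ℝ F] {m : ℕ}

/-- A function of `m` vectors is multilinear, as a property of unbundled functions. -/
def IsMultilin (T : (Fin m → F) → ℝ) : Prop :=
  ∃ f : MultilinearMap ℝ (fun _ : Fin m ↦ F) ℝ, ⇑f = T

theorem isMultilin_coe (f : MultilinearMap ℝ (fun _ : Fin m ↦ F) ℝ) : IsMultilin ⇑f := ⟨f, rfl⟩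

theorem IsMultilin.update_add {T : (Fin m → F) → ℝ} (h : IsMultilin T) (v : Fin m → F)
    (i : Fin m) (x y : F) : T (Function.update v i (x + y))
      = T (Function.update v i x) + T (Function.update v i y) := by
  obtain ⟨f, rfl⟩ := h
  exact f.map_update_add v i x y

theorem IsMultilin.update_smul {T : (Fin m → F) → ℝ} (h : IsMultilin T) (v : Fin m → F)
    (i : Fin m) (c : ℝ) (x : F) : T (Function.update v i (c • x))
      = c * T (Function.update v i x) := by
  obtain ⟨f, rfl⟩ := h
  exact f.map_update_smul v i c x

theorem IsMultilin.update_sub {T : (Fin m → F) → ℝ} (h : IsMultilin T) (v : Fin m → F)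
    (i : Fin m) (x y : F) : T (Function.update v i (x - y))
      = T (Function.update v i x) - T (Function.update v i y) := by
  obtain ⟨f, rfl⟩ := h
  exact f.map_update_sub v i x y

theorem IsMultilin.zero : IsMultilin (0 : (Fin m → F) → ℝ) := ⟨0, rfl⟩

theorem IsMultilin.add {S T : (Fin m → F) → ℝ} (hS : IsMultilin S) (hT : IsMultilin T) :
    IsMultilin (fun v ↦ S v + T v) := by
  obtain ⟨f, rfl⟩ := hS
  obtain ⟨g, rfl⟩ := hT
  exact ⟨f + g, rfl⟩

theorem IsMultilin.const_mul {T : (Fin m → F) → ℝ} (hT : IsMultilin T) (c : ℝ) :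
    IsMultilin (fun v ↦ c * T v) := by
  obtain ⟨g, rfl⟩ := hT
  exact ⟨c • g, rfl⟩

theorem IsMultilin.sub {S T : (Fin m → F) → ℝ} (hS : IsMultilin S) (hT : IsMultilin T) :
    IsMultilin (fun v ↦ S v - T v) := by
  obtain ⟨f, rfl⟩ := hS
  obtain ⟨g, rfl⟩ := hT
  exact ⟨f - g, rfl⟩

theorem IsMultilin.sum {ι : Type*} (s : Finset ι) {T : ι → (Fin m → F) → ℝ}
    (hT : ∀ i ∈ s, IsMultilin (T i)) : IsMultilin (fun v ↦ ∑ i ∈ s, T i v) := by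
  classical
  induction s using Finset.induction_on with
  | empty => simpa using! (IsMultilin.zero : IsMultilin (0 : (Fin m → F) → ℝ))
  | insert a s ha ih =>
    simp only [Finset.sum_insert ha]
    exact (hT a (by simp)).add (ih fun i hi ↦ hT i (by simp [hi]))

theorem IsMultilin.perm {T : (Fin m → F) → ℝ} (hT : IsMultilin T) (σ : Equiv.Perm (Fin m)) :
    IsMultilin (fun v ↦ T (v ∘ σ)) := by
  obtain ⟨g, rfl⟩ := hT
  exact ⟨g.domDomCongr σ, rfl⟩

theorem IsMultilin.compLinear {G : Type*} [AddCommGroup G] [Module ℝ G] {T : (Fin m → F) → ℝ}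
    (hT : IsMultilin T) (L : Fin m → G →ₗ[ℝ] F) : IsMultilin (fun v ↦ T (fun i ↦ L i (v i))) := by
  obtain ⟨g, rfl⟩ := hT
  exact ⟨g.compLinearMap L, rfl⟩

/-- Replacing the `i`-th vector by its image under a linear map preserves multilinearity. -/
theorem IsMultilin.updateLinear {T : (Fin m → F) → ℝ} (hT : IsMultilin T) (i : Fin m)
    (L : F →ₗ[ℝ] F) : IsMultilin (fun v ↦ T (Function.update v i (L (v i)))) := by
  have h := hT.compLinear (fun j ↦ if j = i then L else LinearMap.id)
  convert h using 3 with v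
  funext j
  by_cases hj : j = i
  · subst hj; simp
  · simp [hj]

theorem IsMultilin.cons {T : (Fin (m + 1) → F) → ℝ} (hT : IsMultilin T) (a : F) :
    IsMultilin (fun v ↦ T (Fin.cons a v)) := by
  obtain ⟨g, rfl⟩ := hT
  exact ⟨g.curryLeft a, rfl⟩

theorem IsMultilin.of_cons {T : (Fin (m + 1) → F) → ℝ}
    (h1 : ∀ a, IsMultilin (fun v ↦ T (Fin.cons a v)))
    (h2 : ∀ v, IsLinearMap ℝ (fun a ↦ T (Fin.cons a v))) : IsMultilin T := by
  choose f hf using h1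
  have hf' : ∀ a v, f a v = T (Fin.cons a v) := fun a v ↦ congrFun (hf a) v
  refine ⟨LinearMap.uncurryLeft
    { toFun := f, map_add' := fun a b ↦ ?_, map_smul' := fun c a ↦ ?_ }, ?_⟩
  · ext v
    simp [hf', (h2 v).map_add]
  · ext v
    simp [hf', (h2 v).map_smul]
  · funext v
    simp [hf', Fin.cons_self_tail]

theorem IsMultilin.map_coord_zero {T : (Fin m → F) → ℝ} (hT : IsMultilin T) {v : Fin m → F}
    (i : Fin m) (h : v i = 0) : T v = 0 := by
  obtain ⟨g, rfl⟩ := hT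
  exact g.map_coord_zero i h

theorem IsMultilin.symmOver {T : (Fin m → F) → ℝ} (hT : IsMultilin T) (s : Finset (Fin m)) :
    IsMultilin (symmOver s T) :=
  (IsMultilin.sum _ fun σ _ ↦ hT.perm σ).const_mul _

theorem IsMultilin.skewOver {T : (Fin m → F) → ℝ} (hT : IsMultilin T) (i j : Fin m) :
    IsMultilin (skewOver i j T) := by
  have h := (hT.sub (hT.perm (Equiv.swap i j))).const_mul (1 / 2)
  convert h using 2 with v
  rw [ProjTractor.skewOver]
  ring

/-- The derivative of a multilinear function along a diagonal on which it vanishes. -/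
theorem IsMultilin.sum_update_eq_zero {T : (Fin m → F) → ℝ} (hT : IsMultilin T)
    {s : Finset (Fin m)} {x : F} {v : Fin m → F} (hv : ∀ i ∈ s, v i = x)
    (h : ∀ y w, (∀ i ∈ s, w i = y) → (∀ i, i ∉ s → w i = v i) → T w = 0)
    (z : F) : ∑ i ∈ s, T (Function.update v i z) = 0 := by
  classical
  obtain ⟨f, rfl⟩ := hT
  -- `t ↦ T (v + t z on s)` is a polynomial whose linear coefficient is the sum in question
  have hexp : ∀ t : ℝ, f (v + fun i ↦ if i ∈ s then t • z else 0) = 0 := fun t ↦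
    h (x + t • z) _ (fun i hi ↦ by simp [hi, hv i hi]) fun i hi ↦ by simp [hi]
  let p : Polynomial ℝ := ∑ u ∈ s.powerset,
    Polynomial.monomial u.card (f (u.piecewise (fun _ ↦ z) v))
  have hp : ∀ t : ℝ, p.eval t = 0 := by
    intro t
    have h1 := hexp t
    rw [add_comm, f.map_add_univ] at h1
    rw [← h1, Polynomial.eval_finsetSum]
    symm
    rw [← Finset.sum_subset (Finset.subset_univ s.powerset)]
    · refine Finset.sum_congr rfl fun u hu ↦ ?_
      have hu' := Finset.mem_powerset.1 hu
      rw [Polynomial.eval_monomial]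
      have h2 : u.piecewise (fun i ↦ if i ∈ s then t • z else 0) v
          = u.piecewise (fun i ↦ (fun _ ↦ t) i • (u.piecewise (fun _ ↦ z) v) i)
            (u.piecewise (fun _ ↦ z) v) := by
        funext i
        by_cases hi : i ∈ u
        · simp [hi, hu' hi]
        · simp [hi]
      rw [h2, f.map_piecewise_smul]
      simp [mul_comm]
    · intro u _ hu
      obtain ⟨i, hi, his⟩ := Finset.not_subset.1 (fun h ↦ hu (Finset.mem_powerset.2 h))
      exact f.map_coord_zero i (by simp [hi, his])
  have hp0 : p = 0 := Polynomial.funext fun t ↦ by simp [hp t]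
  have hc : p.coeff 1 = ∑ i ∈ s, f (Function.update v i z) := by
    simp only [p, Polynomial.finsetSum_coeff, Polynomial.coeff_monomial]
    rw [← Finset.sum_filter]
    symm
    refine Finset.sum_bij (fun i _ ↦ {i}) ?_ ?_ ?_ ?_
    · intro i hi; simp [hi]
    · intro i _ j _ hij; simpa using hij
    · intro u hu
      simp only [Finset.mem_filter, Finset.mem_powerset] at hu
      obtain ⟨i, rfl⟩ := Finset.card_eq_one.1 hu.2
      exact ⟨i, by simpa using hu.1, rfl⟩
    · intro i _
      simp only [Finset.piecewise_singleton]
  rw [← hc, hp0, Polynomial.coeff_zero]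

/-- Polarisation: a multilinear function symmetric in the arguments `s` vanishes at `v` if it
vanishes on the diagonal, for the same values of the other arguments. -/
theorem IsMultilin.apply_eq_zero_of_diag {T : (Fin m → F) → ℝ} (hT : IsMultilin T)
    {s : Finset (Fin m)} (hs : SymmOn s T) (v : Fin m → F)
    (h : ∀ x w, (∀ i ∈ s, w i = x) → (∀ i, i ∉ s → w i = v i) → T w = 0) : T v = 0 := by
  classical
  induction s using Finset.induction_on generalizing v with
  | empty => exact h 0 v (by simp) (by simp)
  | insert a s ha ih =>
    refine ih (hs.mono (Finset.subset_insert _ _)) v fun x u hu hu' ↦ ?_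
    let w := Function.update u a x
    have hw : ∀ i ∈ insert a s, w i = x := by
      intro i hi
      by_cases hia : i = a
      · subst hia; simp [w]
      · simp only [w, Function.update_of_ne hia]
        exact hu i (by simpa [hia] using hi)
    have h1 := hT.sum_update_eq_zero hw (fun y q hq hq' ↦ h y q hq fun i hi ↦ by
      have hia : i ≠ a := by rintro rfl; simp at hi
      rw [hq' i hi, ← hu' i (fun h' ↦ hi (Finset.mem_insert_of_mem h'))]
      simp [w, hia]) (u a)
    have h2 : ∀ i ∈ insert a s, T (Function.update w i (u a)) = T u := by
      intro i hi
      rw [← hs.swap hi (Finset.mem_insert_self a s) u]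
      congr 1
      funext j
      have hj : j ∈ insert a s → j ≠ a → u j = x := fun h h' ↦ hu j (by simpa [h'] using h)
      by_cases hja : j = a
      · subst hja
        by_cases hij : i = j
        · subst hij; simp
        · rw [Function.update_of_ne (Ne.symm hij), Function.comp_apply, Equiv.swap_apply_right,
            hw j (by simp)]
          exact (hu i (by simpa [hij] using hi)).symm
      · by_cases hij : j = i
        · subst hij; simp
        · simp [w, Function.update_of_ne hij, Function.update_of_ne hja,
            Equiv.swap_apply_of_ne_of_ne hij hja]
    rw [Finset.sum_congr rfl h2, Finset.sum_const, nsmul_eq_mul] at h1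
    refine (mul_eq_zero.1 h1).resolve_left ?_
    simp [Finset.card_insert_of_notMem ha]
    positivity

/-- A multilinear function symmetric in the arguments `s` is determined by its values on the
diagonal. -/
theorem IsMultilin.eq_zero_of_diagZero {T : (Fin m → F) → ℝ} (hT : IsMultilin T)
    {s : Finset (Fin m)} (hs : SymmOn s T) (h : DiagZero s T) : T = 0 :=
  funext fun v ↦ hT.apply_eq_zero_of_diag hs v fun x w hw _ ↦ h x w hw

theorem symmOver_eq_zero_iff {T : (Fin m → F) → ℝ} (hT : IsMultilin T) {s : Finset (Fin m)} :
    symmOver s T = 0 ↔ DiagZero s T := by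
  refine ⟨fun h x v hv ↦ ?_, fun h ↦ ?_⟩
  · rw [← symmOver_apply_of_const (T := T) hv, h]; rfl
  · refine (hT.symmOver s).eq_zero_of_diagZero (symmOn_symmOver s T) fun x v hv ↦ ?_
    rw [symmOver_apply_of_const hv, h x v hv]

/-- The Garnir relation: if `T` is symmetric in `s \ {p}` and its symmetrisation over `s` vanishes,
the sum of `T` over the coset representatives `(i p)` vanishes. -/
theorem IsMultilin.garnir {T : (Fin m → F) → ℝ} (hT : IsMultilin T) {s : Finset (Fin m)}
    {p : Fin m} (hs : SymmOn (s.erase p) T) (h : DiagZero s T) (v : Fin m → F) :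
    ∑ i ∈ s, T (v ∘ Equiv.swap i p) = 0 := by
  classical
  by_cases hp : p ∈ s
  swap
  · rw [Finset.erase_eq_of_notMem hp] at hs
    rw [hT.eq_zero_of_diagZero hs h]
    simp
  let R : (Fin m → F) → ℝ := fun v ↦ ∑ i ∈ s, T (v ∘ Equiv.swap i p)
  have hR : IsMultilin R := IsMultilin.sum _ fun i _ ↦ hT.perm _
  have hRs : SymmOn s R := by
    intro σ hσ v
    simp only [R]
    refine Finset.sum_bij (fun i _ ↦ σ i) (fun i hi ↦ perm_mem hσ hi)
      (fun i _ j _ hij ↦ σ.injective hij) (fun j hj ↦ ?_) (fun i hi ↦ ?_)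
    · refine ⟨σ⁻¹ j, ?_, by simp⟩
      by_contra hj'
      have := hσ _ hj'
      rw [← Equiv.Perm.mul_apply, mul_inv_cancel, Equiv.Perm.one_apply] at this
      exact hj' (this ▸ hj)
    · have h1 : (v ∘ σ) ∘ ⇑(Equiv.swap i p)
          = (v ∘ Equiv.swap (σ i) p) ∘ (Equiv.swap (σ i) p * σ * Equiv.swap i p) := by
        funext j; simp
      rw [h1, hs]
      intro j hj
      by_cases hjp : j = p
      · subst hjp; simp
      · have hjs : j ∉ s := fun h ↦ hj (Finset.mem_erase.2 ⟨hjp, h⟩)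
        have hji : j ≠ i := by rintro rfl; exact hjs hi
        simp only [Equiv.Perm.mul_apply]
        rw [Equiv.swap_apply_of_ne_of_ne hji hjp, hσ j hjs]
        refine Equiv.swap_apply_of_ne_of_ne ?_ hjp
        rintro rfl
        exact hjs (perm_mem hσ hi)
  have hR0 : DiagZero s R := by
    intro x v hv
    refine Finset.sum_eq_zero fun i hi ↦ h x _ fun j hj ↦ ?_
    refine hv _ ?_
    rw [Equiv.swap_apply_def]
    split_ifs <;> assumption
  exact congrFun (hR.eq_zero_of_diagZero hRs hR0) v

end Multilinear

/-! ### Rectangular Young symmetry -/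

section Young

variable {F : Type*} {r : ℕ}

/-- The `i`-th index of the first block of `r` indices. -/
def firstPos (i : Fin r) : Fin (r + r) := Fin.castAdd r i

/-- The `i`-th index of the last block of `r` indices. -/
def lastPos (i : Fin r) : Fin (r + r) := Fin.natAdd r i

theorem firstPos_injective : Function.Injective (firstPos (r := r)) :=
  Fin.castAdd_injective r r

theorem lastPos_injective : Function.Injective (lastPos (r := r)) := by
  intro i j h
  simpa [lastPos, Fin.ext_iff] using h

@[simp] theorem firstPos_inj {i j : Fin r} : firstPos i = firstPos j ↔ i = j :=
  firstPos_injective.eq_iff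

@[simp] theorem lastPos_inj {i j : Fin r} : lastPos i = lastPos j ↔ i = j :=
  lastPos_injective.eq_iff

@[simp] theorem firstPos_ne_lastPos (i j : Fin r) : firstPos i ≠ lastPos j := by
  intro h
  have := congrArg Fin.val h
  simp [firstPos, lastPos] at this
  omega

@[simp] theorem lastPos_ne_firstPos (i j : Fin r) : lastPos i ≠ firstPos j :=
  (firstPos_ne_lastPos j i).symm

theorem forall_pos {P : Fin (r + r) → Prop} :
    (∀ i, P i) ↔ (∀ i : Fin r, P (firstPos i)) ∧ ∀ i : Fin r, P (lastPos i) :=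
  ⟨fun h ↦ ⟨fun _ ↦ h _, fun _ ↦ h _⟩, fun h i ↦ Fin.addCases h.1 h.2 i⟩

@[simp] theorem firstPos_mem_firstIdx (i : Fin r) : firstPos i ∈ firstIdx r := by
  simp [firstIdx, firstPos]

@[simp] theorem lastPos_notMem_firstIdx (i : Fin r) : lastPos i ∉ firstIdx r := by
  simp [firstIdx, lastPos]

@[simp] theorem lastPos_mem_lastIdx (i : Fin r) : lastPos i ∈ lastIdx r := by
  simp [lastIdx, lastPos]

@[simp] theorem firstPos_notMem_lastIdx (i : Fin r) : firstPos i ∉ lastIdx r := by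
  simp [lastIdx, firstPos]

theorem firstIdx_eq_map : firstIdx r = Finset.univ.map ⟨firstPos, firstPos_injective⟩ := by
  ext i
  revert i
  rw [forall_pos]
  simp

theorem lastIdx_eq_map : lastIdx r = Finset.univ.map ⟨lastPos, lastPos_injective⟩ := by
  ext i
  revert i
  rw [forall_pos]
  simp

theorem disjoint_firstIdx_lastIdx : Disjoint (firstIdx r) (lastIdx r) := by
  rw [Finset.disjoint_left, forall_pos]
  simp

/-- The permutation exchanging the first `r` and the last `r` of `2r` indices. -/
def blockSwap (r : ℕ) : Equiv.Perm (Fin (r + r)) := finAddFlip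

@[simp] theorem blockSwap_firstPos (i : Fin r) : blockSwap r (firstPos i) = lastPos i :=
  finAddFlip_apply_castAdd i r

@[simp] theorem blockSwap_lastPos (i : Fin r) : blockSwap r (lastPos i) = firstPos i :=
  finAddFlip_apply_natAdd i r

@[simp] theorem blockSwap_blockSwap (i : Fin (r + r)) : blockSwap r (blockSwap r i) = i := by
  revert i
  rw [forall_pos]
  simp

theorem blockSwap_mem_lastIdx {i : Fin (r + r)} : blockSwap r i ∈ lastIdx r ↔ i ∈ firstIdx r := by
  revert i
  rw [forall_pos]
  simp

theorem blockSwap_mem_firstIdx {i : Fin (r + r)} :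
    blockSwap r i ∈ firstIdx r ↔ i ∈ lastIdx r := by
  rw [← blockSwap_mem_lastIdx, blockSwap_blockSwap]

theorem comp_blockSwap_blockSwap (v : Fin (r + r) → F) :
    (v ∘ blockSwap r) ∘ blockSwap r = v := by
  funext i; simp

/-- The arguments equal to `y` in the positions `i ∈ I` of the first block and `x` in the other
positions of the first block, and conversely in the last block. -/
def blockArgs (x y : F) (I : Finset (Fin r)) : Fin (r + r) → F :=
  Fin.append (fun i ↦ if i ∈ I then y else x) (fun i ↦ if i ∈ I then x else y)

@[simp] theorem blockArgs_firstPos (x y : F) (I : Finset (Fin r)) (i : Fin r) :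
    blockArgs x y I (firstPos i) = if i ∈ I then y else x :=
  Fin.append_left _ _ i

@[simp] theorem blockArgs_lastPos (x y : F) (I : Finset (Fin r)) (i : Fin r) :
    blockArgs x y I (lastPos i) = if i ∈ I then x else y :=
  Fin.append_right _ _ i

theorem eq_of_blocks {v w : Fin (r + r) → F} (h1 : ∀ i, v (firstPos i) = w (firstPos i))
    (h2 : ∀ i, v (lastPos i) = w (lastPos i)) : v = w :=
  funext (forall_pos.2 ⟨h1, h2⟩)

theorem blockArgs_univ (x y : F) :
    blockArgs x y (Finset.univ : Finset (Fin r)) = blockArgs x y ∅ ∘ blockSwap r := by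
  refine eq_of_blocks (fun i ↦ ?_) (fun i ↦ ?_) <;> simp

/-- Exchanging two equal arguments of the two blocks. -/
theorem blockArgs_comp_swap_of_notMem (x y : F) {I : Finset (Fin r)} {i j : Fin r} (hi : i ∉ I)
    (hj : j ∈ I) : blockArgs x y I ∘ Equiv.swap (firstPos i) (lastPos j) = blockArgs x y I := by
  refine eq_of_blocks (fun k ↦ ?_) (fun k ↦ ?_)
  · by_cases hk : k = i
    · subst hk; simp [hi, hj]
    · simp [Equiv.swap_apply_def, hk]
  · by_cases hk : k = j
    · subst hk; simp [hi, hj]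
    · simp [Equiv.swap_apply_def, hk]

theorem blockArgs_comp_swap_of_mem (x y : F) {I : Finset (Fin r)} {i j : Fin r} (hi : i ∈ I)
    (hj : j ∈ I) : (blockArgs x y I ∘ Equiv.swap (firstPos i) (lastPos j))
      ∘ Equiv.swap (firstPos i) (firstPos j) = blockArgs x y (I.erase j) := by
  refine eq_of_blocks (fun k ↦ ?_) (fun k ↦ ?_)
  · by_cases hki : k = i
    · subst hki
      by_cases hkj : k = j
      · subst hkj; simp [hj]
      · simp [Equiv.swap_apply_def, hkj, Ne.symm hkj, hi, hj]
    · by_cases hkj : k = j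
      · subst hkj; simp [hj]
      · simp [Equiv.swap_apply_def, hki, hkj]
  · by_cases hkj : k = j
    · subst hkj; simp [Equiv.swap_apply_def, hi]
    · simp [Equiv.swap_apply_def, hkj]

theorem SymmOn.symmOver_of_disjoint {m : ℕ} {s t : Finset (Fin m)} {T : (Fin m → F) → ℝ}
    (h : SymmOn t T) (hst : Disjoint s t) : SymmOn t (symmOver s T) := by
  intro τ hτ v
  simp only [symmOver]
  congr 1
  refine Finset.sum_congr rfl fun σ hσ ↦ ?_
  replace hσ : ∀ i, i ∉ s → σ i = i := by simpa using hσ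
  have h1 : (v ∘ τ) ∘ σ = (v ∘ σ) ∘ τ := by
    funext i
    have hd : Equiv.Perm.Disjoint σ τ := by
      intro i
      by_cases hi : i ∈ s
      · exact Or.inr (hτ i (Finset.disjoint_left.1 hst hi))
      · exact Or.inl (hσ i hi)
    exact congrArg v (DFunLike.congr_fun hd.commute.eq i).symm
  rw [h1, h τ hτ]

end Young

section YoungLinear

variable {F : Type*} [AddCommGroup F] [Module ℝ F] {r : ℕ}

/-- `T` is symmetric in each of the two blocks of `r` indices. -/
structure IsBisymm (T : (Fin (r + r) → F) → ℝ) : Prop where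
  multilin : IsMultilin T
  first : SymmOn (firstIdx r) T
  last : SymmOn (lastIdx r) T

/-- Multilinear functions with Young symmetry `(r, r)`, the Garnir condition being expressed by
vanishing when the first block and one more argument coincide. -/
structure IsYoung (T : (Fin (r + r) → F) → ℝ) : Prop extends IsBisymm T where
  zero : ∀ j : Fin r, DiagZero (insert (lastPos j) (firstIdx r)) T

theorem IsBisymm.comp_blockSwap {T : (Fin (r + r) → F) → ℝ} (h : IsBisymm T) :
    IsBisymm (fun v ↦ T (v ∘ blockSwap r)) where
  multilin := h.multilin.perm _
  first σ hσ v := by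
    have h1 : (v ∘ σ) ∘ blockSwap r = (v ∘ blockSwap r) ∘ (blockSwap r * σ * blockSwap r) := by
      funext i; simp
    simp only [h1]
    rw [ h.last]
    intro i hi
    rw [← blockSwap_mem_firstIdx] at hi
    simp [hσ _ hi]
  last σ hσ v := by
    have h1 : (v ∘ σ) ∘ blockSwap r = (v ∘ blockSwap r) ∘ (blockSwap r * σ * blockSwap r) := by
      funext i; simp
    simp only [h1]
    rw [ h.first]
    intro i hi
    rw [← blockSwap_mem_lastIdx] at hi
    simp [hσ _ hi]

/-- Functions symmetric in both blocks agree if they agree when the arguments in each block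
coincide. -/
theorem IsBisymm.ext {S T : (Fin (r + r) → F) → ℝ} (hS : IsBisymm S) (hT : IsBisymm T)
    (h : ∀ x y, S (blockArgs x y ∅) = T (blockArgs x y ∅)) : S = T := by
  suffices H : (fun v ↦ S v - T v) = 0 by
    funext v
    exact sub_eq_zero.1 (congrFun H v)
  have hm := hS.multilin.sub hT.multilin
  refine hm.eq_zero_of_diagZero (s := firstIdx r)
    (fun σ hσ v ↦ by simp only [hS.first σ hσ v, hT.first σ hσ v]) fun x v hv ↦ ?_
  refine hm.apply_eq_zero_of_diag (s := lastIdx r)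
    (fun σ hσ v ↦ by simp only [hS.last σ hσ v, hT.last σ hσ v]) v fun y w hw hw' ↦ ?_
  have h1 : w = blockArgs x y ∅ := by
    refine eq_of_blocks (fun i ↦ ?_) (fun i ↦ ?_)
    · rw [hw' _ (firstPos_notMem_lastIdx i), hv _ (firstPos_mem_firstIdx i)]; simp
    · rw [hw _ (lastPos_mem_lastIdx i)]; simp
  simp only [h1, h, sub_self]

/-- One step of the computation of `T` on block arguments, from the Garnir relation. -/
theorem IsYoung.blockArgs_erase {T : (Fin (r + r) → F) → ℝ} (h : IsYoung T) (x y : F)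
    {I : Finset (Fin r)} {j : Fin r} (hj : j ∈ I) :
    (1 + (r - I.card : ℝ)) * T (blockArgs x y I) + I.card * T (blockArgs x y (I.erase j)) = 0 := by
  have hg := h.multilin.garnir (s := insert (lastPos j) (firstIdx r)) (p := lastPos j)
    (by rw [Finset.erase_insert (lastPos_notMem_firstIdx j)]; exact h.first) (h.zero j)
    (blockArgs x y I)
  rw [Finset.sum_insert (lastPos_notMem_firstIdx j), firstIdx_eq_map, Finset.sum_map] at hg
  have h1 : ∀ i : Fin r, T (blockArgs x y I ∘ Equiv.swap (firstPos i) (lastPos j))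
      = if i ∈ I then T (blockArgs x y (I.erase j)) else T (blockArgs x y I) := by
    intro i
    split_ifs with hi
    · rw [← h.first.swap (firstPos_mem_firstIdx i) (firstPos_mem_firstIdx j),
        blockArgs_comp_swap_of_mem x y hi hj]
    · rw [blockArgs_comp_swap_of_notMem x y hi hj]
  simp only [Function.Embedding.coeFn_mk] at hg
  rw [Finset.sum_congr rfl (fun i _ ↦ h1 i), Finset.sum_ite, Finset.sum_const, Finset.sum_const,
    Equiv.swap_self] at hg
  have hc : (Finset.univ.filter (fun i ↦ i ∈ I)).card = I.card := by simp
  have hc' : ((Finset.univ.filter (fun i ↦ i ∉ I)).card : ℝ) = r - I.card := by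
    have : Finset.univ.filter (fun i ↦ i ∉ I) = Iᶜ := by ext; simp
    rw [this, Finset.card_compl, Fintype.card_fin,
      Nat.cast_sub (by simpa using Finset.card_le_univ I)]
  rw [nsmul_eq_mul, nsmul_eq_mul, hc, hc'] at hg
  simp only [Equiv.coe_refl, Function.comp_id] at hg
  linarith

/-- Functions with Young symmetry `(r, r)` are determined by `T(x, …, x, y, …, y)`: exchanging
arguments between the blocks costs a sign and a binomial coefficient. -/
theorem IsYoung.apply_blockArgs {T : (Fin (r + r) → F) → ℝ} (h : IsYoung T) (x y : F)
    (I : Finset (Fin r)) :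
    T (blockArgs x y I) = (-1) ^ I.card * ((r.choose I.card : ℝ))⁻¹ * T (blockArgs x y ∅) := by
  induction I using Finset.induction_on with
  | empty => simp
  | insert j I hj ih =>
    have h1 := h.blockArgs_erase x y (Finset.mem_insert_self j I)
    rw [Finset.erase_insert hj, ih, Finset.card_insert_of_notMem hj] at h1
    rw [Finset.card_insert_of_notMem hj]
    have hlt : I.card < r := by
      have := Finset.card_le_univ (insert j I)
      rw [Finset.card_insert_of_notMem hj, Fintype.card_fin] at this
      omega
    have h2 : (r.choose (I.card + 1) : ℝ) * (I.card + 1) = r.choose I.card * (r - I.card) := by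
      rw [← Nat.cast_sub hlt.le]
      exact_mod_cast Nat.choose_succ_right_eq r I.card
    have hp1 : (0 : ℝ) < r.choose (I.card + 1) := by exact_mod_cast Nat.choose_pos hlt
    have hp2 : (0 : ℝ) < r.choose I.card := by exact_mod_cast Nat.choose_pos hlt.le
    have hp3 : (0 : ℝ) < r - I.card := by
      rw [sub_pos]; exact_mod_cast hlt
    have hd : (r - I.card : ℝ) = r.choose (I.card + 1) * (I.card + 1) / r.choose I.card := by
      field_simp; linarith
    push_cast at h1
    rw [show 1 + ((r : ℝ) - (I.card + 1)) = r - I.card by ring] at h1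
    rw [hd] at h1
    rw [pow_succ]
    field_simp at h1 ⊢
    have h3 := (mul_eq_zero.1 (h1.trans (mul_zero _))).resolve_left (Nat.cast_add_one_ne_zero _)
    linarith

/-- Exchanging the two blocks multiplies a function with Young symmetry `(r, r)` by `(-1) ^ r`. -/
theorem IsYoung.apply_comp_blockSwap {T : (Fin (r + r) → F) → ℝ} (h : IsYoung T)
    (v : Fin (r + r) → F) : T (v ∘ blockSwap r) = (-1) ^ r * T v := by
  have h1 : IsBisymm (fun v ↦ (-1) ^ r * T v) :=
    ⟨h.multilin.const_mul _, fun σ hσ v ↦ by simp only [h.first σ hσ],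
      fun σ hσ v ↦ by simp only [h.last σ hσ]⟩
  refine congrFun (h.comp_blockSwap.ext h1 fun x y ↦ ?_) v
  simp only [← blockArgs_univ]
  rw [h.apply_blockArgs]
  simp

/-- The Garnir condition may equivalently be imposed on the last block and one more argument. -/
theorem IsYoung.of_last {T : (Fin (r + r) → F) → ℝ} (h : IsBisymm T)
    (h0 : ∀ j : Fin r, DiagZero (insert (firstPos j) (lastIdx r)) T) : IsYoung T := by
  have h1 : IsYoung (fun v ↦ T (v ∘ blockSwap r)) := by
    refine ⟨h.comp_blockSwap, fun j x v hv ↦ h0 j x _ fun i hi ↦ hv _ ?_⟩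
    rw [Finset.mem_insert] at hi ⊢
    rcases hi with rfl | hi
    · simp
    · exact Or.inr (blockSwap_mem_firstIdx.2 hi)
  have h2 : T = fun v ↦ (-1) ^ r * T (v ∘ blockSwap r) := by
    funext v
    rw [← h1.apply_comp_blockSwap v, comp_blockSwap_blockSwap]
  refine ⟨h, fun j x v hv ↦ ?_⟩
  rw [h2]
  simp only [h1.zero j x v hv, mul_zero]

/-- Young symmetry `(r, r)` forces the vanishing on the last block and one more argument. -/
theorem IsYoung.zero_last {T : (Fin (r + r) → F) → ℝ} (h : IsYoung T) (j : Fin r) :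
    DiagZero (insert (firstPos j) (lastIdx r)) T := by
  intro x v hv
  have h1 := h.apply_comp_blockSwap (v ∘ blockSwap r)
  rw [comp_blockSwap_blockSwap] at h1
  rw [h1, h.zero j x, mul_zero]
  intro i hi
  refine hv _ ?_
  rw [Finset.mem_insert] at hi ⊢
  rcases hi with rfl | hi
  · simp
  · exact Or.inr (blockSwap_mem_lastIdx.2 hi)

end YoungLinear

/-! ### The Young projection -/

section YoungProj

variable {F : Type*} {r : ℕ}

/-- The composition of the skew-symmetrisations over the pairs `(i, r + i)` for `i` in a list. -/
def skewList (l : List (Fin r)) (T : (Fin (r + r) → F) → ℝ) : (Fin (r + r) → F) → ℝ :=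
  l.foldr (fun i S ↦ skewOver (firstPos i) (lastPos i) S) T

theorem youngProj_def (T : (Fin (r + r) → F) → ℝ) : youngProj r T
    = symmOver (firstIdx r) (symmOver (lastIdx r) (skewList (List.finRange r) T)) := rfl

theorem skewList_cons (i : Fin r) (l : List (Fin r)) (T : (Fin (r + r) → F) → ℝ)
    (v : Fin (r + r) → F) : skewList (i :: l) T v
      = (skewList l T v - skewList l T (v ∘ Equiv.swap (firstPos i) (lastPos i))) / 2 := rfl

theorem skewList_eq_zero {l : List (Fin r)} (T : (Fin (r + r) → F) → ℝ) {j : Fin r} (hj : j ∈ l)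
    {v : Fin (r + r) → F} (hv : v (firstPos j) = v (lastPos j)) : skewList l T v = 0 := by
  induction l generalizing v with
  | nil => simp at hj
  | cons i l ih =>
    rw [skewList_cons]
    by_cases hij : i = j
    · subst hij
      have h1 : v ∘ Equiv.swap (firstPos i) (lastPos i) = v := by
        funext k
        rw [Function.comp_apply, Equiv.swap_apply_def]
        split_ifs with h1 h2
        · rw [h1, hv]
        · rw [h2, hv]
        · rfl
      rw [h1]; simp
    · have hjl : j ∈ l := by simpa [Ne.symm hij] using hj
      rw [ih hjl hv, ih hjl]
      · simp
      · simp [Equiv.swap_apply_def, Ne.symm hij, hv]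

theorem blockArgs_comp_swap_self (x y : F) {I : Finset (Fin r)} {i : Fin r} (hi : i ∉ I) :
    blockArgs x y I ∘ Equiv.swap (firstPos i) (lastPos i) = blockArgs x y (insert i I) := by
  refine eq_of_blocks (fun k ↦ ?_) (fun k ↦ ?_)
  all_goals
    by_cases hk : k = i
    · subst hk; simp [hi]
    · simp [Equiv.swap_apply_def, hk]

/-- Each skew-symmetrisation either leaves a pair of arguments alone or exchanges it, with a
sign. -/
theorem skewList_blockArgs (T : (Fin (r + r) → F) → ℝ) (x y : F) (l : List (Fin r))
    (hl : l.Nodup) (I : Finset (Fin r)) (hI : ∀ i ∈ l, i ∉ I) :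
    skewList l T (blockArgs x y I) = ((2 : ℝ) ^ l.length)⁻¹ *
      ∑ J ∈ l.toFinset.powerset, (-1) ^ J.card * T (blockArgs x y (I ∪ J)) := by
  induction l generalizing I with
  | nil => simp [skewList]
  | cons i l ih =>
    have hil : i ∉ l.toFinset := by simpa using (List.nodup_cons.1 hl).1
    rw [skewList_cons, blockArgs_comp_swap_self x y (hI i (by simp)),
      ih (List.nodup_cons.1 hl).2 I (fun j hj ↦ hI j (by simp [hj])),
      ih (List.nodup_cons.1 hl).2 (insert i I) (fun j hj ↦ ?_), List.toFinset_cons,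
      Finset.sum_powerset_insert hil, List.length_cons, pow_succ]
    · have h1 : ∀ J ∈ l.toFinset.powerset, (-1 : ℝ) ^ (insert i J).card
          * T (blockArgs x y (I ∪ insert i J))
          = - ((-1) ^ J.card * T (blockArgs x y (insert i I ∪ J))) := by
        intro J hJ
        have hiJ : i ∉ J := fun h ↦ hil (Finset.mem_powerset.1 hJ h)
        rw [Finset.card_insert_of_notMem hiJ, pow_succ, Finset.union_insert, Finset.insert_union]
        ring
      rw [Finset.sum_congr rfl h1, Finset.sum_neg_distrib]
      ring
    · have hji : j ≠ i := by rintro rfl; exact (List.nodup_cons.1 hl).1 hj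
      simp [hji, hI j (by simp [hj])]

variable [AddCommGroup F] [Module ℝ F]

theorem IsMultilin.skewList {T : (Fin (r + r) → F) → ℝ} (hT : IsMultilin T) (l : List (Fin r)) :
    IsMultilin (skewList l T) := by
  induction l with
  | nil => exact hT
  | cons i l ih => exact ih.skewOver _ _

theorem IsMultilin.isBisymm_youngProj {T : (Fin (r + r) → F) → ℝ} (hT : IsMultilin T) :
    IsBisymm (youngProj r T) where
  multilin := ((hT.skewList _).symmOver _).symmOver _
  first := symmOn_symmOver _ _
  last := (symmOn_symmOver _ _).symmOver_of_disjoint disjoint_firstIdx_lastIdx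

/-- The Young projection takes values in the functions with Young symmetry: after symmetrisation
over the first block, an argument of the last block equal to all the arguments of the first block
can be moved into every position, where one of the skew-symmetrisations annihilates it. -/
theorem IsMultilin.isYoung_youngProj {T : (Fin (r + r) → F) → ℝ} (hT : IsMultilin T) :
    IsYoung (youngProj r T) := by
  refine ⟨hT.isBisymm_youngProj, fun j x v hv ↦ ?_⟩
  rw [youngProj_def, symmOver_apply_of_const (x := x) (fun i hi ↦ hv i (by simp [hi])),
    ProjTractor.symmOver,
    Finset.sum_eq_zero, mul_zero]
  intro σ hσ
  replace hσ : ∀ i, i ∉ lastIdx r → σ i = i := by simpa using hσ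
  obtain ⟨k, hk⟩ : ∃ k : Fin r, σ (lastPos k) = lastPos j := by
    have h1 : σ⁻¹ (lastPos j) ∈ lastIdx r :=
      perm_mem (fun i hi ↦ by rw [Equiv.Perm.inv_eq_iff_eq, hσ i hi]) (lastPos_mem_lastIdx j)
    rw [lastIdx_eq_map] at h1
    obtain ⟨k, -, hk⟩ := Finset.mem_map.1 h1
    refine ⟨k, ?_⟩
    rw [Function.Embedding.coeFn_mk] at hk
    rw [hk]; simp
  refine skewList_eq_zero T (List.mem_finRange k) ?_
  rw [Function.comp_apply, Function.comp_apply, hk, hσ _ (firstPos_notMem_lastIdx k),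
    hv _ (by simp), hv _ (by simp)]

/-- The Young projection acts on its image as multiplication by `(r + 1) / 2 ^ r`. -/
theorem IsYoung.youngProj_apply {T : (Fin (r + r) → F) → ℝ} (h : IsYoung T)
    (v : Fin (r + r) → F) : youngProj r T v = (r + 1) / 2 ^ r * T v := by
  have h1 : IsBisymm (fun v ↦ ((r : ℝ) + 1) / 2 ^ r * T v) :=
    ⟨h.multilin.const_mul _, fun σ hσ v ↦ by simp only [h.first σ hσ],
      fun σ hσ v ↦ by simp only [h.last σ hσ]⟩
  refine congrFun (h.multilin.isBisymm_youngProj.ext h1 fun x y ↦ ?_) v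
  rw [youngProj_def, symmOver_apply_of_const (x := x), symmOver_apply_of_const (x := y),
    skewList_blockArgs T x y _ (List.nodup_finRange r) ∅ (by simp)]
  · simp only [Finset.empty_union, List.length_finRange, List.toFinset_finRange]
    have h2 : ∀ J ∈ (Finset.univ : Finset (Fin r)).powerset,
        (-1 : ℝ) ^ J.card * T (blockArgs x y J)
          = (fun k ↦ ((r.choose k : ℝ))⁻¹ * T (blockArgs x y ∅)) J.card := by
      intro J _
      rw [h.apply_blockArgs, ← mul_assoc, ← mul_assoc, ← mul_pow]
      simp
    rw [Finset.sum_congr rfl h2, Finset.sum_powerset_apply_card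
      (fun k ↦ ((r.choose k : ℝ))⁻¹ * T (blockArgs x y ∅)), Finset.card_univ, Fintype.card_fin]
    have h3 : ∀ k ∈ Finset.range (r + 1), r.choose k • (((r.choose k : ℝ))⁻¹
        * T (blockArgs x y ∅)) = T (blockArgs x y ∅) := by
      intro k hk
      have : (0 : ℝ) < r.choose k := by
        exact_mod_cast Nat.choose_pos (Nat.lt_succ_iff.1 (Finset.mem_range.1 hk))
      rw [nsmul_eq_mul, mul_inv_cancel_left₀ this.ne']
    rw [Finset.sum_congr rfl h3]
    simp
    ring
  · intro i hi
    rw [lastIdx_eq_map] at hi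
    obtain ⟨k, -, rfl⟩ := Finset.mem_map.1 hi
    simp
  · intro i hi
    rw [firstIdx_eq_map] at hi
    obtain ⟨k, -, rfl⟩ := Finset.mem_map.1 hi
    simp

theorem firstSuccIdx_eq (hr : 0 < r) :
    firstSuccIdx r = insert (lastPos ⟨0, hr⟩) (firstIdx r) := by
  ext i
  simp only [firstSuccIdx, firstIdx, lastPos, Finset.mem_filter, Finset.mem_univ, true_and,
    Finset.mem_insert, Fin.ext_iff]
  simp
  omega

theorem hasYoungSymmetry_iff {T : (Fin (r + r) → F) → ℝ} (hr : 0 < r) (hT : IsMultilin T) :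
    HasYoungSymmetry r T ↔ IsYoung T := by
  rw [HasYoungSymmetry, ← symmOn_iff_symmOver_eq, ← symmOn_iff_symmOver_eq,
    symmOver_eq_zero_iff hT, firstSuccIdx_eq hr]
  refine ⟨fun h ↦ ⟨⟨hT, h.1, h.2.1⟩, fun j x v hv ↦ ?_⟩, fun h ↦ ⟨h.first, h.last, h.zero _⟩⟩
  rw [← h.2.1.swap (lastPos_mem_lastIdx ⟨0, hr⟩) (lastPos_mem_lastIdx j)]
  refine h.2.2 x _ fun i hi ↦ ?_
  rw [firstIdx_eq_map] at hv hi
  rw [Finset.mem_insert, Finset.mem_map] at hi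
  obtain rfl | ⟨k, -, rfl⟩ := hi
  · simpa using hv (lastPos j) (by simp)
  · simpa [Equiv.swap_apply_def] using hv (firstPos k) (by simp)

end YoungProj

/-! ### Adding an index in front -/

section Succ

variable {F : Type*} {m : ℕ}

/-- The permutation of `m + 1` indices that fixes the index `0` and acts by `σ` on the others. -/
def succPerm (σ : Equiv.Perm (Fin m)) : Equiv.Perm (Fin (m + 1)) :=
  Equiv.Perm.decomposeFin.symm (0, σ)

@[simp] theorem succPerm_zero (σ : Equiv.Perm (Fin m)) : succPerm σ 0 = 0 := by
  simp [succPerm]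

@[simp] theorem succPerm_succ (σ : Equiv.Perm (Fin m)) (i : Fin m) :
    succPerm σ i.succ = (σ i).succ := by
  simp [succPerm]

theorem exists_eq_succPerm {τ : Equiv.Perm (Fin (m + 1))} (h : τ 0 = 0) :
    ∃ σ, τ = succPerm σ := by
  obtain ⟨⟨p, σ⟩, rfl⟩ := Equiv.Perm.decomposeFin.symm.surjective τ
  rw [Equiv.Perm.decomposeFin_symm_apply_zero] at h
  exact ⟨σ, by rw [h]; rfl⟩

theorem cons_comp_succPerm (a : F) (v : Fin m → F) (σ : Equiv.Perm (Fin m)) :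
    (Fin.cons a v : Fin (m + 1) → F) ∘ succPerm σ = Fin.cons a (v ∘ σ) := by
  funext i
  refine Fin.cases ?_ (fun i ↦ ?_) i <;> simp

theorem symmOn_map_succ {s : Finset (Fin m)} {T : (Fin (m + 1) → F) → ℝ} :
    SymmOn (s.map (Fin.succEmb m)) T ↔ ∀ a, SymmOn s (fun v ↦ T (Fin.cons a v)) := by
  constructor
  · intro h a σ hσ v
    simp only [← cons_comp_succPerm]
    refine h _ (fun i hi ↦ ?_) _
    revert hi
    refine Fin.cases (by simp) (fun i hi ↦ ?_) i
    rw [succPerm_succ, hσ i (by simpa using hi)]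
  · intro h τ hτ v
    obtain ⟨σ, rfl⟩ := exists_eq_succPerm (hτ 0 (by simp))
    rw [← Fin.cons_self_tail v, cons_comp_succPerm]
    refine h _ σ (fun i hi ↦ ?_) _
    have := hτ i.succ (by simpa using hi)
    simpa using this

theorem SymmOn.comp_perm {s : Finset (Fin m)} {T : (Fin m → F) → ℝ} (h : SymmOn s T)
    (τ : Equiv.Perm (Fin m)) : SymmOn (s.map τ.toEmbedding) (fun v ↦ T (v ∘ τ)) := by
  intro σ hσ v
  have h1 : (v ∘ σ) ∘ τ = (v ∘ τ) ∘ (τ⁻¹ * σ * τ) := by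
    funext i; simp
  simp only [h1]
  refine h _ (fun i hi ↦ ?_) _
  rw [Equiv.Perm.mul_apply, Equiv.Perm.mul_apply, hσ (τ i) (by simpa using hi)]
  simp

variable [AddCommGroup F] [Module ℝ F] {r : ℕ}

/-- A tensor symmetric in `r + 1` indices and in `r` further indices, whose symmetrisation over the
latter and one of the former vanishes, is zero. By `IsYoung.apply_comp_blockSwap` the first index
can be exchanged for an index of either block, so that it is symmetric in the first index together
with the last block. -/
theorem IsMultilin.eq_zero_of_symm_succ {V : (Fin (r + r + 1) → F) → ℝ} (hV : IsMultilin V)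
    (h1 : SymmOn (insert 0 ((firstIdx r).map (Fin.succEmb _))) V)
    (h2 : ∀ a, SymmOn (lastIdx r) (fun v ↦ V (Fin.cons a v)))
    (h3 : DiagZero (insert 0 ((lastIdx r).map (Fin.succEmb _))) V) : V = 0 := by
  have hY : ∀ a, IsYoung (fun v ↦ V (Fin.cons a v)) := by
    intro a
    refine IsYoung.of_last ⟨hV.cons a,
      symmOn_map_succ.1 (h1.mono (Finset.subset_insert _ _)) a, h2 a⟩ fun j x v hv ↦ ?_
    have hj : (firstPos j).succ ∈ insert 0 ((firstIdx r).map (Fin.succEmb (r + r))) := by simp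
    rw [← h1.swap (Finset.mem_insert_self _ _) hj]
    refine h3 x _ fun i hi ↦ ?_
    rw [Finset.mem_insert, Finset.mem_map] at hi
    obtain rfl | ⟨i, hi, rfl⟩ := hi
    · simpa using hv (firstPos j) (by simp)
    · have hne : i ≠ firstPos j := by rintro rfl; simp at hi
      simpa [Equiv.swap_apply_def, hne] using hv i (by simp [hi])
  have h4 : ∀ v, V (v ∘ succPerm (blockSwap r)) = (-1) ^ r * V v := by
    intro v
    rw [← Fin.cons_self_tail v, cons_comp_succPerm]
    exact (hY _).apply_comp_blockSwap _
  -- exchanging the blocks turns the symmetry `h1` into symmetry in the indices of `h3`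
  refine hV.eq_zero_of_diagZero (fun σ hσ v ↦ ?_) h3
  have h5 := h1.comp_perm (succPerm (blockSwap r)) σ (fun i hi ↦ hσ i ?_) v
  · simp only [h4] at h5
    exact mul_left_cancel₀ (by simp) h5
  · contrapose! hi
    rw [Finset.mem_insert, Finset.mem_map] at hi
    obtain rfl | ⟨i, hi, rfl⟩ := hi
    · exact Finset.mem_map.2 ⟨0, by simp, by simp⟩
    · refine Finset.mem_map.2 ⟨(blockSwap r i).succ, ?_, by simp⟩
      simpa using blockSwap_mem_firstIdx.2 hi

end Succ

/-! ### Smooth tensor fields on an open set -/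

section SmoothTensor

variable {n : ℕ} {F : Type*} [NormedAddCommGroup F] [NormedSpace ℝ F] {m : ℕ}

/-- `V` is, over `U`, a smooth field of multilinear functions. -/
structure IsSmoothTensor (U : Set (Coord n)) (V : Coord n → (Fin m → F) → ℝ) : Prop where
  smooth : ∀ v, ContDiffOn ℝ ∞ (fun y ↦ V y v) U
  multilin : ∀ y ∈ U, IsMultilin (V y)

theorem IsMultilin.expand {ι : Type*} [Fintype ι] (b : Module.Basis ι ℝ F) {T : (Fin m → F) → ℝ}
    (hT : IsMultilin T) (v : Fin m → F) :
    T v = ∑ κ : Fin m → ι, (∏ i, b.equivFun (v i) (κ i)) * T (fun i ↦ b (κ i)) := by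
  obtain ⟨f, rfl⟩ := hT
  have h1 : v = fun i ↦ ∑ k, b.equivFun (v i) k • b k := by
    funext i
    rw [b.sum_equivFun]
  conv_lhs => rw [h1, f.map_sum]
  refine Finset.sum_congr rfl fun κ _ ↦ ?_
  rw [f.map_smul_univ (fun i ↦ b.equivFun (v i) (κ i)) (fun i ↦ b (κ i)), smul_eq_mul]

theorem IsSmoothTensor.differentiableAt {U : Set (Coord n)} (hU : IsOpen U)
    {V : Coord n → (Fin m → F) → ℝ} (hV : IsSmoothTensor U V) {y : Coord n} (hy : y ∈ U)
    (v : Fin m → F) : DifferentiableAt ℝ (fun z ↦ V z v) y :=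
  ((hV.smooth v).contDiffAt (hU.mem_nhds hy)).differentiableAt (by simp)

/-- The derivative of a multilinear function in a parameter is multilinear. -/
theorem IsSmoothTensor.isMultilin_fderiv {U : Set (Coord n)} (hU : IsOpen U)
    {V : Coord n → (Fin m → F) → ℝ} (hV : IsSmoothTensor U V) {y : Coord n} (hy : y ∈ U)
    (a : Coord n) : IsMultilin (fun v ↦ fderiv ℝ (fun z ↦ V z v) y a) := by
  have hm : ∀ᶠ z in 𝓝 y, IsMultilin (V z) :=
    Filter.mem_of_superset (hU.mem_nhds hy) fun z hz ↦ hV.multilin z hz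
  refine ⟨{ toFun := fun v ↦ fderiv ℝ (fun z ↦ V z v) y a, map_update_add' := ?_,
            map_update_smul' := ?_ }, rfl⟩
  · intro dec v i x x'
    obtain rfl : dec = instDecidableEqFin m := Subsingleton.elim _ _
    have h : (fun z ↦ V z (Function.update v i (x + x'))) =ᶠ[𝓝 y]
        (fun z ↦ V z (Function.update v i x) + V z (Function.update v i x')) := by
      filter_upwards [hm] with z hz using hz.update_add v i x x'
    rw [h.fderiv_eq, fderiv_fun_add (hV.differentiableAt hU hy _) (hV.differentiableAt hU hy _)]
    rfl
  · intro dec v i c x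
    obtain rfl : dec = instDecidableEqFin m := Subsingleton.elim _ _
    have h : (fun z ↦ V z (Function.update v i (c • x))) =ᶠ[𝓝 y]
        (fun z ↦ c * V z (Function.update v i x)) := by
      filter_upwards [hm] with z hz using hz.update_smul v i c x
    rw [h.fderiv_eq, fderiv_const_mul (hV.differentiableAt hU hy _)]
    rfl

variable [FiniteDimensional ℝ F]

theorem contDiff_equivFun {ι : Type*} [Fintype ι] (b : Module.Basis ι ℝ F) (k : ι) :
    ContDiff ℝ ∞ (fun x ↦ b.equivFun x k) :=
  ((LinearMap.proj k ∘ₗ b.equivFun.toLinearMap).toContinuousLinearMap).contDiff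

/-- Inserting smooth functions into the arguments of a smooth tensor field gives a smooth
function. -/
theorem IsSmoothTensor.contDiffOn_comp {U : Set (Coord n)} {V : Coord n → (Fin m → F) → ℝ}
    (hV : IsSmoothTensor U V) {E : Type*} [NormedAddCommGroup E] [NormedSpace ℝ E] {s : Set E}
    {g : E → Coord n} (hg : ContDiffOn ℝ ∞ g s) (hgU : MapsTo g s U) {f : Fin m → E → F}
    (hf : ∀ i, ContDiffOn ℝ ∞ (f i) s) :
    ContDiffOn ℝ ∞ (fun e ↦ V (g e) (fun i ↦ f i e)) s := by
  let b := Module.finBasis ℝ F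
  have h1 : ContDiffOn ℝ ∞ (fun e ↦ ∑ κ : Fin m → Fin (Module.finrank ℝ F),
      (∏ i, b.equivFun (f i e) (κ i)) * V (g e) (fun i ↦ b (κ i))) s := by
    refine ContDiffOn.sum fun κ _ ↦ ContDiffOn.mul (contDiffOn_prod fun i _ ↦ ?_) ?_
    · exact (contDiff_equivFun b (κ i)).comp_contDiffOn (hf i)
    · exact (hV.smooth _).comp hg hgU
  exact h1.congr fun e he ↦ (hV.multilin _ (hgU he)).expand b _

theorem IsMultilin.hasFDerivAt {T : (Fin m → F) → ℝ} (hT : IsMultilin T)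
    {E : Type*} [NormedAddCommGroup E] [NormedSpace ℝ E] {f : Fin m → E → F} {x : E}
    (hf : ∀ i, DifferentiableAt ℝ (f i) x) (a : E) :
    fderiv ℝ (fun e ↦ T (fun i ↦ f i e)) x a
      = ∑ i, T (Function.update (fun i ↦ f i x) i (fderiv ℝ (f i) x a)) := by
  have hc : Continuous T := by
    let b := Module.finBasis ℝ F
    have : T = fun v ↦ ∑ κ : Fin m → Fin (Module.finrank ℝ F),
        (∏ i, b.equivFun (v i) (κ i)) * T (fun i ↦ b (κ i)) := funext fun v ↦ hT.expand b v
    rw [this]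
    refine continuous_finsetSum _ fun κ _ ↦ Continuous.mul
      (continuous_finsetProd _ fun i _ ↦ ?_) continuous_const
    exact (contDiff_equivFun b (κ i)).continuous.comp (continuous_apply i)
  obtain ⟨g, rfl⟩ := hT
  let G : ContinuousMultilinearMap ℝ (fun _ : Fin m ↦ F) ℝ := ⟨g, hc⟩
  have h := HasFDerivAt.multilinear_comp G (fun i ↦ (hf i).hasFDerivAt)
  have h1 : fderiv ℝ (fun e ↦ g (fun i ↦ f i e)) x = _ := h.fderiv
  rw [h1]
  simp [G]
  rfl

/-- The product rule for a smooth tensor field with functions inserted into its arguments. -/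
theorem IsSmoothTensor.fderiv_comp {U : Set (Coord n)} (hU : IsOpen U)
    {V : Coord n → (Fin m → F) → ℝ} (hV : IsSmoothTensor U V) {y : Coord n} (hy : y ∈ U)
    {f : Fin m → Coord n → F} (hf : ∀ i, ContDiffOn ℝ ∞ (f i) U) (a : Coord n) :
    fderiv ℝ (fun z ↦ V z (fun i ↦ f i z)) y a
      = fderiv ℝ (fun z ↦ V z (fun i ↦ f i y)) y a
        + ∑ i, V y (Function.update (fun i ↦ f i y) i (fderiv ℝ (f i) y a)) := by
  -- differentiate `(z, z') ↦ V z (f z')` along the diagonal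
  let H : Coord n × Coord n → ℝ := fun p ↦ V p.1 (fun i ↦ f i p.2)
  have hH : DifferentiableAt ℝ H (y, y) := by
    have h1 : ContDiffOn ℝ ∞ H (U ×ˢ U) :=
      hV.contDiffOn_comp contDiff_fst.contDiffOn (fun p hp ↦ hp.1)
        (fun i ↦ (hf i).comp contDiff_snd.contDiffOn (fun p hp ↦ hp.2))
    exact (h1.contDiffAt ((hU.prod hU).mem_nhds ⟨hy, hy⟩)).differentiableAt (by simp)
  have hd : HasFDerivAt (fun z : Coord n ↦ (z, z))
      ((ContinuousLinearMap.id ℝ _).prod (ContinuousLinearMap.id ℝ _)) y :=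
    (hasFDerivAt_id y).prodMk (hasFDerivAt_id y)
  have hl : HasFDerivAt (fun z : Coord n ↦ (z, y))
      ((ContinuousLinearMap.id ℝ _).prod (0 : Coord n →L[ℝ] Coord n)) y :=
    (hasFDerivAt_id y).prodMk (hasFDerivAt_const y y)
  have hr : HasFDerivAt (fun z : Coord n ↦ (y, z))
      ((0 : Coord n →L[ℝ] Coord n).prod (ContinuousLinearMap.id ℝ _)) y :=
    (hasFDerivAt_const y y).prodMk (hasFDerivAt_id y)
  have e1 : fderiv ℝ (fun z ↦ V z (fun i ↦ f i z)) y = _ :=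
    (HasFDerivAt.comp y (g := H) (f := fun z : Coord n ↦ (z, z)) hH.hasFDerivAt hd).fderiv
  have e2 : fderiv ℝ (fun z ↦ V z (fun i ↦ f i y)) y = _ :=
    (HasFDerivAt.comp y (g := H) (f := fun z : Coord n ↦ (z, y)) hH.hasFDerivAt hl).fderiv
  have e3 : fderiv ℝ (fun z ↦ V y (fun i ↦ f i z)) y = _ :=
    (HasFDerivAt.comp y (g := H) (f := fun z : Coord n ↦ (y, z)) hH.hasFDerivAt hr).fderiv
  rw [← (hV.multilin y hy).hasFDerivAt
    (fun i ↦ ((hf i).contDiffAt (hU.mem_nhds hy)).differentiableAt (by simp)), e1, e2, e3]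
  simp only [ContinuousLinearMap.comp_apply, ContinuousLinearMap.prod_apply,
    ContinuousLinearMap.id_apply, zero_apply]
  rw [← map_add]
  simp

theorem IsSmoothTensor.contDiffOn_update {U : Set (Coord n)} {V : Coord n → (Fin m → F) → ℝ}
    (hV : IsSmoothTensor U V) (v : Fin m → F) (i : Fin m) {f : Coord n → F}
    (hf : ContDiffOn ℝ ∞ f U) : ContDiffOn ℝ ∞ (fun y ↦ V y (Function.update v i (f y))) U := by
  have h := hV.contDiffOn_comp contDiffOn_id (mapsTo_id U)
    (f := fun j y ↦ Function.update v i (f y) j) (fun j ↦ ?_)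
  · exact h
  · by_cases hj : j = i
    · subst hj; simpa using hf
    · simpa [hj] using contDiffOn_const

theorem IsSmoothTensor.fderiv_update {U : Set (Coord n)} (hU : IsOpen U)
    {V : Coord n → (Fin m → F) → ℝ} (hV : IsSmoothTensor U V) {y : Coord n} (hy : y ∈ U)
    (v : Fin m → F) (i : Fin m) {f : Coord n → F} (hf : ContDiffOn ℝ ∞ f U) (a : Coord n) :
    fderiv ℝ (fun z ↦ V z (Function.update v i (f z))) y a
      = fderiv ℝ (fun z ↦ V z (Function.update v i (f y))) y a
        + V y (Function.update v i (fderiv ℝ f y a)) := by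
  have h := hV.fderiv_comp hU hy
    (f := fun j y ↦ Function.update v i (f y) j) (fun j ↦ ?_) a
  · have h1 : ∑ j, V y (Function.update (fun j ↦ Function.update v i (f y) j) j
        (fderiv ℝ (fun y ↦ Function.update v i (f y) j) y a))
        = V y (Function.update v i (fderiv ℝ f y a)) := by
      rw [Finset.sum_eq_single i]
      · simp
      · intro j _ hj
        refine (hV.multilin y hy).map_coord_zero j ?_
        simp [hj]
      · simp
    rw [h1] at h
    exact h
  · by_cases hj : j = i
    · subst hj; simpa using hf
    · simpa [hj] using contDiffOn_const

end SmoothTensor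

/-! ### The Thomas operator of a tractor connection form -/

section BilinearField

variable {E F G : Type*} [NormedAddCommGroup E] [NormedSpace ℝ E] [NormedAddCommGroup F]
  [NormedSpace ℝ F] [NormedAddCommGroup G] [NormedSpace ℝ G] {U : Set E} {A : E → E →L[ℝ] F →L[ℝ] G}

theorem contDiffOn_clm_apply₂ (hA : ContDiffOn ℝ ∞ A U) (a : E) (v : F) :
    ContDiffOn ℝ ∞ (fun y ↦ A y a v) U :=
  (hA.clm_apply contDiffOn_const).clm_apply contDiffOn_const

theorem fderiv_clm_apply₂ (hU : IsOpen U) (hA : ContDiffOn ℝ ∞ A U) {y : E} (hy : y ∈ U)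
    (a b : E) (v : F) : fderiv ℝ (fun z ↦ A z b v) y a = fderiv ℝ A y a b v := by
  have h : HasFDerivAt A (fderiv ℝ A y) y :=
    ((hA.contDiffAt (hU.mem_nhds hy)).differentiableAt (by simp)).hasFDerivAt
  have h1 := (h.clm_apply (hasFDerivAt_const b y)).clm_apply (hasFDerivAt_const v y)
  rw [h1.fderiv]
  simp

end BilinearField

section Thomas

variable {n : ℕ} {m : ℕ}

/-- The covariant derivative `∇_a V` of a tractor field for the connection `∂ + A` on `𝓣`. -/
def tractorDeriv (A : Coord n → Coord n →L[ℝ] Tr n →L[ℝ] Tr n) (V : Coord n → (Fin m → Tr n) → ℝ)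
    (y a : Coord n) (v : Fin m → Tr n) : ℝ :=
  fderiv ℝ (fun z ↦ V z v) y a - ∑ i, V y (Function.update v i (A y a (v i)))

/-- The Thomas operator on tractors of weight `w`. In the frame given by the coordinates, the
connection form of the density bundle cancels against the one in the splitting `Y`, so that only
the tractor connection form `A` is left. -/
def thomas (A : Coord n → Coord n →L[ℝ] Tr n →L[ℝ] Tr n) (w : ℝ)
    (V : Coord n → (Fin m → Tr n) → ℝ) (y : Coord n) (v : Fin (m + 1) → Tr n) : ℝ :=
  w * (v 0).1 * V y (Fin.tail v) + tractorDeriv A V y (v 0).2 (Fin.tail v)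

/-- The iterates of the Thomas operator. -/
def iterThomas (A : Coord n → Coord n →L[ℝ] Tr n →L[ℝ] Tr n) (w : ℝ)
    (V : Coord n → (Fin m → Tr n) → ℝ) : (j : ℕ) → Coord n → (Fin (m + j) → Tr n) → ℝ
  | 0 => V
  | j + 1 => thomas A (w - j) (iterThomas A w V j)

/-- `A` is the connection form, over `U`, of a flat smooth connection on `𝓣` with the property
`∇_a X = a` of tractor connections. -/
structure IsFlatTractorForm (U : Set (Coord n)) (A : Coord n → Coord n →L[ℝ] Tr n →L[ℝ] Tr n) :
    Prop where
  isOpen : IsOpen U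
  smooth : ContDiffOn ℝ ∞ A U
  apply_one : ∀ y ∈ U, ∀ a, A y a (1, 0) = (0, a)
  flat : ∀ y ∈ U, ∀ a b v, fderiv ℝ A y a b v - fderiv ℝ A y b a v
    + A y a (A y b v) - A y b (A y a v) = 0

variable {U : Set (Coord n)} {A : Coord n → Coord n →L[ℝ] Tr n →L[ℝ] Tr n}
  {V : Coord n → (Fin m → Tr n) → ℝ}

theorem thomas_cons (w : ℝ) (y : Coord n) (a : Tr n) (v : Fin m → Tr n) :
    thomas A w V y (Fin.cons a v) = w * a.1 * V y v + tractorDeriv A V y a.2 v := by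
  simp [thomas]

theorem isMultilin_tractorDeriv (hV : IsSmoothTensor U V) (hU : IsOpen U) {y : Coord n}
    (hy : y ∈ U) (a : Coord n) : IsMultilin (tractorDeriv A V y a) := by
  exact (hV.isMultilin_fderiv hU hy a).sub (IsMultilin.sum _ fun i _ ↦
    (hV.multilin y hy).updateLinear i (A y a).toLinearMap)

theorem tractorDeriv_add_dir (hV : IsSmoothTensor U V) {y : Coord n}
    (hy : y ∈ U) (a b : Coord n) (v : Fin m → Tr n) :
    tractorDeriv A V y (a + b) v = tractorDeriv A V y a v + tractorDeriv A V y b v := by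
  simp only [tractorDeriv, map_add, add_apply, (hV.multilin y hy).update_add,
    Finset.sum_add_distrib]
  ring

theorem tractorDeriv_smul_dir (hV : IsSmoothTensor U V) {y : Coord n}
    (hy : y ∈ U) (c : ℝ) (a : Coord n) (v : Fin m → Tr n) :
    tractorDeriv A V y (c • a) v = c * tractorDeriv A V y a v := by
  simp only [tractorDeriv, map_smul, smul_apply, (hV.multilin y hy).update_smul,
    ← Finset.mul_sum, smul_eq_mul]
  ring

theorem IsSmoothTensor.thomas (hU : IsOpen U) (hA : ContDiffOn ℝ ∞ A U) (hV : IsSmoothTensor U V)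
    (w : ℝ) : IsSmoothTensor U (thomas A w V) where
  smooth v := by
    refine ContDiffOn.add (contDiffOn_const.mul (hV.smooth _)) (ContDiffOn.sub ?_ ?_)
    · exact ((hV.smooth _).fderiv_of_isOpen hU (by simp)).clm_apply contDiffOn_const
    · exact ContDiffOn.sum fun i _ ↦ hV.contDiffOn_update _ i (contDiffOn_clm_apply₂ hA _ _)
  multilin y hy := by
    refine IsMultilin.of_cons (fun a ↦ ?_) fun v ↦ ⟨fun a b ↦ ?_, fun c a ↦ ?_⟩
    · simp only [thomas_cons]
      exact ((hV.multilin y hy).const_mul _).add (isMultilin_tractorDeriv hV hU hy _)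
    · simp only [thomas_cons, Prod.fst_add, Prod.snd_add, tractorDeriv_add_dir hV hy]
      ring
    · simp only [thomas_cons, Prod.smul_fst, Prod.smul_snd, tractorDeriv_smul_dir hV hy,
        smul_eq_mul]
      ring

theorem IsSmoothTensor.iterThomas (hU : IsOpen U) (hA : ContDiffOn ℝ ∞ A U)
    (hV : IsSmoothTensor U V) (w : ℝ) (j : ℕ) : IsSmoothTensor U (iterThomas A w V j) := by
  induction j with
  | zero => exact hV
  | succ j ih => exact ih.thomas hU hA _

theorem tractorDeriv_congr {A' : Coord n → Coord n →L[ℝ] Tr n →L[ℝ] Tr n}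
    {V' : Coord n → (Fin m → Tr n) → ℝ} (hU : IsOpen U) (hV : ∀ y ∈ U, V y = V' y)
    (hA : ∀ y ∈ U, A y = A' y) {y : Coord n} (hy : y ∈ U) :
    tractorDeriv A V y = tractorDeriv A' V' y := by
  funext a v
  have h : (fun z ↦ V z v) =ᶠ[𝓝 y] fun z ↦ V' z v :=
    Filter.mem_of_superset (hU.mem_nhds hy) fun z hz ↦ congrFun (hV z hz) v
  rw [tractorDeriv, tractorDeriv, h.fderiv_eq, hA y hy, hV y hy]

theorem thomas_congr {A' : Coord n → Coord n →L[ℝ] Tr n →L[ℝ] Tr n}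
    {V' : Coord n → (Fin m → Tr n) → ℝ} (hU : IsOpen U) (hV : ∀ y ∈ U, V y = V' y)
    (hA : ∀ y ∈ U, A y = A' y) (w : ℝ) {y : Coord n} (hy : y ∈ U) :
    thomas A w V y = thomas A' w V' y := by
  funext v
  rw [thomas, thomas, tractorDeriv_congr hU hV hA hy, hV y hy]

/-- The Thomas operator commutes with permutations of the indices. -/
theorem thomas_comp_perm (w : ℝ) (σ : Equiv.Perm (Fin m)) (y : Coord n) (a : Tr n)
    (v : Fin m → Tr n) :
    thomas A w (fun z u ↦ V z (u ∘ σ)) y (Fin.cons a v) = thomas A w V y (Fin.cons a (v ∘ σ)) := by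
  rw [thomas_cons, thomas_cons, tractorDeriv, tractorDeriv]
  congr 2
  rw [← Equiv.sum_comp σ]
  refine Finset.sum_congr rfl fun i _ ↦ ?_
  congr 1
  funext k
  by_cases hk : k = i
  · subst hk; simp
  · simp [hk]

theorem thomas_symmOn (hU : IsOpen U) {s : Finset (Fin m)} (h : ∀ y ∈ U, SymmOn s (V y)) (w : ℝ)
    {y : Coord n} (hy : y ∈ U) : SymmOn (s.map (Fin.succEmb m)) (thomas A w V y) := by
  rw [symmOn_map_succ]
  intro a σ hσ v
  simp only [← thomas_comp_perm]
  exact congrFun (thomas_congr hU (fun z hz ↦ funext fun u ↦ h z hz σ hσ u) (fun _ _ ↦ rfl) w hy) _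

theorem thomas_diagZero (hU : IsOpen U) (hV : IsSmoothTensor U V) {s : Finset (Fin m)}
    (h : ∀ y ∈ U, DiagZero s (V y)) (w : ℝ) {y : Coord n} (hy : y ∈ U) :
    DiagZero (s.map (Fin.succEmb m)) (thomas A w V y) := by
  intro x v hv
  have hv' : ∀ i ∈ s, Fin.tail v i = x := fun i hi ↦ hv _ (Finset.mem_map.2 ⟨i, hi, rfl⟩)
  have h1 : (fun z ↦ V z (Fin.tail v)) =ᶠ[𝓝 y] fun _ ↦ 0 :=
    Filter.mem_of_superset (hU.mem_nhds hy) fun z hz ↦ h z hz x _ hv'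
  have h2 : ∑ i, V y (Function.update (Fin.tail v) i (A y (v 0).2 (Fin.tail v i))) = 0 := by
    rw [← Finset.sum_subset (Finset.subset_univ s)]
    · rw [← (hV.multilin y hy).sum_update_eq_zero hv' (fun x' u hu _ ↦ h y hy x' u hu)
        (A y (v 0).2 x)]
      exact Finset.sum_congr rfl fun i hi ↦ by rw [hv' i hi]
    · intro i _ hi
      refine h y hy x _ fun j hj ↦ ?_
      rw [Function.update_of_ne (by rintro rfl; exact hi hj), hv' j hj]
  rw [thomas, tractorDeriv, h1.fderiv_eq, h2, h y hy x _ hv']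
  simp

end Thomas

/-! ### Commutation of Thomas operators -/

section Commute

variable {n : ℕ} {m : ℕ} {U : Set (Coord n)} {A : Coord n → Coord n →L[ℝ] Tr n →L[ℝ] Tr n}
  {V : Coord n → (Fin m → Tr n) → ℝ}

/-- The flatness of the connection on `X` shows that its torsion and the skew part of its Schouten
tensor vanish. -/
theorem IsFlatTractorForm.apply_comm (hA : IsFlatTractorForm U A) {y : Coord n} (hy : y ∈ U)
    (a b : Coord n) : A y a (0, b) = A y b (0, a) := by
  have h := hA.flat y hy a b (1, 0)
  have h0 : ∀ a b : Coord n, fderiv ℝ A y a b (1, 0) = 0 := by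
    intro a b
    rw [← fderiv_clm_apply₂ hA.isOpen hA.smooth hy]
    have h1 : (fun z ↦ A z b (1, 0)) =ᶠ[𝓝 y] fun _ ↦ (0, b) :=
      Filter.mem_of_superset (hA.isOpen.mem_nhds hy) fun z hz ↦ hA.apply_one z hz b
    rw [h1.fderiv_eq]
    simp
  rw [h0, h0, hA.apply_one y hy, hA.apply_one y hy] at h
  simpa [sub_eq_zero] using h

theorem IsFlatTractorForm.apply_eq (hA : IsFlatTractorForm U A) {y : Coord n} (hy : y ∈ U)
    (a : Coord n) (b : Tr n) : A y a b = b.1 • (0, a) + A y a (0, b.2) := by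
  have h : b = b.1 • (1, 0) + (0, b.2) := by ext <;> simp
  conv_lhs => rw [h, map_add, map_smul, hA.apply_one y hy]

/-- Inserting `f` and `g` successively into the arguments of `T`, in either order, gives the same
sums up to the terms in which both are inserted into one argument. -/
theorem sum_update_update_comm (T : (Fin m → Tr n) → ℝ) (t : Fin m → Tr n)
    (f g : Tr n → Tr n) :
    ∑ i, ∑ j, T (Function.update (Function.update t i (f (t i))) j
        (g (Function.update t i (f (t i)) j)))
      - ∑ i, T (Function.update t i (g (f (t i))))
    = ∑ i, ∑ j, T (Function.update (Function.update t i (g (t i))) j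
        (f (Function.update t i (g (t i)) j)))
      - ∑ i, T (Function.update t i (f (g (t i)))) := by
  have key : ∀ f g : Tr n → Tr n, ∑ i, ∑ j, T (Function.update (Function.update t i (f (t i))) j
        (g (Function.update t i (f (t i)) j)))
      - ∑ i, T (Function.update t i (g (f (t i))))
      = ∑ i, ∑ j, if j = i then 0 else T (Function.update (Function.update t i (f (t i))) j
        (g (t j))) := by
    intro f g
    rw [← Finset.sum_sub_distrib]
    refine Finset.sum_congr rfl fun i _ ↦ ?_
    rw [sub_eq_iff_eq_add, ← Finset.sum_erase_add _ _ (Finset.mem_univ i),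
      ← Finset.sum_erase_add (a := i) (Finset.univ : Finset (Fin m))
        (fun j ↦ if j = i then 0 else T (Function.update (Function.update t i (f (t i))) j
        (g (t j)))) (Finset.mem_univ i)]
    simp only [Function.update_self, Function.update_idem, if_true, add_zero]
    congr 1
    refine Finset.sum_congr rfl fun j hj ↦ ?_
    have hji := (Finset.mem_erase.1 hj).1
    rw [if_neg hji, Function.update_of_ne hji]
  rw [key f g, key g f, Finset.sum_comm]
  refine Finset.sum_congr rfl fun j _ ↦ Finset.sum_congr rfl fun i _ ↦ ?_
  by_cases hij : j = i
  · simp [hij]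
  · rw [if_neg hij, if_neg (Ne.symm hij), Function.update_comm (Ne.symm hij)]

theorem tractorDeriv_thomas (hU : IsOpen U) (hA : ContDiffOn ℝ ∞ A U) (hV : IsSmoothTensor U V)
    (w : ℝ) {y : Coord n} (hy : y ∈ U) (a : Coord n) (b : Tr n) (t : Fin m → Tr n) :
    tractorDeriv A (thomas A w V) y a (Fin.cons b t)
      = w * b.1 * tractorDeriv A V y a t - thomas A w V y (Fin.cons (A y a b) t)
        + fderiv ℝ (fun z ↦ fderiv ℝ (fun z ↦ V z t) z b.2) y a
        - ∑ i, fderiv ℝ (fun z ↦ V z (Function.update t i (A y b.2 (t i)))) y a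
        - ∑ i, fderiv ℝ (fun z ↦ V z (Function.update t i (A y a (t i)))) y b.2
        - ∑ i, V y (Function.update t i (fderiv ℝ A y a b.2 (t i)))
        + ∑ i, ∑ j, V y (Function.update (Function.update t i (A y a (t i))) j
          (A y b.2 (Function.update t i (A y a (t i)) j))) := by
  have hd : ∀ v, DifferentiableAt ℝ (fun z ↦ V z v) y := hV.differentiableAt hU hy
  have hd2 : DifferentiableAt ℝ (fun z ↦ fderiv ℝ (fun z ↦ V z t) z b.2) y :=
    (((((hV.smooth t).fderiv_of_isOpen hU (m := ∞) (by simp)).clm_apply contDiffOn_const).contDiffAt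
      (hU.mem_nhds hy)).differentiableAt (by simp))
  have hu : ∀ i, ContDiffOn ℝ ∞ (fun z ↦ V z (Function.update t i (A z b.2 (t i)))) U :=
    fun i ↦ hV.contDiffOn_update _ i (contDiffOn_clm_apply₂ hA _ _)
  have hu' : ∀ i, DifferentiableAt ℝ (fun z ↦ V z (Function.update t i (A z b.2 (t i)))) y :=
    fun i ↦ ((hu i).contDiffAt (hU.mem_nhds hy)).differentiableAt (by simp)
  have h1 : fderiv ℝ (fun z ↦ thomas A w V z (Fin.cons b t)) y a
      = w * b.1 * fderiv ℝ (fun z ↦ V z t) y a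
        + (fderiv ℝ (fun z ↦ fderiv ℝ (fun z ↦ V z t) z b.2) y a
        - ∑ i, (fderiv ℝ (fun z ↦ V z (Function.update t i (A y b.2 (t i)))) y a
          + V y (Function.update t i (fderiv ℝ A y a b.2 (t i))))) := by
    simp only [thomas_cons, tractorDeriv]
    rw [fderiv_fun_add ((hd t).const_mul _)
      (hd2.fun_sub (DifferentiableAt.fun_sum fun i _ ↦ hu' i)),
      fderiv_fun_sub hd2 (DifferentiableAt.fun_sum fun i _ ↦ hu' i),
      fderiv_fun_sum (fun i _ ↦ hu' i), fderiv_const_mul (hd t)]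
    simp only [add_apply, sub_apply, smul_apply, sum_apply, smul_eq_mul]
    congr 2
    refine Finset.sum_congr rfl fun i _ ↦ ?_
    rw [hV.fderiv_update hU hy t i (contDiffOn_clm_apply₂ hA _ _), fderiv_clm_apply₂ hU hA hy]
  rw [tractorDeriv, h1, Fin.sum_univ_succ]
  simp only [Fin.cons_zero, Fin.cons_succ, Fin.update_cons_zero, ← Fin.cons_update, thomas_cons,
    tractorDeriv, Finset.sum_add_distrib, Finset.sum_sub_distrib, ← Finset.mul_sum]
  ring

/-- In the flat case Thomas operators commute. -/
theorem thomas_comm (hA : IsFlatTractorForm U A) (hV : IsSmoothTensor U V)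
    (w : ℝ) {y : Coord n} (hy : y ∈ U) (a b : Tr n) (t : Fin m → Tr n) :
    thomas A (w - 1) (thomas A w V) y (Fin.cons a (Fin.cons b t))
      = thomas A (w - 1) (thomas A w V) y (Fin.cons b (Fin.cons a t)) := by
  have hU := hA.isOpen
  have hW := hV.thomas hU hA.smooth w
  have hlin : ∀ (c d : Tr n) (x : ℝ), thomas A w V y (Fin.cons (x • c + d) t)
      = x * thomas A w V y (Fin.cons c t) + thomas A w V y (Fin.cons d t) := by
    intro c d x
    simp only [thomas_cons, Prod.fst_add, Prod.snd_add, Prod.smul_fst, Prod.smul_snd,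
      tractorDeriv_add_dir hV hy, tractorDeriv_smul_dir hV hy, smul_eq_mul]
    ring
  -- the second derivative is symmetric
  have h2 : fderiv ℝ (fun z ↦ fderiv ℝ (fun z ↦ V z t) z b.2) y a.2
      = fderiv ℝ (fun z ↦ fderiv ℝ (fun z ↦ V z t) z a.2) y b.2 := by
    have hf := (hV.smooth t).contDiffAt (hU.mem_nhds hy)
    have hd : DifferentiableAt ℝ (fderiv ℝ (fun z ↦ V z t)) y :=
      (((hV.smooth t).fderiv_of_isOpen hU (m := ∞) (by simp)).contDiffAt
        (hU.mem_nhds hy)).differentiableAt (by simp)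
    have e : ∀ c d : Coord n, fderiv ℝ (fun z ↦ fderiv ℝ (fun z ↦ V z t) z c) y d
        = fderiv ℝ (fderiv ℝ (fun z ↦ V z t)) y d c := by
      intro c d
      rw [(hd.hasFDerivAt.clm_apply (hasFDerivAt_const c y)).fderiv]
      simp
    rw [e, e]
    exact hf.isSymmSndFDerivAt (by
      rw [minSmoothness_of_isRCLikeNormedField]; exact WithTop.coe_le_coe.2
        (le_top : (2 : ℕ∞) ≤ ⊤)) _ _
  -- the curvature terms cancel
  have h3 : ∑ i, V y (Function.update t i (fderiv ℝ A y a.2 b.2 (t i)))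
      - ∑ i, V y (Function.update t i (fderiv ℝ A y b.2 a.2 (t i)))
      + ∑ i, V y (Function.update t i (A y a.2 (A y b.2 (t i))))
      - ∑ i, V y (Function.update t i (A y b.2 (A y a.2 (t i)))) = 0 := by
    rw [← Finset.sum_sub_distrib, ← Finset.sum_add_distrib, ← Finset.sum_sub_distrib]
    refine Finset.sum_eq_zero fun i _ ↦ ?_
    have hm := hV.multilin y hy
    rw [← hm.update_sub, ← hm.update_add, ← hm.update_sub, hA.flat y hy]
    exact hm.map_coord_zero i (by simp)
  have h4 := sum_update_update_comm (V y) t (A y a.2) (A y b.2)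
  have h5 : ∀ c : Tr n, thomas A w V y (Fin.cons c t)
      = w * c.1 * V y t + tractorDeriv A V y c.2 t := fun c ↦ thomas_cons w y c t
  have h6 : thomas A w V y (Fin.cons (A y a.2 b) t) = b.1 * tractorDeriv A V y a.2 t
      + thomas A w V y (Fin.cons (A y a.2 (0, b.2)) t) := by
    rw [hA.apply_eq hy, hlin, h5]
    simp
  have h7 : thomas A w V y (Fin.cons (A y b.2 a) t) = a.1 * tractorDeriv A V y b.2 t
      + thomas A w V y (Fin.cons (A y a.2 (0, b.2)) t) := by
    rw [hA.apply_eq hy, hlin, h5, hA.apply_comm hy b.2 a.2]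
    simp
  rw [thomas_cons (w - 1), thomas_cons (w - 1), tractorDeriv_thomas hU hA.smooth hV w hy,
    tractorDeriv_thomas hU hA.smooth hV w hy, h6, h7, h2, h5 a, h5 b]
  linarith

end Commute

/-! ### Symmetries of iterated Thomas operators -/

section Iterate

variable {n : ℕ} {m : ℕ} {U : Set (Coord n)} {A : Coord n → Coord n →L[ℝ] Tr n →L[ℝ] Tr n}
  {V : Coord n → (Fin m → Tr n) → ℝ}

theorem filter_lt_succ (j : ℕ) : (Finset.univ.filter (fun i : Fin (m + (j + 1)) ↦ i.val < j + 1))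
    = insert 0 ((Finset.univ.filter (fun i : Fin (m + j) ↦ i.val < j)).map
      (Fin.succEmb (m + j))) := by
  ext i
  refine Fin.cases ?_ (fun i ↦ ?_) i <;> simp

theorem filter_le_succ (k j : ℕ) :
    (Finset.univ.filter (fun i : Fin (m + (j + 1)) ↦ k + 1 ≤ i.val))
    = (Finset.univ.filter (fun i : Fin (m + j) ↦ k ≤ i.val)).map (Fin.succEmb (m + j)) := by
  ext i
  refine Fin.cases ?_ (fun i ↦ ?_) i <;> simp

theorem iterThomas_symm_first (hA : IsFlatTractorForm U A) (hV : IsSmoothTensor U V) (w : ℝ)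
    (j : ℕ) {y : Coord n} (hy : y ∈ U) :
    SymmOn (Finset.univ.filter (fun i : Fin (m + j) ↦ i.val < j)) (iterThomas A w V j y) := by
  induction j generalizing y with
  | zero =>
    intro σ hσ v
    congr 1
    funext i
    rw [Function.comp_apply, hσ i (by simp)]
  | succ j ih =>
    rw [filter_lt_succ]
    have h1 := thomas_symmOn (A := A) hA.isOpen (fun z hz ↦ ih hz) (w - j) hy
    cases j with
    | zero =>
      intro σ hσ v
      congr 1
      funext i
      have h0 : ∀ i, i ≠ 0 → σ i = i := fun i hi ↦ hσ i (by simpa using hi)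
      by_cases hi : i = 0
      · subst hi
        by_contra hne
        have h2 : σ 0 ≠ 0 := fun h ↦ hne (by rw [Function.comp_apply, h])
        exact h2 (σ.injective (h0 _ h2))
      · rw [Function.comp_apply, h0 i hi]
    | succ j =>
      refine SymmOn.of_erase (p := 0) (q := (0 : Fin (m + j + 1)).succ) ?_ ?_ ?_
      · rw [Finset.erase_insert (by simp)]
        exact h1
      · rw [Finset.erase_insert (by simp)]
        exact Finset.mem_map.2 ⟨0, by simp, rfl⟩
      · intro v
        obtain ⟨a, b, t, rfl⟩ : ∃ (a b : Tr n) (t : Fin (m + j) → Tr n),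
            v = Fin.cons a (Fin.cons b t) :=
          ⟨v 0, v (Fin.succ 0), fun i ↦ v i.succ.succ, by
            funext i
            refine Fin.cases rfl (fun i ↦ Fin.cases rfl (fun i ↦ rfl) i) i⟩
        have h2 : (Fin.cons a (Fin.cons b t) : Fin (m + j + 1 + 1) → Tr n)
            ∘ Equiv.swap 0 (0 : Fin (m + j + 1)).succ = Fin.cons b (Fin.cons a t) := by
          funext i
          refine Fin.cases ?_ (fun i ↦ Fin.cases ?_ (fun i ↦ ?_) i) i
          · simp
          · simp
          · rw [Function.comp_apply, Equiv.swap_apply_of_ne_of_ne (Fin.succ_ne_zero _)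
              (by simp [Fin.ext_iff])]
            simp
        have h3 := thomas_comm hA (hV.iterThomas hA.isOpen hA.smooth w j) (w - j) hy b a t
        have h4 : w - j - 1 = w - (j + 1 : ℕ) := by push_cast; ring
        rw [h4] at h3
        exact (congrArg (iterThomas A w V (j + 1 + 1) y) h2).trans h3

theorem iterThomas_symm_last (hU : IsOpen U) (h : ∀ y ∈ U, SymmOn Finset.univ (V y)) (w : ℝ)
    (j : ℕ) {y : Coord n} (hy : y ∈ U) :
    SymmOn (Finset.univ.filter (fun i : Fin (m + j) ↦ j ≤ i.val)) (iterThomas A w V j y) := by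
  induction j generalizing y with
  | zero => simpa [iterThomas] using h y hy
  | succ j ih =>
    rw [filter_le_succ]
    exact thomas_symmOn hU (fun z hz ↦ ih hz) _ hy

theorem iterThomas_diagZero (hU : IsOpen U) (hA : ContDiffOn ℝ ∞ A U) (hV : IsSmoothTensor U V)
    (w : ℝ) (h : ∀ y ∈ U, DiagZero Finset.univ (thomas A w V y)) (j : ℕ) {y : Coord n}
    (hy : y ∈ U) : DiagZero (Finset.univ.filter (fun i : Fin (m + (j + 1)) ↦ j ≤ i.val))
      (iterThomas A w V (j + 1) y) := by
  induction j generalizing y with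
  | zero => simpa [iterThomas] using h y hy
  | succ j ih =>
    rw [filter_le_succ]
    exact thomas_diagZero hU (hV.iterThomas hU hA w _) (fun z hz ↦ ih hz) _ hy

/-- Contracting all the new indices with `X`. -/
theorem iterThomas_apply_one (w : ℝ) (j : ℕ) (hV : IsSmoothTensor U V) {y : Coord n}
    (hy : y ∈ U) (hU : IsOpen U) (hA : ContDiffOn ℝ ∞ A U)
    (v : Fin (m + j) → Tr n) (hv : ∀ i, i.val < j → v i = (1, 0)) :
    iterThomas A w V j y v
      = (∏ l ∈ Finset.range j, (w - l)) * V y (fun i ↦ v (i.addNat j)) := by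
  induction j generalizing y with
  | zero => simp [iterThomas]
  | succ j ih =>
    have h0 : v 0 = (1, 0) := hv 0 (by simp)
    have hS := hV.iterThomas hU hA w j
    have h1 : tractorDeriv A (iterThomas A w V j) y 0 (Fin.tail v) = 0 := by
      simpa using tractorDeriv_smul_dir (A := A) hS hy 0 0 (Fin.tail v)
    rw [iterThomas, thomas, h0, h1, ih hy (Fin.tail v) (fun i hi ↦ hv i.succ (by simpa using hi)),
      Finset.prod_range_succ]
    simp only [mul_one, add_zero, Fin.tail]
    rw [← mul_assoc, mul_comm (w - j : ℝ)]
    rfl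

end Iterate

/-! ### Killing tensors and parallel tractors on an open set -/

section Prolongation

variable {n r : ℕ} {U : Set (Coord n)} {A : Coord n → Coord n →L[ℝ] Tr n →L[ℝ] Tr n}

theorem thomas_weight_zero {m : ℕ} (V : Coord n → (Fin m → Tr n) → ℝ) (y : Coord n) (a : Tr n)
    (v : Fin m → Tr n) : thomas A 0 V y (Fin.cons a v) = tractorDeriv A V y a.2 v := by
  rw [thomas_cons]; simp

/-- If `𝔻_{(A} K_{B₁ ⋯ B_r)} = 0`, then `𝔻^r K` has Young symmetry `(r, r)`. -/
theorem isYoung_iterThomas (hA : IsFlatTractorForm U A) (hr : 0 < r)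
    {K : Coord n → (Fin r → Tr n) → ℝ} (hK : IsSmoothTensor U K)
    (hs : ∀ y ∈ U, SymmOn Finset.univ (K y)) {w : ℝ}
    (h0 : ∀ y ∈ U, DiagZero Finset.univ (thomas A w K y)) {y : Coord n} (hy : y ∈ U) :
    IsYoung (iterThomas A w K r y) := by
  have h1 : SymmOn (firstIdx r) (iterThomas A w K r y) := iterThomas_symm_first hA hK w r hy
  refine IsYoung.of_last ⟨(hK.iterThomas hA.isOpen hA.smooth w r).multilin y hy, h1,
    iterThomas_symm_last hA.isOpen hs w r hy⟩ fun j x v hv ↦ ?_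
  obtain ⟨q, rfl⟩ : ∃ q, r = q + 1 := ⟨r - 1, by omega⟩
  have h2 := iterThomas_diagZero hA.isOpen hA.smooth hK w h0 q hy
  rw [← h1.swap (firstPos_mem_firstIdx (Fin.last q)) (firstPos_mem_firstIdx j)]
  refine h2 x _ (forall_pos.2 ⟨fun i hi ↦ ?_, fun i _ ↦ ?_⟩)
  · have hi' : i = Fin.last q := by
      simp only [firstPos, Finset.mem_filter, Finset.mem_univ, true_and, Fin.val_castAdd] at hi
      ext
      simp only [Fin.val_last]
      omega
    subst hi'
    simpa using hv (firstPos j) (by simp)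
  · simpa [Equiv.swap_apply_def] using hv (lastPos i) (by simp)

/-- If `𝔻_{(A} K_{B₁ ⋯ B_r)} = 0`, then `𝔻^r K` is parallel: `𝔻^{r+1} K` is symmetric in the
first `r + 1` and in the last `r` indices, and its symmetrisation over `r + 1` indices vanishes. -/
theorem tractorDeriv_iterThomas_eq_zero (hA : IsFlatTractorForm U A)
    {K : Coord n → (Fin r → Tr n) → ℝ} (hK : IsSmoothTensor U K)
    (hs : ∀ y ∈ U, SymmOn Finset.univ (K y))
    (h0 : ∀ y ∈ U, DiagZero Finset.univ (thomas A r K y)) {y : Coord n} (hy : y ∈ U)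
    (a : Coord n) (v : Fin (r + r) → Tr n) :
    tractorDeriv A (iterThomas A r K r) y a v = 0 := by
  have hsymm := iterThomas_symm_first hA hK r (r + 1) hy
  rw [filter_lt_succ] at hsymm
  have hlast := iterThomas_symm_last hA.isOpen hs (A := A) r (r + 1) hy
  rw [filter_le_succ] at hlast
  have hmem : (⟨r, by omega⟩ : Fin (r + (r + 1))) ∈ insert 0
      ((Finset.univ.filter (fun i : Fin (r + r) ↦ i.val < r)).map (Fin.succEmb (r + r))) := by
    rw [← filter_lt_succ]; simp
  have h2 := iterThomas_diagZero hA.isOpen hA.smooth hK r h0 r hy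
  have hV : iterThomas A r K (r + 1) y = 0 := by
    refine IsMultilin.eq_zero_of_symm_succ
      ((hK.iterThomas hA.isOpen hA.smooth r (r + 1)).multilin y hy) hsymm
      (symmOn_map_succ.1 hlast) fun x v hv ↦ ?_
    rw [← hsymm.swap (Finset.mem_insert_self 0 _) hmem]
    refine h2 x _ fun i hi ↦ ?_
    simp only [Finset.mem_filter, Finset.mem_univ, true_and] at hi
    rw [Function.comp_apply, Equiv.swap_apply_def]
    split_ifs with hi0 hir
    · subst hi0
      have hr0 : r = 0 := by simpa using hi
      subst hr0
      exact hv _ (by simp [Fin.ext_iff])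
    · exact hv _ (by simp)
    · have h3 : r < i.val := lt_of_le_of_ne hi fun h ↦ hir (Fin.ext h.symm)
      revert hi0 h3
      refine Fin.cases (by simp) (fun i ↦ ?_) i
      intro _ h3
      refine hv _ (Finset.mem_insert_of_mem (Finset.mem_map.2 ⟨i, ?_, rfl⟩))
      simp only [lastIdx, Finset.mem_filter, Finset.mem_univ, true_and]
      simp only [Fin.val_succ] at h3
      omega
  have h3 : thomas A (r - r : ℝ) (iterThomas A r K r) y (Fin.cons (0, a) v) = 0 :=
    congrFun hV _
  rwa [sub_self, thomas_weight_zero] at h3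

/-- The arguments `X, …, X, v₁, …, v_{r+j}` with `r - j` copies of `X = (1, 0)`. -/
def withX (j : ℕ) (v : Fin (r + j) → Tr n) (i : Fin (r + r)) : Tr n :=
  if i.val < r - j then (1, 0) else v ⟨i.val - (r - j), by omega⟩

/-- The position of `v_i` in `withX j v`. -/
def withXPos (j : ℕ) (hj : j ≤ r) (i : Fin (r + j)) : Fin (r + r) := ⟨i.val + (r - j), by omega⟩

theorem withX_of_lt {j : ℕ} (v : Fin (r + j) → Tr n) {i : Fin (r + r)} (hi : i.val < r - j) :
    withX j v i = (1, 0) := if_pos hi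

@[simp] theorem withX_withXPos {j : ℕ} (hj : j ≤ r) (v : Fin (r + j) → Tr n) (i : Fin (r + j)) :
    withX j v (withXPos j hj i) = v i := by
  simp [withX, withXPos]

theorem withX_update {j : ℕ} (hj : j ≤ r) (v : Fin (r + j) → Tr n) (i : Fin (r + j)) (x : Tr n) :
    withX j (Function.update v i x) = Function.update (withX j v) (withXPos j hj i) x := by
  funext k
  by_cases hk : k = withXPos j hj i
  · subst hk; simp
  · rw [Function.update_of_ne hk, withX, withX]
    split_ifs with h
    · rfl
    · rw [Function.update_of_ne]
      rintro rfl
      refine hk (Fin.ext ?_)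
      simp [withXPos]
      omega

theorem withX_succ {j : ℕ} (hj : j < r) (v : Fin (r + (j + 1)) → Tr n) :
    withX (j + 1) v
      = Function.update (withX j (Fin.tail v)) ⟨r - j - 1, by omega⟩ (v 0) := by
  funext k
  by_cases hk : k = ⟨r - j - 1, by omega⟩
  · subst hk
    rw [Function.update_self, withX, if_neg (by simp; omega)]
    congr 1
    ext
    simp
    omega
  · rw [Function.update_of_ne hk]
    have hk' : k.val ≠ r - j - 1 := fun h ↦ hk (Fin.ext h)
    rw [withX, withX]
    by_cases h : k.val < r - (j + 1)
    · rw [if_pos h, if_pos (by omega)]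
    · rw [if_neg h, if_neg (by omega), Fin.tail]
      congr 1
      ext
      simp
      omega

theorem IsMultilin.withX {T : (Fin (r + r) → Tr n) → ℝ} (hT : IsMultilin T) {j : ℕ} (hj : j ≤ r) :
    IsMultilin (fun v ↦ T (withX j v)) := by
  refine ⟨{ toFun := fun v ↦ T (ProjTractor.withX j v), map_update_add' := ?_,
            map_update_smul' := ?_ }, rfl⟩
  · intro dec v i x x'
    obtain rfl : dec = instDecidableEqFin _ := Subsingleton.elim _ _
    simp only [withX_update hj, hT.update_add]
  · intro dec v i c x
    obtain rfl : dec = instDecidableEqFin _ := Subsingleton.elim _ _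
    simp only [withX_update hj, hT.update_smul, smul_eq_mul]

theorem IsSmoothTensor.withX {L : Coord n → (Fin (r + r) → Tr n) → ℝ} (hL : IsSmoothTensor U L)
    {j : ℕ} (hj : j ≤ r) : IsSmoothTensor U (fun y v ↦ L y (withX j v)) :=
  ⟨fun _ ↦ hL.smooth _, fun y hy ↦ (hL.multilin y hy).withX hj⟩

/-- Differentiating the contraction of a parallel tractor with `r - j` copies of `X`. -/
theorem tractorDeriv_withX (hA : IsFlatTractorForm U A) {L : Coord n → (Fin (r + r) → Tr n) → ℝ}
    (hp : ∀ y ∈ U, ∀ a v, tractorDeriv A L y a v = 0) {y : Coord n} (hy : y ∈ U)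
    (hs : SymmOn (firstIdx r) (L y)) {j : ℕ} (hj : j < r) (a : Coord n) (v : Fin (r + j) → Tr n) :
    tractorDeriv A (fun z u ↦ L z (withX j u)) y a v
      = (r - j) * L y (Function.update (withX j v) ⟨r - j - 1, by omega⟩ (0, a)) := by
  have h1 := sub_eq_zero.1 (hp y hy a (withX j v))
  have hmem : ∀ p : Fin (r + r), p.val < r - j → p ∈ firstIdx r := fun p hp ↦ by
    simp only [firstIdx, Finset.mem_filter, Finset.mem_univ, true_and]; omega
  let q : Fin (r + r) := ⟨r - j - 1, by omega⟩
  have hq : q.val < r - j := by simp only [q]; omega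
  rw [tractorDeriv, h1, ← Finset.sum_filter_add_sum_filter_not Finset.univ
    (fun p : Fin (r + r) ↦ p.val < r - j)]
  -- the terms in which an argument `v_i` is differentiated cancel
  have h2 : ∑ p ∈ Finset.univ.filter (fun p : Fin (r + r) ↦ ¬ p.val < r - j),
      L y (Function.update (withX j v) p (A y a (withX j v p)))
      = ∑ i, L y (withX j (Function.update v i (A y a (v i)))) := by
    symm
    refine Finset.sum_bij (fun i _ ↦ withXPos j hj.le i) ?_ ?_ ?_ ?_
    · intro i _
      simp [withXPos]
      omega
    · intro i _ i' _ h
      have := congrArg Fin.val h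
      simp only [withXPos] at this
      ext; omega
    · intro p hp
      simp only [Finset.mem_filter, Finset.mem_univ, true_and, not_lt] at hp
      exact ⟨⟨p.val - (r - j), by omega⟩, Finset.mem_univ _, Fin.ext (by simp [withXPos]; omega)⟩
    · intro i _
      rw [withX_update hj.le, withX_withXPos]
  -- the terms in which `X` is differentiated agree by symmetry
  have h3 : ∀ p ∈ Finset.univ.filter (fun p : Fin (r + r) ↦ p.val < r - j),
      L y (Function.update (withX j v) p (A y a (withX j v p)))
      = L y (Function.update (withX j v) q (0, a)) := by
    intro p hp
    replace hp : p.val < r - j := by simpa using hp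
    rw [withX_of_lt v hp, hA.apply_one y hy, ← hs.swap (hmem p hp) (hmem q hq)]
    congr 1
    funext k
    by_cases hkq : k = q
    · subst hkq; simp
    · by_cases hkp : k = p
      · subst hkp
        simp [Function.update_of_ne hkq, Function.update_of_ne (Ne.symm hkq), withX_of_lt v hp,
          withX_of_lt v hq]
      · simp [Equiv.swap_apply_of_ne_of_ne hkp hkq, hkp, hkq]
  have h4 : (Finset.univ.filter (fun p : Fin (r + r) ↦ p.val < r - j)).card = r - j := by
    rw [Fin.card_filter_val_lt]; omega
  rw [h2, add_sub_cancel_right, Finset.sum_congr rfl h3, Finset.sum_const, h4, nsmul_eq_mul,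
    Nat.cast_sub hj.le]

/-- On parallel tractors, `𝔻` acts on the contraction with `r - j` copies of `X` by replacing one
of them by the new argument, with the factor `r - j`: the part of weight `r - j` gives the `X`
component of the new argument, and `∇_a X = a` its tangent part. Thus the iterated Thomas operators
undo the contractions of a parallel tractor with `X`. -/
theorem iterThomas_withX (hA : IsFlatTractorForm U A) {L : Coord n → (Fin (r + r) → Tr n) → ℝ}
    (hL : IsSmoothTensor U L) (hs : ∀ y ∈ U, SymmOn (firstIdx r) (L y))
    (hp : ∀ y ∈ U, ∀ a v, tractorDeriv A L y a v = 0) {j : ℕ} (hj : j ≤ r) (c : ℝ)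
    {y : Coord n} (hy : y ∈ U) :
    iterThomas A r (fun z u ↦ c * L z (withX 0 u)) j y
      = fun v ↦ c * (∏ l ∈ Finset.range j, ((r : ℝ) - l)) * L y (withX j v) := by
  induction j generalizing y with
  | zero => simp [iterThomas]
  | succ j ih =>
    have hjr : j < r := hj
    funext v
    have hS := hL.withX (r := r) hjr.le
    rw [iterThomas, thomas_congr hA.isOpen (fun z hz ↦ ih hjr.le hz) (fun _ _ ↦ rfl) _ hy]
    set c' := c * ∏ l ∈ Finset.range j, ((r : ℝ) - l)
    have h1 : tractorDeriv A (fun z u ↦ c' * L z (withX j u)) y (v 0).2 (Fin.tail v)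
        = c' * tractorDeriv A (fun z u ↦ L z (withX j u)) y (v 0).2 (Fin.tail v) := by
      simp only [tractorDeriv]
      rw [fderiv_const_mul (hS.differentiableAt hA.isOpen hy _), ← Finset.mul_sum]
      simp only [smul_apply, smul_eq_mul]
      ring
    rw [thomas, h1, tractorDeriv_withX hA hp hy (hs y hy) hjr, Finset.prod_range_succ,
      withX_succ hjr]
    have hm := hL.multilin y hy
    have h2 : v 0 = (v 0).1 • (1, 0) + (0, (v 0).2) := by ext <;> simp
    have h3 : Function.update (withX j (Fin.tail v)) ⟨r - j - 1, by omega⟩ (1, 0)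
        = withX j (Fin.tail v) := by
      rw [← withX_of_lt (j := j) (Fin.tail v) (i := ⟨r - j - 1, by omega⟩) (by simp; omega),
        Function.update_eq_self]
    conv_rhs => rw [h2, hm.update_add, hm.update_smul, h3]
    ring

/-- Contracting a parallel tractor of Young symmetry `(r, r)` with `r` copies of `X` gives a
solution of the Killing equation. -/
theorem thomas_withX_diagZero (hA : IsFlatTractorForm U A) (hr : 0 < r)
    {L : Coord n → (Fin (r + r) → Tr n) → ℝ}
    (hL : IsSmoothTensor U L) (hY : ∀ y ∈ U, IsYoung (L y))
    (hp : ∀ y ∈ U, ∀ a v, tractorDeriv A L y a v = 0) (c : ℝ) {y : Coord n} (hy : y ∈ U) :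
    DiagZero Finset.univ (thomas A r (fun z u ↦ c * L z (withX 0 u)) y) := by
  intro x v hv
  have h := congrFun (iterThomas_withX hA hL (fun z hz ↦ (hY z hz).first) hp (j := 1) hr c hy) v
  simp only [iterThomas, Nat.cast_zero, sub_zero] at h
  rw [h, (hY y hy).zero_last ⟨r - 1, by omega⟩ x, mul_zero]
  intro i hi
  have hi' : ¬ i.val < r - 1 := by
    rw [Finset.mem_insert] at hi
    rcases hi with rfl | hi
    · simp [firstPos]
    · simp only [lastIdx, Finset.mem_filter, Finset.mem_univ, true_and] at hi
      omega
  rw [withX, if_neg hi', hv _ (Finset.mem_univ _)]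

/-- The contraction with `r` copies of `X` only depends on the projections of the remaining
arguments to the tangent space. -/
theorem IsYoung.withX_zero_congr {T : (Fin (r + r) → Tr n) → ℝ} (hT : IsYoung T)
    (v : Fin r → Tr n) : T (withX 0 v) = T (withX 0 (fun i ↦ (0, (v i).2))) := by
  have h1 : ∀ (v : Fin r → Tr n) (i : Fin r),
      T (withX 0 (Function.update v i (0, (v i).2))) = T (withX 0 v) := by
    intro v i
    have h2 : (0, (v i).2) = v i - (v i).1 • ((1, 0) : Tr n) := by ext <;> simp
    have hm := hT.multilin.withX (Nat.zero_le r)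
    have h3 := hm.update_sub v i (v i) ((v i).1 • ((1, 0) : Tr n))
    rw [hm.update_smul, Function.update_eq_self] at h3
    rw [h2, h3, hT.zero i (1, 0) (withX 0 (Function.update v i (1, 0))) (fun k hk ↦ ?_), mul_zero,
      sub_zero]
    rw [Finset.mem_insert] at hk
    rcases hk with rfl | hk
    · have h4 : lastPos i = withXPos 0 (Nat.zero_le r) i := by
        ext; simp [lastPos, withXPos, add_comm]
      rw [h4, withX_withXPos, Function.update_self]
    · refine withX_of_lt _ ?_
      simpa [firstIdx] using hk
  have h2 : ∀ s : Finset (Fin r),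
      T (withX 0 (s.piecewise (fun i ↦ ((0, (v i).2) : Tr n)) v)) = T (withX 0 v) := by
    intro s
    induction s using Finset.induction_on with
    | empty => simp
    | insert i s hi ih =>
      rw [Finset.piecewise_insert, ← ih, ← h1 (s.piecewise (fun i ↦ ((0, (v i).2) : Tr n)) v) i,
        Finset.piecewise_eq_of_notMem _ _ _ hi]
  rw [← h2 Finset.univ, Finset.piecewise_univ]
  rfl

theorem IsBisymm.withX_zero_symmOn {T : (Fin (r + r) → Tr n) → ℝ} (hT : IsBisymm T) :
    SymmOn Finset.univ (fun v : Fin r → Tr n ↦ T (withX 0 v)) := by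
  intro σ _ v
  let e : Fin r ↪ Fin (r + r) := ⟨lastPos, lastPos_injective⟩
  have hpos : ∀ (v : Fin r → Tr n) (i : Fin r), withX 0 v (lastPos i) = v i := by
    intro v i
    have h4 : lastPos i = withXPos 0 (Nat.zero_le r) i := by
      ext; simp [lastPos, withXPos, add_comm]
    rw [h4, withX_withXPos]
  have hlt : ∀ (v : Fin r → Tr n) (i : Fin r), withX 0 v (firstPos i) = (1, 0) :=
    fun v i ↦ withX_of_lt _ (by simp [firstPos])
  have hnot : ∀ i : Fin r, firstPos i ∉ Set.range e := by
    rintro i ⟨k, hk⟩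
    exact firstPos_ne_lastPos i k hk.symm
  have h1 : withX 0 (v ∘ σ) = withX 0 v ∘ (σ.viaEmbedding e) := by
    refine eq_of_blocks (fun i ↦ ?_) (fun i ↦ ?_)
    · rw [Function.comp_apply, Equiv.Perm.viaEmbedding_apply_of_notMem _ _ _ (hnot i), hlt, hlt]
    · have h2 : σ.viaEmbedding e (lastPos i) = lastPos (σ i) :=
        Equiv.Perm.viaEmbedding_apply σ e i
      rw [Function.comp_apply, h2, hpos, hpos]; rfl
  simp only [h1]
  refine hT.last _ (forall_pos.2 ⟨fun i _ ↦ ?_, fun i hi ↦ ?_⟩) _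
  · exact Equiv.Perm.viaEmbedding_apply_of_notMem _ _ _ (hnot i)
  · simp at hi

end Prolongation

/-! ### Gauge transformations of flat connections -/

section Gauge

variable {E F : Type*} [NormedAddCommGroup E] [NormedSpace ℝ E] [NormedAddCommGroup F]
  [NormedSpace ℝ F]

/-- The failure of the family of linear maps `g`, over the map `ψ` of the base, to intertwine the
connections `∂ + A` and `∂ + A'`. -/
def gaugeDefect (A A' : E → E →L[ℝ] F →L[ℝ] F) (ψ : E → E) (g : E → F →L[ℝ] F) (y a : E) (v : F) :
    F :=
  fderiv ℝ g y a v + A' (ψ y) (fderiv ℝ ψ y a) (g y v) - g y (A y a v)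

theorem ContDiffOn.hasFDerivAt_of_mem {G : Type*} [NormedAddCommGroup G] [NormedSpace ℝ G]
    {U : Set E} (hU : IsOpen U) {f : E → G} (hf : ContDiffOn ℝ ∞ f U) {y : E} (hy : y ∈ U) :
    HasFDerivAt f (fderiv ℝ f y) y :=
  ((hf.contDiffAt (hU.mem_nhds hy)).differentiableAt (by simp)).hasFDerivAt

theorem ContDiffOn.fderiv_fderiv_comm {G : Type*} [NormedAddCommGroup G] [NormedSpace ℝ G]
    {U : Set E} (hU : IsOpen U) {f : E → G} (hf : ContDiffOn ℝ ∞ f U) {y : E} (hy : y ∈ U)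
    (a b : E) : fderiv ℝ (fderiv ℝ f) y a b = fderiv ℝ (fderiv ℝ f) y b a :=
  (hf.contDiffAt (hU.mem_nhds hy)).isSymmSndFDerivAt (by
    rw [minSmoothness_of_isRCLikeNormedField]
    exact WithTop.coe_le_coe.2 (le_top : (2 : ℕ∞) ≤ ⊤)) _ _

set_option synthInstance.maxHeartbeats 400000 in
/-- The covariant exterior derivative of the gauge defect between two flat connections vanishes. -/
theorem fderiv_gaugeDefect_sub {A A' : E → E →L[ℝ] F →L[ℝ] F} {ψ : E → E} {g : E → F →L[ℝ] F}
    {U U' : Set E} (hU : IsOpen U) (hU' : IsOpen U') (hA : ContDiffOn ℝ ∞ A U)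
    (hA' : ContDiffOn ℝ ∞ A' U') (hψ : ContDiffOn ℝ ∞ ψ U) (hψU : MapsTo ψ U U')
    (hg : ContDiffOn ℝ ∞ g U) {y : E} (hy : y ∈ U)
    (hflat : ∀ a b v, fderiv ℝ A y a b v - fderiv ℝ A y b a v
      + A y a (A y b v) - A y b (A y a v) = 0)
    (hflat' : ∀ a b v, fderiv ℝ A' (ψ y) a b v - fderiv ℝ A' (ψ y) b a v
      + A' (ψ y) a (A' (ψ y) b v) - A' (ψ y) b (A' (ψ y) a v) = 0) (a b : E) (v : F) :
    fderiv ℝ (fun z ↦ gaugeDefect A A' ψ g z b v) y a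
        - fderiv ℝ (fun z ↦ gaugeDefect A A' ψ g z a v) y b
      = A' (ψ y) (fderiv ℝ ψ y b) (gaugeDefect A A' ψ g y a v)
        - A' (ψ y) (fderiv ℝ ψ y a) (gaugeDefect A A' ψ g y b v)
        - gaugeDefect A A' ψ g y a (A y b v) + gaugeDefect A A' ψ g y b (A y a v) := by
  have dA := ContDiffOn.hasFDerivAt_of_mem hU hA hy
  have dA' := ContDiffOn.hasFDerivAt_of_mem hU' hA' (hψU hy)
  have dψ := ContDiffOn.hasFDerivAt_of_mem hU hψ hy
  have dg := ContDiffOn.hasFDerivAt_of_mem hU hg hy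
  have ddψ := ContDiffOn.hasFDerivAt_of_mem hU (hψ.fderiv_of_isOpen hU (m := ∞) (by simp)) hy
  have ddg := ContDiffOn.hasFDerivAt_of_mem hU (hg.fderiv_of_isOpen hU (m := ∞) (by simp)) hy
  have key : ∀ a b : E, fderiv ℝ (fun z ↦ gaugeDefect A A' ψ g z b v) y a
      = fderiv ℝ (fderiv ℝ g) y a b v
        + (fderiv ℝ A' (ψ y) (fderiv ℝ ψ y a) (fderiv ℝ ψ y b) (g y v)
          + A' (ψ y) (fderiv ℝ (fderiv ℝ ψ) y a b) (g y v)
          + A' (ψ y) (fderiv ℝ ψ y b) (fderiv ℝ g y a v))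
        - (fderiv ℝ g y a (A y b v) + g y (fderiv ℝ A y a b v)) := by
    intro a b
    have h1 := (ddg.clm_apply (hasFDerivAt_const b y)).clm_apply (hasFDerivAt_const v y)
    have hA'ψ : HasFDerivAt (fun z ↦ A' (ψ z)) _ y := dA'.comp y dψ
    have h2 := (hA'ψ.clm_apply (ddψ.clm_apply (hasFDerivAt_const b y))).clm_apply
      (dg.clm_apply (hasFDerivAt_const v y))
    have h3 := dg.clm_apply
      ((dA.clm_apply (hasFDerivAt_const b y)).clm_apply (hasFDerivAt_const v y))
    have h4 := (h1.add h2).sub h3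
    have h5 : fderiv ℝ (fun z ↦ gaugeDefect A A' ψ g z b v) y = _ := h4.fderiv
    rw [h5]
    simp
    abel
  rw [key, key, ContDiffOn.fderiv_fderiv_comm hU hg hy b a,
    ContDiffOn.fderiv_fderiv_comm hU hψ hy b a]
  have h1 := hflat' (fderiv ℝ ψ y a) (fderiv ℝ ψ y b) (g y v)
  have h2 := congrArg (g y) (hflat a b v)
  simp only [map_add, map_sub, map_zero] at h2
  simp only [gaugeDefect, map_add, map_sub]
  rw [← sub_eq_zero] at h1 h2 ⊢
  rw [← sub_eq_zero.2 (h1.trans h2.symm)]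
  abel

end Gauge

/-! ### Traces and determinants -/

section Trace

variable {n : ℕ}

theorem tr_eq_trace (f : Coord n →ₗ[ℝ] Coord n) : tr f = LinearMap.trace ℝ _ f := by
  rw [LinearMap.trace_eq_matrix_trace ℝ (EuclideanSpace.basisFun (Fin n) ℝ).toBasis]
  simp [tr, Matrix.trace, LinearMap.toMatrix_apply]

theorem tr_conj {J K : Coord n →ₗ[ℝ] Coord n} (h : J ∘ₗ K = LinearMap.id)
    (f : Coord n →ₗ[ℝ] Coord n) : tr (fun b ↦ K (f (J b))) = tr f := by
  have h1 := tr_eq_trace (K ∘ₗ f ∘ₗ J)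
  rw [← LinearMap.comp_assoc, LinearMap.trace_comp_comm', ← LinearMap.comp_assoc, h,
    LinearMap.id_comp, ← tr_eq_trace] at h1
  exact h1

theorem tr_add (f g : Coord n → Coord n) : tr (fun b ↦ f b + g b) = tr f + tr g := by
  simp [tr, Finset.sum_add_distrib]

theorem tr_smul (c : ℝ) (f : Coord n → Coord n) : tr (fun b ↦ c • f b) = c * tr f := by
  simp [tr, Finset.mul_sum]

theorem tr_id : tr (fun b : Coord n ↦ b) = n := by simp [tr]

theorem sum_smul_stdVec (a : Coord n) : ∑ i, a i • stdVec i = a := by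
  ext j
  simp [Finset.sum_apply, Pi.single_apply]

theorem tr_rankOne (f : Coord n →ₗ[ℝ] ℝ) (a : Coord n) : tr (fun b ↦ f b • a) = f a := by
  conv_rhs => rw [← sum_smul_stdVec a, map_sum]
  simp [tr, mul_comm]

/-- The derivative of the determinant at an invertible map `J y` with inverse `K`. -/
theorem hasFDerivAt_clm_det {J : Coord n → Coord n →L[ℝ] Coord n} {y : Coord n}
    (hJ : DifferentiableAt ℝ J y) {K : Coord n →L[ℝ] Coord n} (h : K ∘L J y = .id ℝ _)
    (h' : J y ∘L K = .id ℝ _) :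
    DifferentiableAt ℝ (fun z ↦ (J z).det) y ∧ ∀ a, fderiv ℝ (fun z ↦ (J z).det) y a
      = (J y).det * tr (fun b ↦ K (fderiv ℝ J y a b)) := by
  let B := (EuclideanSpace.basisFun (Fin n) ℝ).toBasis
  let T : (Fin n → Fin n → ℝ) → ℝ := fun M ↦ Matrix.det (Matrix.of M)
  have hT : IsMultilin T :=
    ⟨(Matrix.detRowAlternating (n := Fin n) (R := ℝ)).toMultilinearMap, rfl⟩
  -- the rows of the matrix of `K ∘ J z`
  let f : Fin n → Coord n → Fin n → ℝ := fun i z j ↦ K (J z (stdVec j)) i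
  have hJe : ∀ j, HasFDerivAt (fun z ↦ K (J z (stdVec j)))
      (K ∘L (fderiv ℝ J y).flip (stdVec j)) y := fun j ↦
    K.hasFDerivAt.comp y (by
      have := hJ.hasFDerivAt.clm_apply (hasFDerivAt_const (stdVec j) y)
      simpa using this)
  have hfe : ∀ i j, HasFDerivAt (fun z ↦ f i z j)
      ((EuclideanSpace.proj (𝕜 := ℝ) i) ∘L (K ∘L (fderiv ℝ J y).flip (stdVec j))) y := fun i j ↦
    (EuclideanSpace.proj (𝕜 := ℝ) i).hasFDerivAt.comp y (hJe j)
  have hf : ∀ i, HasFDerivAt (f i) (ContinuousLinearMap.pi fun j ↦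
      (EuclideanSpace.proj (𝕜 := ℝ) i) ∘L (K ∘L (fderiv ℝ J y).flip (stdVec j))) y := fun i ↦
    hasFDerivAt_pi.2 fun j ↦ hfe i j
  have hdet : ∀ z, (J z).det = (J y).det * T (fun i ↦ f i z) := by
    intro z
    have h1 : T (fun i ↦ f i z) = (K ∘L J z).det := by
      rw [ContinuousLinearMap.det, ← LinearMap.det_toMatrix B]
      congr 1
    have h2 : J z = J y ∘L (K ∘L J z) := by
      rw [← ContinuousLinearMap.comp_assoc, h']
      rfl
    rw [h1]
    conv_lhs => rw [h2]
    simp only [ContinuousLinearMap.det, ContinuousLinearMap.toLinearMap_comp, LinearMap.det_comp]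
  have hone : (Matrix.of fun i ↦ f i y) = 1 := by
    ext i j
    have : K (J y (stdVec j)) = stdVec j := DFunLike.congr_fun h (stdVec j)
    simp [f, this, Matrix.one_apply]
  have hdiff : DifferentiableAt ℝ (fun z ↦ T (fun i ↦ f i z)) y := by
    have h1 : Differentiable ℝ T := by
      have : T = fun M ↦ ∑ σ : Equiv.Perm (Fin n), (Equiv.Perm.sign σ : ℤ) • ∏ i, M (σ i) i := by
        funext M
        simp only [T, Matrix.det_apply]
        rfl
      rw [this]
      fun_prop
    exact (h1 _).comp y (differentiableAt_pi.2 fun i ↦ (hf i).differentiableAt)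
  have hfun : (fun z ↦ (J z).det) = fun z ↦ (J y).det * T (fun i ↦ f i z) := funext hdet
  refine ⟨by rw [hfun]; exact hdiff.const_mul _, fun a ↦ ?_⟩
  rw [hfun, fderiv_const_mul hdiff, smul_apply,
    hT.hasFDerivAt (fun i ↦ (hf i).differentiableAt) a, smul_eq_mul]
  congr 1
  simp only [tr]
  refine Finset.sum_congr rfl fun i _ ↦ ?_
  have h3 : T (Function.update (fun i ↦ f i y) i (fderiv ℝ (f i) y a))
      = Matrix.det (Matrix.updateRow 1 i (fderiv ℝ (f i) y a)) := by
    rw [← hone]; rfl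
  rw [h3, ← Matrix.cramer_transpose_apply, Matrix.transpose_one, Matrix.cramer_one, (hf i).fderiv]
  simp

/-- The function `|det Dψ| ^ (-w / (n + 1))`. -/
def densPow (ψ : Coord n → Coord n) (w : ℝ) (y : Coord n) : ℝ :=
  |(fderiv ℝ ψ y).det| ^ (-(w / (n + 1)))

theorem densTrans_eq {M : Type*} [TopologicalSpace M] (w : ℝ)
    (φ φ' : OpenPartialHomeomorph M (Coord n)) :
    densTrans w φ φ' = densPow (transMap φ φ') w := rfl

theorem densPow_eq_rpow (ψ : Coord n → Coord n) (w : ℝ) (y : Coord n) :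
    densPow ψ w y = densPow ψ 1 y ^ w := by
  rw [densPow, densPow, ← Real.rpow_mul (abs_nonneg _)]
  congr 1
  ring

/-- `ψ` is a smooth change of coordinates on the open set `W`, with inverse derivative `K`. -/
structure IsCoordChange (W : Set (Coord n)) (ψ : Coord n → Coord n)
    (K : Coord n → Coord n →L[ℝ] Coord n) : Prop where
  isOpen : IsOpen W
  smooth : ContDiffOn ℝ ∞ ψ W
  left_inv : ∀ y ∈ W, K y ∘L fderiv ℝ ψ y = .id ℝ _
  right_inv : ∀ y ∈ W, fderiv ℝ ψ y ∘L K y = .id ℝ _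

variable {W : Set (Coord n)} {ψ : Coord n → Coord n} {K : Coord n → Coord n →L[ℝ] Coord n}

theorem IsCoordChange.det_ne_zero (h : IsCoordChange W ψ K) {y : Coord n} (hy : y ∈ W) :
    (fderiv ℝ ψ y).det ≠ 0 := by
  intro h0
  have h1 : ((K y) ∘L (fderiv ℝ ψ y)).det = (K y).det * (fderiv ℝ ψ y).det := by
    simp only [ContinuousLinearMap.det, ContinuousLinearMap.toLinearMap_comp, LinearMap.det_comp]
  rw [h.left_inv y hy, h0, mul_zero] at h1
  simp [ContinuousLinearMap.det] at h1

theorem IsCoordChange.densPow_pos (h : IsCoordChange W ψ K) {y : Coord n} (hy : y ∈ W) (w : ℝ) :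
    0 < densPow ψ w y :=
  Real.rpow_pos_of_pos (abs_pos.2 (h.det_ne_zero hy)) _

theorem IsCoordChange.contDiffOn_fderiv (h : IsCoordChange W ψ K) :
    ContDiffOn ℝ ∞ (fderiv ℝ ψ) W := h.smooth.fderiv_of_isOpen h.isOpen (by simp)

theorem contDiff_clm_det : ContDiff ℝ ∞ (fun f : Coord n →L[ℝ] Coord n ↦ f.det) := by
  have h1 : (fun f : Coord n →L[ℝ] Coord n ↦ f.det) = fun f ↦ ∑ σ : Equiv.Perm (Fin n),
      ((Equiv.Perm.sign σ : ℤ) : ℝ) * ∏ i, f (stdVec i) (σ i) := by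
    funext f
    rw [ContinuousLinearMap.det,
      ← LinearMap.det_toMatrix (EuclideanSpace.basisFun (Fin n) ℝ).toBasis, Matrix.det_apply]
    refine Finset.sum_congr rfl fun σ _ ↦ ?_
    rw [Units.smul_def, zsmul_eq_mul]
    congr 1
  rw [h1]
  refine ContDiff.sum fun σ _ ↦ contDiff_const.mul (contDiff_prod fun i _ ↦ ?_)
  exact ((EuclideanSpace.proj (𝕜 := ℝ) (σ i)) ∘L
    (ContinuousLinearMap.apply ℝ (Coord n) (stdVec i))).contDiff

theorem IsCoordChange.contDiffOn_densPow (h : IsCoordChange W ψ K) (w : ℝ) :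
    ContDiffOn ℝ ∞ (densPow ψ w) W := by
  intro y hy
  have h1 : ContDiffWithinAt ℝ ∞ (fun z ↦ (fderiv ℝ ψ z).det) W y :=
    contDiff_clm_det.contDiffAt.comp_contDiffWithinAt y (h.contDiffOn_fderiv y hy)
  exact (h1.abs (h.det_ne_zero hy)).rpow_const_of_ne (abs_pos.2 (h.det_ne_zero hy)).ne'

theorem IsCoordChange.fderiv_densPow_one (h : IsCoordChange W ψ K) {y : Coord n} (hy : y ∈ W)
    (a : Coord n) : fderiv ℝ (densPow ψ 1) y a
      = -(tr (fun b ↦ K y (fderiv ℝ (fderiv ℝ ψ) y a b)) / (n + 1)) * densPow ψ 1 y := by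
  obtain ⟨h1, h2⟩ := hasFDerivAt_clm_det
    (ContDiffOn.hasFDerivAt_of_mem h.isOpen h.contDiffOn_fderiv hy).differentiableAt
    (h.left_inv y hy) (h.right_inv y hy)
  have hne := h.det_ne_zero hy
  -- `|x| ^ p = exp (p log x)`, as `Real.log x = log |x|`
  have h3 : densPow ψ 1 =ᶠ[𝓝 y]
      fun z ↦ Real.exp (-(1 / (n + 1)) * Real.log (fderiv ℝ ψ z).det) := by
    filter_upwards [h.isOpen.mem_nhds hy] with z hz
    rw [densPow, Real.rpow_def_of_pos (abs_pos.2 (h.det_ne_zero hz)), Real.log_abs, mul_comm]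
  have h4 := ((h1.hasFDerivAt.log hne).const_mul (-(1 / ((n : ℝ) + 1)))).exp
  rw [h3.fderiv_eq, h4.fderiv, h3.eq_of_nhds]
  simp only [smul_apply, smul_eq_mul, h2]
  field_simp

theorem IsCoordChange.fderiv_densPow (h : IsCoordChange W ψ K) {y : Coord n} (hy : y ∈ W)
    (w : ℝ) (a : Coord n) : fderiv ℝ (densPow ψ w) y a
      = w * densPow ψ (w - 1) y * fderiv ℝ (densPow ψ 1) y a := by
  have hpos := h.densPow_pos hy 1
  have h1 := (ContDiffOn.hasFDerivAt_of_mem h.isOpen (h.contDiffOn_densPow 1) hy).rpow_const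
    (p := w) (Or.inl hpos.ne')
  have h2 : densPow ψ w = fun z ↦ densPow ψ 1 z ^ w := funext fun z ↦ densPow_eq_rpow ψ w z
  rw [h2, h1.fderiv, densPow_eq_rpow ψ (w - 1)]
  simp

end Trace

/-! ### The normal tractor connection of a connection with given coefficients -/

section TractorForm

variable {n : ℕ}

/-- A smooth family of bilinear maps is a smooth function with values in the normed space of
continuous bilinear maps. -/
theorem exists_clm_of_bilinear {E F F' : Type*} [NormedAddCommGroup E] [NormedSpace ℝ E]
    [NormedAddCommGroup F] [NormedSpace ℝ F] [NormedAddCommGroup F'] [NormedSpace ℝ F']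
    [FiniteDimensional ℝ E] [FiniteDimensional ℝ F] {U : Set E} {T : E → E → F → F'}
    (hT : ∀ a v, ContDiffOn ℝ ∞ (fun y ↦ T y a v) U)
    (hb : ∀ y ∈ U, ∃ B : E →ₗ[ℝ] F →ₗ[ℝ] F', ∀ a v, B a v = T y a v) :
    ∃ A : E → E →L[ℝ] F →L[ℝ] F', ContDiffOn ℝ ∞ A U ∧ ∀ y ∈ U, ∀ a v, A y a v = T y a v := by
  classical
  choose! B hB using hb
  refine ⟨fun y ↦ (B y).toContinuousBilinearMap, ?_, hB⟩
  rw [contDiffOn_clm_apply]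
  intro a
  rw [contDiffOn_clm_apply]
  exact fun v ↦ (hT a v).congr fun y hy ↦ hB y hy a v

/-- The connection coefficients given by a family of continuous bilinear maps. -/
abbrev coeff (G : Coord n → Coord n →L[ℝ] Coord n →L[ℝ] Coord n) (y a b : Coord n) : Coord n :=
  G y a b

/-- The linear map `f ↦ tr f / (n + 1)`. -/
def densCLM (n : ℕ) : (Coord n →L[ℝ] Coord n) →L[ℝ] ℝ :=
  ((n : ℝ) + 1)⁻¹ • ∑ i : Fin n,
    (EuclideanSpace.proj i : Coord n →L[ℝ] ℝ) ∘L ContinuousLinearMap.apply ℝ (Coord n) (stdVec i)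

theorem densCLM_apply (f : Coord n →L[ℝ] Coord n) : densCLM n f = tr f / (n + 1) := by
  simp [densCLM, tr, div_eq_inv_mul]

theorem densForm_coeff (G : Coord n → Coord n →L[ℝ] Coord n →L[ℝ] Coord n) (y a : Coord n) :
    densForm (coeff G) y a = densCLM n (G y a) := (densCLM_apply _).symm

variable {U : Set (Coord n)} {G : Coord n → Coord n →L[ℝ] Coord n →L[ℝ] Coord n}

theorem contDiffOn_densForm (hG : ContDiffOn ℝ ∞ G U) (a : Coord n) :
    ContDiffOn ℝ ∞ (fun y ↦ densForm (coeff G) y a) U := by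
  simp only [densForm_coeff]
  exact (densCLM n).contDiff.comp_contDiffOn (hG.clm_apply contDiffOn_const)

set_option maxSynthPendingDepth 6 in
theorem fderiv_densForm (hU : IsOpen U) (hG : ContDiffOn ℝ ∞ G U) {y : Coord n} (hy : y ∈ U)
    (v a : Coord n) : fderiv ℝ (fun z ↦ densForm (coeff G) z v) y a
      = densCLM n (fderiv ℝ G y a v) := by
  simp only [densForm_coeff]
  have h := (densCLM n).hasFDerivAt.comp y
    ((ContDiffOn.hasFDerivAt_of_mem hU hG hy).clm_apply (hasFDerivAt_const v y))
  rw [show (fun z ↦ densCLM n (G z v)) = densCLM n ∘ fun z ↦ G z v from rfl, h.fderiv]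
  simp

set_option maxSynthPendingDepth 6 in
theorem curv_coeff (hU : IsOpen U) (hG : ContDiffOn ℝ ∞ G U) {y : Coord n} (hy : y ∈ U)
    (a b c : Coord n) : curv (coeff G) y a b c
      = fderiv ℝ G y a b c - fderiv ℝ G y b a c + G y a (G y b c) - G y b (G y a c) := by
  simp only [curv, coeff, fderiv_clm_apply₂ hU hG hy]

set_option maxSynthPendingDepth 6 in
theorem contDiffOn_curv (hU : IsOpen U) (hG : ContDiffOn ℝ ∞ G U) (a b c : Coord n) :
    ContDiffOn ℝ ∞ (fun y ↦ curv (coeff G) y a b c) U := by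
  have hG' : ContDiffOn ℝ ∞ (fderiv ℝ G) U := hG.fderiv_of_isOpen hU (by simp)
  have h1 : ∀ a b c, ContDiffOn ℝ ∞ (fun y ↦ fderiv ℝ G y a b c) U := fun a b c ↦
    ((hG'.clm_apply contDiffOn_const).clm_apply contDiffOn_const).clm_apply contDiffOn_const
  have h2 : ∀ a b c, ContDiffOn ℝ ∞ (fun y ↦ G y a (G y b c)) U := fun a b c ↦
    (hG.clm_apply contDiffOn_const).clm_apply (contDiffOn_clm_apply₂ hG b c)
  exact ((((h1 a b c).sub (h1 b a c)).add (h2 a b c)).sub (h2 b a c)).congr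
    fun y hy ↦ curv_coeff hU hG hy a b c

theorem contDiffOn_schouten (hU : IsOpen U) (hG : ContDiffOn ℝ ∞ G U) (a b : Coord n) :
    ContDiffOn ℝ ∞ (fun y ↦ schouten (coeff G) y a b) U := by
  have h : ∀ a b, ContDiffOn ℝ ∞ (fun y ↦ ricci (coeff G) y a b) U := fun a b ↦ by
    simp only [ricci, tr]
    exact ContDiffOn.sum fun i _ ↦ (EuclideanSpace.proj (𝕜 := ℝ) i).contDiff.comp_contDiffOn
      (contDiffOn_curv hU hG _ a b)
  exact ((contDiffOn_const.mul (h a b)).add (h b a)).div_const _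

set_option maxSynthPendingDepth 6 in
theorem exists_schouten_bilinear (hU : IsOpen U) (hG : ContDiffOn ℝ ∞ G U) {y : Coord n}
    (hy : y ∈ U) : ∃ B : Coord n →ₗ[ℝ] Coord n →ₗ[ℝ] ℝ, ∀ a b, B a b = schouten (coeff G) y a b :=
      by
  have hadd : ∀ a a' b c, curv (coeff G) y c (a + a') b
      = curv (coeff G) y c a b + curv (coeff G) y c a' b := by
    intro a a' b c
    simp only [curv_coeff hU hG hy, map_add, add_apply]
    abel
  have hadd' : ∀ a b b' c, curv (coeff G) y c a (b + b')
      = curv (coeff G) y c a b + curv (coeff G) y c a b' := by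
    intro a b b' c
    simp only [curv_coeff hU hG hy, map_add]
    abel
  have hsmul : ∀ (s : ℝ) a b c, curv (coeff G) y c (s • a) b = s • curv (coeff G) y c a b := by
    intro s a b c
    simp only [curv_coeff hU hG hy, map_smul, smul_apply]
    module
  have hsmul' : ∀ (s : ℝ) a b c, curv (coeff G) y c a (s • b) = s • curv (coeff G) y c a b := by
    intro s a b c
    simp only [curv_coeff hU hG hy, map_smul]
    module
  refine ⟨LinearMap.mk₂ ℝ (schouten (coeff G) y) ?_ ?_ ?_ ?_, fun _ _ ↦ rfl⟩ <;> intros <;>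
    simp only [schouten, ricci, hadd, hadd', hsmul, hsmul', tr_add, tr_smul, smul_eq_mul] <;> ring

theorem contDiffOn_tractorForm (hU : IsOpen U) (hG : ContDiffOn ℝ ∞ G U) (a : Coord n) (v : Tr n) :
    ContDiffOn ℝ ∞ (fun y ↦ tractorForm (coeff G) y a v) U := by
  have hθ : ∀ a, ContDiffOn ℝ ∞ (fun y ↦ densForm (coeff G) y a) U := contDiffOn_densForm hG
  have hρ : ContDiffOn ℝ ∞ (fun y ↦ splitY (coeff G) y v) U := contDiffOn_const.sub (hθ _)
  have hu : ContDiffOn ℝ ∞ (fun y ↦ (coeff G y a v.2 - densForm (coeff G) y a • v.2)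
      + splitY (coeff G) y v • a) U :=
    ((contDiffOn_clm_apply₂ hG _ _).sub ((hθ a).smul contDiffOn_const)).add
      (hρ.smul contDiffOn_const)
  have hθu : ContDiffOn ℝ ∞ (fun y ↦ densForm (coeff G) y ((coeff G y a v.2
      - densForm (coeff G) y a • v.2) + splitY (coeff G) y v • a)) U := by
    simp only [densForm_coeff _ _ (_ + _)]
    exact (densCLM n).contDiff.comp_contDiffOn (hG.clm_apply hu)
  have hdθ : ContDiffOn ℝ ∞ (fun y ↦ fderiv ℝ (fun z ↦ densForm (coeff G) z v.2) y a) U :=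
    ((hθ v.2).fderiv_of_isOpen hU (by simp)).clm_apply contDiffOn_const
  exact (((hdθ.neg.sub ((hθ a).mul hρ)).sub (contDiffOn_schouten hU hG a v.2)).add hθu).prodMk hu

theorem exists_bilinear_of_tractor_formula {C : Type*} [AddCommGroup C] [Module ℝ C]
    (Γ : C →ₗ[ℝ] C →ₗ[ℝ] C) (θ : C →ₗ[ℝ] ℝ) (P : C →ₗ[ℝ] C →ₗ[ℝ] ℝ) :
    ∃ B : C →ₗ[ℝ] (ℝ × C) →ₗ[ℝ] (ℝ × C), ∀ a v, B a v
      = (P a v.2 - θ a * (v.1 - θ v.2) + θ (Γ a v.2 - θ a • v.2 + (v.1 - θ v.2) • a),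
        Γ a v.2 - θ a • v.2 + (v.1 - θ v.2) • a) := by
  refine ⟨LinearMap.mk₂ ℝ (fun a v ↦
    (P a v.2 - θ a * (v.1 - θ v.2) + θ (Γ a v.2 - θ a • v.2 + (v.1 - θ v.2) • a),
        Γ a v.2 - θ a • v.2 + (v.1 - θ v.2) • a)) ?_ ?_ ?_ ?_, fun _ _ ↦ rfl⟩ <;> intros <;>
    refine Prod.ext ?_ ?_ <;>
    simp only [Prod.fst_add, Prod.snd_add, Prod.smul_fst, Prod.smul_snd, map_add, map_sub, map_smul,
      LinearMap.add_apply, LinearMap.smul_apply, smul_eq_mul] <;>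
    first | ring1 | module

set_option maxSynthPendingDepth 6 in
theorem exists_tractorForm_bilinear (hU : IsOpen U) (hG : ContDiffOn ℝ ∞ G U) {y : Coord n}
    (hy : y ∈ U) :
    ∃ B : Coord n →ₗ[ℝ] Tr n →ₗ[ℝ] Tr n, ∀ a v, B a v = tractorForm (coeff G) y a v := by
  obtain ⟨P, hP⟩ := exists_schouten_bilinear hU hG hy
  let dθ : Coord n →ₗ[ℝ] Coord n →ₗ[ℝ] ℝ :=
    LinearMap.mk₂ ℝ (fun a v ↦ densCLM n (fderiv ℝ G y a v)) (by intros; simp) (by intros; simp)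
      (by intros; simp) (by intros; simp)
  obtain ⟨B, hB⟩ := exists_bilinear_of_tractor_formula
    (LinearMap.mk₂ ℝ (fun a b ↦ G y a b) (by intros; simp) (by intros; simp)
      (by intros; simp) (by intros; simp)) (densCLM n ∘L G y).toLinearMap (-dθ - P)
  refine ⟨B, fun a v ↦ ?_⟩
  rw [hB, tractorForm, splitY, fderiv_densForm hU hG hy, ← hP]
  simp only [densForm_coeff]
  refine Prod.ext ?_ rfl
  change -(dθ a v.2) - P a v.2 - _ + _ = _
  rw [sub_right_comm]
  rfl

/-- `A` is the normal tractor connection form, over the open set `U`, of the connection with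
coefficients `Γ`, and it is flat. -/
structure IsNormalForm (U : Set (Coord n)) (Γ : Coord n → Coord n → Coord n → Coord n)
    (A : Coord n → Coord n →L[ℝ] Tr n →L[ℝ] Tr n) : Prop extends IsFlatTractorForm U A where
  apply_eq_form : ∀ y ∈ U, ∀ a v, A y a v = tractorForm Γ y a v

theorem exists_isNormalForm (hU : IsOpen U) (hG : ContDiffOn ℝ ∞ G U)
    (hflat : ∀ y ∈ U, ∀ a b v, tractorCurv (coeff G) y a b v = 0) :
    ∃ A, IsNormalForm U (coeff G) A := by
  obtain ⟨A, hA, hAe⟩ := exists_clm_of_bilinear (contDiffOn_tractorForm hU hG)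
    (fun y hy ↦ exists_tractorForm_bilinear hU hG hy)
  refine ⟨A, ⟨hU, hA, fun y hy a ↦ ?_, fun y hy a b v ↦ ?_⟩, hAe⟩
  · rw [hAe y hy]
    have h0 : (fun z ↦ densForm (coeff G) z 0) = fun _ ↦ 0 := by
      funext z; rw [densForm_coeff, map_zero, map_zero]
    obtain ⟨P, hP⟩ := exists_schouten_bilinear hU hG hy
    simp only [tractorForm, splitY, h0, ← hP]
    simp [densForm_coeff]
  · rw [← hflat y hy a b v, tractorCurv]
    have h : ∀ b, (fun z ↦ tractorForm (coeff G) z b v) =ᶠ[𝓝 y] fun z ↦ A z b v := fun b ↦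
      Filter.mem_of_superset (hU.mem_nhds hy) fun z hz ↦ (hAe z hz b v).symm
    rw [(h b).fderiv_eq, (h a).fderiv_eq, fderiv_clm_apply₂ hU hA hy, fderiv_clm_apply₂ hU hA hy]
    simp only [← hAe y hy]

variable {Γ : Coord n → Coord n → Coord n → Coord n} {A : Coord n → Coord n →L[ℝ] Tr n →L[ℝ] Tr n}
  {m : ℕ}

theorem covDeriv_tractorForm (hA : IsNormalForm U Γ A) (V : Coord n → (Fin m → Tr n) → ℝ)
    {y : Coord n} (hy : y ∈ U) (θ : Coord n → Coord n → ℝ) (a : Coord n) (v : Fin m → Tr n) :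
    covDeriv (tractorForm Γ) θ 0 V y a v = tractorDeriv A V y a v := by
  simp [covDeriv, tractorDeriv, hA.apply_eq_form y hy]

theorem thomasD_eq (hA : IsNormalForm U Γ A) (w : ℝ) (V : Coord n → (Fin m → Tr n) → ℝ)
    {y : Coord n} (hy : y ∈ U) : thomasD Γ w V y = thomas A w V y := by
  funext v
  simp only [thomasD, thomas, covDeriv, tractorDeriv, splitY, hA.apply_eq_form y hy]
  ring

theorem iterThomasD_eq (hA : IsNormalForm U Γ A) (w : ℝ) (V : Coord n → (Fin m → Tr n) → ℝ) (j : ℕ)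
    {y : Coord n} (hy : y ∈ U) : iterThomasD Γ w V j y = iterThomas A w V j y := by
  induction j generalizing y with
  | zero => rfl
  | succ j ih =>
    rw [iterThomasD, iterThomas, thomasD_eq hA _ _ hy]
    exact thomas_congr hA.isOpen (fun z hz ↦ ih hz) (fun _ _ ↦ rfl) _ hy

/-- The tractor connection form differentiates the tangent part through the connection on
`TM(-1)`, and this part only depends on the projective class. -/
theorem IsNormalForm.apply_snd {U : Set (Coord n)} (hA : IsNormalForm U Γ A) {y : Coord n}
    (hy : y ∈ U) (a : Coord n) (v : Tr n) :
    (A y a v).2 = v.1 • a + (Γ y a v.2 - densForm Γ y a • v.2 - densForm Γ y v.2 • a) := by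
  rw [hA.apply_eq_form y hy]
  simp only [tractorForm, splitY]
  module

end TractorForm

/-! ### Invariance of the tractor connection and of the Thomas operator -/

section Invariance

variable {n : ℕ} {U U' W : Set (Coord n)} {ψ : Coord n → Coord n}
  {K : Coord n → Coord n →L[ℝ] Coord n} {A A' : Coord n → Coord n →L[ℝ] Tr n →L[ℝ] Tr n}
  {g : Coord n → Tr n →L[ℝ] Tr n}

theorem fderiv_snd_eq_zero {E F F' : Type*} [NormedAddCommGroup E] [NormedSpace ℝ E]
    [NormedAddCommGroup F] [NormedSpace ℝ F] [NormedAddCommGroup F'] [NormedSpace ℝ F']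
    {f : E → F × F'} {y : E} (h : ∀ᶠ z in 𝓝 y, (f z).2 = 0) (a : E) : (fderiv ℝ f y a).2 = 0 := by
  by_cases hf : DifferentiableAt ℝ f y
  · have h1 := hf.hasFDerivAt.snd.fderiv
    have h2 : (fun z ↦ (f z).2) =ᶠ[𝓝 y] fun _ ↦ 0 := h
    rw [h2.fderiv_eq] at h1
    simpa using (DFunLike.congr_fun h1 a).symm
  · rw [fderiv_zero_of_not_differentiableAt hf]; rfl

/-- Two flat tractor connections that are intertwined modulo `X` are intertwined. The defect is of
the form `e_a ⊗ X`, and its covariant exterior derivative is `e_a(v) Dψ(b) - e_b(v) Dψ(a)`, modulo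
`X`. -/
theorem gaugeDefect_eq_zero (hn : 2 ≤ n) (hψ : IsCoordChange W ψ K) (hA : IsFlatTractorForm U A)
    (hA' : IsFlatTractorForm U' A') (hWU : W ⊆ U) (hψU : MapsTo ψ W U') (hg : ContDiffOn ℝ ∞ g W)
    (hsnd : ∀ y ∈ W, ∀ a v, (gaugeDefect A A' ψ g y a v).2 = 0) {y : Coord n} (hy : y ∈ W)
    (a : Coord n) (v : Tr n) : gaugeDefect A A' ψ g y a v = 0 := by
  have key : ∀ a b : Coord n, (gaugeDefect A A' ψ g y a v).1 • b
      = (gaugeDefect A A' ψ g y b v).1 • a := by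
    intro a b
    have h := congrArg Prod.snd (fderiv_gaugeDefect_sub hψ.isOpen hA'.isOpen (hA.smooth.mono hWU)
      hA'.smooth hψ.smooth hψU hg hy (hA.flat y (hWU hy)) (hA'.flat _ (hψU hy)) a b v)
    have hev : ∀ b, ∀ᶠ z in 𝓝 y, (gaugeDefect A A' ψ g z b v).2 = 0 := fun b ↦
      Filter.mem_of_superset (hψ.isOpen.mem_nhds hy) fun z hz ↦ hsnd z hz b v
    have hX : ∀ a b, (A' (ψ y) b (gaugeDefect A A' ψ g y a v)).2
        = (gaugeDefect A A' ψ g y a v).1 • b := by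
      intro a b
      have h1 : gaugeDefect A A' ψ g y a v
          = (gaugeDefect A A' ψ g y a v).1 • ((1, 0) : Tr n) :=
        Prod.ext (by simp) (by simpa using hsnd y hy a v)
      conv_lhs => rw [h1, map_smul, hA'.apply_one _ (hψU hy)]
      rfl
    simp only [Prod.snd_sub, Prod.snd_add, fderiv_snd_eq_zero (hev _), hsnd y hy, hX, sub_zero,
      add_zero] at h
    have h2 := congrArg (K y) (sub_eq_zero.1 h.symm)
    simp only [map_smul] at h2
    have hK : ∀ x, K y (fderiv ℝ ψ y x) = x := DFunLike.congr_fun (hψ.left_inv y hy)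
    rwa [hK, hK] at h2
  -- as `n ≥ 2`, a linear form `e` with `e(a) b = e(b) a` for all `a` and `b` vanishes
  refine Prod.ext ?_ (hsnd y hy a v)
  by_cases ha : a = 0
  · subst ha
    simp [gaugeDefect]
  · obtain ⟨i, hi⟩ : ∃ i, a i ≠ 0 := by
      by_contra! h
      exact ha (by ext i; simpa using h i)
    have : Nontrivial (Fin n) := Fin.nontrivial_iff_two_le.2 hn
    obtain ⟨j, hj⟩ := exists_ne i
    have h1 := congrArg (fun x : Coord n ↦ x i) (key a (stdVec j))
    have h2 := congrArg (fun x : Coord n ↦ x j) (key a (stdVec j))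
    simp only [PiLp.smul_apply, smul_eq_mul, PiLp.single_apply, hj.symm, if_false,
      mul_zero, if_true, mul_one] at h1 h2
    have h3 : (gaugeDefect A A' ψ g y (stdVec j) v).1 = 0 :=
      (mul_eq_zero.1 h1.symm).resolve_right hi
    rw [h2, h3, zero_mul]
    rfl

/-- The transition map of `𝓣` for the change of coordinates `ψ`. -/
def gaugeMap (ψ : Coord n → Coord n) (y : Coord n) : Tr n →L[ℝ] Tr n :=
  (densPow ψ 1 y • ContinuousLinearMap.fst ℝ ℝ (Coord n)
      + (fderiv ℝ (densPow ψ 1) y) ∘L ContinuousLinearMap.snd ℝ ℝ (Coord n)).prod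
    (densPow ψ 1 y • (fderiv ℝ ψ y) ∘L ContinuousLinearMap.snd ℝ ℝ (Coord n))

theorem gaugeMap_apply (ψ : Coord n → Coord n) (y : Coord n) (v : Tr n) : gaugeMap ψ y v
    = (densPow ψ 1 y * v.1 + fderiv ℝ (densPow ψ 1) y v.2, densPow ψ 1 y • fderiv ℝ ψ y v.2) :=
  rfl

theorem IsCoordChange.contDiffOn_gaugeMap_apply (h : IsCoordChange W ψ K) (v : Tr n) :
    ContDiffOn ℝ ∞ (fun y ↦ gaugeMap ψ y v) W := by
  simp only [gaugeMap_apply]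
  have h1 := h.contDiffOn_densPow 1
  exact ((h1.mul contDiffOn_const).add ((h1.fderiv_of_isOpen h.isOpen (m := ∞) (by simp)).clm_apply
    contDiffOn_const)).prodMk (h1.smul (h.contDiffOn_fderiv.clm_apply contDiffOn_const))

theorem IsCoordChange.contDiffOn_gaugeMap (h : IsCoordChange W ψ K) :
    ContDiffOn ℝ ∞ (gaugeMap ψ) W :=
  contDiffOn_clm_apply.2 h.contDiffOn_gaugeMap_apply

theorem IsCoordChange.fderiv_gaugeMap (h : IsCoordChange W ψ K) {y : Coord n} (hy : y ∈ W)
    (a : Coord n) (v : Tr n) : (fderiv ℝ (gaugeMap ψ) y a v).2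
      = fderiv ℝ (densPow ψ 1) y a • fderiv ℝ ψ y v.2
        + densPow ψ 1 y • fderiv ℝ (fderiv ℝ ψ) y a v.2 := by
  have h1 := (ContDiffOn.hasFDerivAt_of_mem h.isOpen h.contDiffOn_gaugeMap hy).clm_apply
    (hasFDerivAt_const v y)
  have h2 := (ContDiffOn.hasFDerivAt_of_mem h.isOpen (h.contDiffOn_densPow 1) hy).smul
    ((ContDiffOn.hasFDerivAt_of_mem h.isOpen h.contDiffOn_fderiv hy).clm_apply
    (hasFDerivAt_const v.2 y))
  have h3 := DFunLike.congr_fun (h1.snd.unique h2) a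
  simp at h3
  rw [h3, add_comm]

/-- The normal tractor connection does not depend on the coordinates. -/
theorem gaugeDefect_gaugeMap (hn : 2 ≤ n) (hψ : IsCoordChange W ψ K)
    {G G' : Coord n → Coord n →L[ℝ] Coord n →L[ℝ] Coord n} (hA : IsNormalForm U (coeff G) A)
    (hA' : IsNormalForm U' (coeff G') A') (hWU : W ⊆ U) (hψU : MapsTo ψ W U')
    (hG : ∀ y ∈ W, ∀ a b, fderiv ℝ ψ y (G y a b)
      = G' (ψ y) (fderiv ℝ ψ y a) (fderiv ℝ ψ y b) + fderiv ℝ (fderiv ℝ ψ) y a b)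
    {y : Coord n} (hy : y ∈ W) (a : Coord n) (v : Tr n) :
    gaugeDefect A A' ψ (gaugeMap ψ) y a v = 0 := by
  refine gaugeDefect_eq_zero hn hψ hA.toIsFlatTractorForm hA'.toIsFlatTractorForm hWU hψU
    hψ.contDiffOn_gaugeMap (fun y hy a v ↦ ?_) hy a v
  have hK : ∀ x, K y (fderiv ℝ ψ y x) = x := DFunLike.congr_fun (hψ.left_inv y hy)
  -- the connection forms of the density bundle differ by the logarithmic derivative of the density
  have hθ : ∀ a, fderiv ℝ (densPow ψ 1) y a = densPow ψ 1 y
      * (densForm (coeff G') (ψ y) (fderiv ℝ ψ y a) - densForm (coeff G) y a) := by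
    intro a
    have h1 : tr (fun b ↦ G y a b)
        = tr (fun b ↦ G' (ψ y) (fderiv ℝ ψ y a) b)
          + tr (fun b ↦ K y (fderiv ℝ (fderiv ℝ ψ) y a b)) := by
      have h2 := tr_conj (J := (fderiv ℝ ψ y).toLinearMap) (K := (K y).toLinearMap)
        (congrArg ContinuousLinearMap.toLinearMap (hψ.right_inv y hy))
        (G' (ψ y) (fderiv ℝ ψ y a)).toLinearMap
      simp only [ContinuousLinearMap.coe_coe] at h2
      rw [← h2, ← tr_add]
      congr 1
      funext b
      rw [← map_add, ← hG y hy, hK]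
    rw [hψ.fderiv_densPow_one hy, densForm, densForm]
    simp only [coeff]
    rw [h1]
    ring
  rw [gaugeDefect, Prod.snd_sub, Prod.snd_add, hψ.fderiv_gaugeMap hy, hA'.apply_snd (hψU hy),
    gaugeMap_apply, gaugeMap_apply, hA.apply_snd (hWU hy), hθ, hθ]
  simp only [coeff, map_add, map_sub, map_smul, hG y hy, densForm_coeff, smul_eq_mul]
  module

/-- The normal tractor connection is the same for all connections in a projective class. -/
theorem IsNormalForm.eq_of_projective_change (hn : 2 ≤ n)
    {G G' : Coord n → Coord n →L[ℝ] Coord n →L[ℝ] Coord n} (hA : IsNormalForm U (coeff G) A)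
    (hA' : IsNormalForm U (coeff G') A') {Υ : Coord n → Coord n →ₗ[ℝ] ℝ}
    (hG : ∀ y ∈ U, ∀ a b, G' y a b = G y a b + Υ y a • b + Υ y b • a) {y : Coord n} (hy : y ∈ U) :
    A y = A' y := by
  -- compare the two connection forms over the identity change of coordinates
  have hid : IsCoordChange U (id : Coord n → Coord n) (fun _ ↦ .id ℝ _) :=
    ⟨hA.isOpen, contDiffOn_id, fun y _ ↦ by rw [fderiv_id]; rfl, fun y _ ↦ by rw [fderiv_id]; rfl⟩
  have hdef : ∀ y a v, gaugeDefect A A' id (fun _ ↦ .id ℝ (Tr n)) y a v = A' y a v - A y a v := by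
    intro y a v
    simp [gaugeDefect]
  have h := gaugeDefect_eq_zero (g := fun _ ↦ .id ℝ (Tr n)) hn hid
    hA.toIsFlatTractorForm hA'.toIsFlatTractorForm Subset.rfl (mapsTo_id U) contDiffOn_const
      (fun y hy a v ↦ ?_) hy
  · refine ContinuousLinearMap.ext fun a ↦ ContinuousLinearMap.ext fun v ↦ ?_
    have h1 := h a v
    rw [hdef] at h1
    exact (sub_eq_zero.1 h1).symm
  · have hθ : ∀ a, densForm (coeff G') y a = densForm (coeff G) y a + Υ y a := by
      intro a
      have h1 : tr (fun b ↦ G' y a b) = tr (fun b ↦ G y a b) + (n + 1) * Υ y a := by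
        simp only [hG y hy]
        rw [tr_add, tr_add, tr_smul, tr_rankOne, tr_id]
        ring
      simp only [densForm, coeff]
      rw [h1]
      field_simp
    rw [hdef, Prod.snd_sub, hA'.apply_snd hy, hA.apply_snd hy, hθ, hθ]
    simp only [coeff, hG y hy]
    module

variable {m : ℕ} {V V' : Coord n → (Fin m → Tr n) → ℝ}

theorem densPow_sub_one_mul (hψ : IsCoordChange W ψ K) {y : Coord n} (hy : y ∈ W) (w : ℝ) :
    densPow ψ (w - 1) y * densPow ψ 1 y = densPow ψ w y := by
  rw [densPow_eq_rpow ψ (w - 1), densPow_eq_rpow ψ w, Real.rpow_sub_one (hψ.densPow_pos hy 1).ne',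
    div_mul_cancel₀ _ (hψ.densPow_pos hy 1).ne']

/-- The Thomas operator is compatible with changes of coordinates. -/
theorem thomas_coordChange (hψ : IsCoordChange W ψ K) (hU' : IsOpen U') (hψU : MapsTo ψ W U')
    (hgauge : ∀ y ∈ W, ∀ a v, gaugeDefect A A' ψ (gaugeMap ψ) y a v = 0)
    (hV' : IsSmoothTensor U' V') {w : ℝ}
    (hV : ∀ y ∈ W, ∀ v, V y v = densPow ψ w y * V' (ψ y) (fun i ↦ gaugeMap ψ y (v i)))
    {y : Coord n} (hy : y ∈ W) (v : Fin (m + 1) → Tr n) : thomas A w V y v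
      = densPow ψ (w - 1) y * thomas A' w V' (ψ y) (fun i ↦ gaugeMap ψ y (v i)) := by
  obtain ⟨a, v, rfl⟩ : ∃ a u, v = Fin.cons a u := ⟨v 0, Fin.tail v, (Fin.cons_self_tail v).symm⟩
  have hcons : (fun i ↦ gaugeMap ψ y ((Fin.cons a v : Fin (m + 1) → Tr n) i))
      = Fin.cons (gaugeMap ψ y a) (fun i ↦ gaugeMap ψ y (v i)) := by
    funext i
    refine Fin.cases ?_ (fun i ↦ ?_) i <;> simp
  have hVψ : IsSmoothTensor W (fun z ↦ V' (ψ z)) :=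
    ⟨fun v ↦ (hV'.smooth v).comp hψ.smooth hψU, fun z hz ↦ hV'.multilin _ (hψU hz)⟩
  have hψ' := ContDiffOn.hasFDerivAt_of_mem hψ.isOpen hψ.smooth hy
  have hg := ContDiffOn.hasFDerivAt_of_mem hψ.isOpen hψ.contDiffOn_gaugeMap hy
  have hm := hV'.multilin _ (hψU hy)
  have h1 : ∀ b, fderiv ℝ (fun z ↦ V z v) y b
      = fderiv ℝ (densPow ψ w) y b * V' (ψ y) (fun i ↦ gaugeMap ψ y (v i))
        + densPow ψ w y * (fderiv ℝ (fun z ↦ V' z (fun i ↦ gaugeMap ψ y (v i))) (ψ y)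
            (fderiv ℝ ψ y b)
          + ∑ i, V' (ψ y) (Function.update (fun i ↦ gaugeMap ψ y (v i)) i
            (fderiv ℝ (gaugeMap ψ) y b (v i)))) := by
    intro b
    have h2 : (fun z ↦ V z v) =ᶠ[𝓝 y]
        fun z ↦ densPow ψ w z * V' (ψ z) (fun i ↦ gaugeMap ψ z (v i)) :=
      Filter.mem_of_superset (hψ.isOpen.mem_nhds hy) fun z hz ↦ hV z hz v
    have hsm : ContDiffOn ℝ ∞ (fun z ↦ V' (ψ z) (fun i ↦ gaugeMap ψ z (v i))) W :=
      hVψ.contDiffOn_comp contDiffOn_id (mapsTo_id W) fun i ↦ hψ.contDiffOn_gaugeMap_apply (v i)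
    have h3 : HasFDerivAt (fun z ↦ densPow ψ w z * V' (ψ z) (fun i ↦ gaugeMap ψ z (v i))) _ y :=
      (ContDiffOn.hasFDerivAt_of_mem hψ.isOpen (hψ.contDiffOn_densPow w) hy).mul
      (ContDiffOn.hasFDerivAt_of_mem hψ.isOpen hsm hy)
    have h4 : HasFDerivAt (fun z ↦ V' (ψ z) (fun i ↦ gaugeMap ψ y (v i))) _ y :=
      (ContDiffOn.hasFDerivAt_of_mem hU' (hV'.smooth (fun i ↦ gaugeMap ψ y (v i)))
        (hψU hy)).comp y hψ'
    rw [h2.fderiv_eq, h3.fderiv]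
    simp only [add_apply, smul_apply, smul_eq_mul]
    rw [hVψ.fderiv_comp hψ.isOpen hy (fun i ↦ hψ.contDiffOn_gaugeMap_apply (v i)), h4.fderiv]
    have h5 : ∀ i, fderiv ℝ (fun z ↦ gaugeMap ψ z (v i)) y b
        = fderiv ℝ (gaugeMap ψ) y b (v i) := by
      intro i
      rw [(hg.clm_apply (hasFDerivAt_const (v i) y)).fderiv]
      simp
    simp only [h5, ContinuousLinearMap.comp_apply]
    ring
  have h6 : ∀ b i, fderiv ℝ (gaugeMap ψ) y b (v i) = gaugeMap ψ y (A y b (v i))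
      - A' (ψ y) (fderiv ℝ ψ y b) (gaugeMap ψ y (v i)) := by
    intro b i
    have := hgauge y hy b (v i)
    rw [gaugeDefect, sub_eq_zero] at this
    rw [← this, add_sub_cancel_right]
  have h7 : ∀ i x, (fun j ↦ gaugeMap ψ y (Function.update v i x j))
      = Function.update (fun j ↦ gaugeMap ψ y (v j)) i (gaugeMap ψ y x) := by
    intro i x
    funext j
    by_cases hj : j = i
    · subst hj; simp
    · simp [hj]
  rw [hcons, thomas_cons, thomas_cons, tractorDeriv, tractorDeriv, h1, hV y hy, gaugeMap_apply]
  simp only [h6, hV y hy, h7, hm.update_sub, Finset.sum_sub_distrib, ← Finset.mul_sum, map_smul,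
    smul_apply, smul_eq_mul, hm.update_smul]
  rw [hψ.fderiv_densPow hy, ← densPow_sub_one_mul hψ hy w]
  ring

theorem iterThomas_coordChange (hψ : IsCoordChange W ψ K) (hU' : IsOpen U') (hψU : MapsTo ψ W U')
    (hA' : ContDiffOn ℝ ∞ A' U')
    (hgauge : ∀ y ∈ W, ∀ a v, gaugeDefect A A' ψ (gaugeMap ψ) y a v = 0)
    (hV' : IsSmoothTensor U' V') {w : ℝ}
    (hV : ∀ y ∈ W, ∀ v, V y v = densPow ψ w y * V' (ψ y) (fun i ↦ gaugeMap ψ y (v i))) (j : ℕ)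
    {y : Coord n} (hy : y ∈ W) (v : Fin (m + j) → Tr n) : iterThomas A w V j y v
      = densPow ψ (w - j) y * iterThomas A' w V' j (ψ y) (fun i ↦ gaugeMap ψ y (v i)) := by
  induction j generalizing y with
  | zero => simpa [iterThomas] using hV y hy v
  | succ j ih =>
    rw [iterThomas, iterThomas, thomas_coordChange hψ hU' hψU hgauge
      (hV'.iterThomas hU' hA' w j) (fun z hz u ↦ ih hz u) hy]
    push_cast
    rw [sub_add_eq_sub_sub]
    rfl

end Invariance

/-! ### The Killing equation in terms of the Thomas operator -/

section Killing

variable {n r : ℕ} {U : Set (Coord n)} {A : Coord n → Coord n →L[ℝ] Tr n →L[ℝ] Tr n}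
  {k : Coord n → (Fin r → Coord n) → ℝ}

theorem IsSmoothTensor.liftK (hk : IsSmoothTensor U k) : IsSmoothTensor U (liftK k) :=
  ⟨fun _ ↦ hk.smooth _, fun y hy ↦
    (hk.multilin y hy).compLinear fun _ ↦ LinearMap.snd ℝ ℝ (Coord n)⟩

theorem SymmOn.liftK {y : Coord n} (hk : SymmOn Finset.univ (k y)) :
    SymmOn Finset.univ (liftK k y) := fun σ hσ v ↦ hk σ hσ fun i ↦ (v i).2

/-- On the diagonal, `𝔻 K` and `∇ k` agree. -/
theorem thomas_liftK_diag {G : Coord n → Coord n →L[ℝ] Coord n →L[ℝ] Coord n}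
    (hA : IsNormalForm U (coeff G) A) (hk : IsSmoothTensor U k) {y : Coord n} (hy : y ∈ U)
    (x : Tr n) : thomas A r (liftK k) y (fun _ ↦ x)
      = covDeriv (coeff G) (densForm (coeff G)) (2 * r) k y x.2 (fun _ ↦ x.2) := by
  have hm := hk.multilin y hy
  have hup : ∀ i z, liftK k y (Function.update (fun _ ↦ x) i z)
      = k y (Function.update (fun _ ↦ x.2) i z.2) := by
    intro i z
    rw [liftK]
    congr 1
    funext j
    by_cases hj : j = i
    · subst hj; simp
    · simp [hj]
  have ht : Fin.tail (fun _ : Fin (r + 1) ↦ x) = fun _ ↦ x := rfl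
  rw [thomas, tractorDeriv, ht]
  simp only [hup, hA.apply_snd hy, covDeriv, hm.update_add,
    hm.update_sub, hm.update_smul, Function.update_eq_self, Finset.sum_add_distrib,
    Finset.sum_sub_distrib, Finset.sum_const, Finset.card_univ, Fintype.card_fin, nsmul_eq_mul]
  simp only [liftK]
  ring

theorem isMultilin_covDeriv {G : Coord n → Coord n →L[ℝ] Coord n →L[ℝ] Coord n}
    (hU : IsOpen U) (hk : IsSmoothTensor U k) {y : Coord n} (hy : y ∈ U) (w : ℝ) :
    IsMultilin (fun v : Fin (r + 1) → Coord n ↦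
      covDeriv (coeff G) (densForm (coeff G)) w k y (v 0) (Fin.tail v)) := by
  have hm := hk.multilin y hy
  refine IsMultilin.of_cons (fun a ↦ ?_) fun v ↦ ⟨fun a b ↦ ?_, fun c a ↦ ?_⟩
  · simp only [Fin.cons_zero, Fin.tail_cons]
    exact ((hk.isMultilin_fderiv hU hy a).sub (IsMultilin.sum _ fun i _ ↦
      hm.updateLinear i (G y a).toLinearMap)).add (hm.const_mul _)
  · simp only [Fin.cons_zero, Fin.tail_cons, covDeriv, map_add, densForm_coeff, coeff, add_apply,
      hm.update_add, Finset.sum_add_distrib]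
    ring
  · simp only [Fin.cons_zero, Fin.tail_cons, covDeriv, map_smul, densForm_coeff, coeff, smul_apply,
      hm.update_smul, ← Finset.mul_sum, smul_eq_mul]
    ring

/-- The Killing equation for `k` is the equation `𝔻_{(A} K_{B₁ ⋯ B_r)} = 0`: both are the vanishing
on the diagonal, where the two operators agree. -/
theorem symmOver_covDeriv_eq_zero_iff {G : Coord n → Coord n →L[ℝ] Coord n →L[ℝ] Coord n}
    (hA : IsNormalForm U (coeff G) A) (hk : IsSmoothTensor U k) {y : Coord n} (hy : y ∈ U) :
    symmOver Finset.univ (fun v : Fin (r + 1) → Coord n ↦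
        covDeriv (coeff G) (densForm (coeff G)) (2 * r) k y (v 0) (Fin.tail v)) = 0
      ↔ DiagZero Finset.univ (thomas A r (liftK k) y) := by
  rw [symmOver_eq_zero_iff (isMultilin_covDeriv hA.isOpen hk hy _)]
  constructor
  · intro h x v hv
    obtain rfl : v = fun _ ↦ x := funext fun i ↦ hv i (Finset.mem_univ i)
    rw [thomas_liftK_diag hA hk hy]
    exact h x.2 (fun _ ↦ x.2) fun _ _ ↦ rfl
  · intro h x v hv
    obtain rfl : v = fun _ ↦ x := funext fun i ↦ hv i (Finset.mem_univ i)
    have h1 := h (0, x) (fun _ ↦ (0, x)) fun _ _ ↦ rfl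
    rwa [thomas_liftK_diag hA hk hy] at h1

end Killing

/-! ### Charts and coordinate vector fields -/

section Charts

variable {n : ℕ} {M : Type*} [TopologicalSpace M] [ChartedSpace (Coord n) M]

/-- The derivative of the chart `φ` at `x`, with values in the model space. -/
def chartDeriv (φ : OpenPartialHomeomorph M (Coord n)) (x : M) :
    TangentSpace 𝓘(ℝ, Coord n) x →L[ℝ] Coord n :=
  mfderiv 𝓘(ℝ, Coord n) 𝓘(ℝ, Coord n) φ x

theorem coordField_sum (φ : OpenPartialHomeomorph M (Coord n)) (x : M) (c : Coord n) :
    coordField φ c x = ∑ i, c i • coordField φ (stdVec i) x := by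
  have h : coordField φ c x = (chartDeriv φ x).inverse (∑ i, c i • stdVec i) := by
    rw [sum_smul_stdVec]; rfl
  rw [h, map_sum]
  exact Finset.sum_congr rfl fun i _ ↦ map_smul _ _ _

theorem mem_source_of_mem_trans {M : Type*} [TopologicalSpace M]
    {φ φ' : OpenPartialHomeomorph M (Coord n)} {y : Coord n}
    (hy : y ∈ (φ.symm.trans φ').source) : y ∈ φ.target ∧ φ.symm y ∈ φ'.source := by
  simpa [OpenPartialHomeomorph.trans_source] using hy

theorem transMap_mem_target {M : Type*} [TopologicalSpace M]
    {φ φ' : OpenPartialHomeomorph M (Coord n)} {y : Coord n}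
    (hy : y ∈ (φ.symm.trans φ').source) : transMap φ φ' y ∈ φ'.target :=
  φ'.map_source (mem_source_of_mem_trans hy).2

variable [IsManifold 𝓘(ℝ, Coord n) ∞ M] {φ φ' : OpenPartialHomeomorph M (Coord n)} {x : M}

theorem contMDiffOn_chart (hφ : φ ∈ atlas (Coord n) M) :
    ContMDiffOn 𝓘(ℝ, Coord n) 𝓘(ℝ, Coord n) ∞ φ φ.source :=
  contMDiffOn_of_mem_maximalAtlas (IsManifold.subset_maximalAtlas hφ)

theorem contMDiffOn_chart_symm (hφ : φ ∈ atlas (Coord n) M) :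
    ContMDiffOn 𝓘(ℝ, Coord n) 𝓘(ℝ, Coord n) ∞ φ.symm φ.target :=
  contMDiffOn_symm_of_mem_maximalAtlas (IsManifold.subset_maximalAtlas hφ)

theorem mdifferentiable_chart (hφ : φ ∈ atlas (Coord n) M) :
    φ.MDifferentiable 𝓘(ℝ, Coord n) 𝓘(ℝ, Coord n) :=
  ⟨(contMDiffOn_chart hφ).mdifferentiableOn (by simp),
    (contMDiffOn_chart_symm hφ).mdifferentiableOn (by simp)⟩

theorem isInvertible_chartDeriv (hφ : φ ∈ atlas (Coord n) M) (hx : x ∈ φ.source) :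
    (chartDeriv φ x).IsInvertible :=
  ⟨(mdifferentiable_chart hφ).mfderiv hx, rfl⟩

theorem chartDeriv_coordField (hφ : φ ∈ atlas (Coord n) M) (hx : x ∈ φ.source) (a : Coord n) :
    chartDeriv φ x (coordField φ a x) = a :=
  (isInvertible_chartDeriv hφ hx).self_apply_inverse a

theorem coordField_chartDeriv (hφ : φ ∈ atlas (Coord n) M) (hx : x ∈ φ.source)
    (u : TangentSpace 𝓘(ℝ, Coord n) x) : coordField φ (chartDeriv φ x u) x = u :=
  (isInvertible_chartDeriv hφ hx).inverse_apply_self u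

theorem contMDiffOn_coordField (hφ : φ ∈ atlas (Coord n) M) (a : Coord n) :
    ContMDiffOn 𝓘(ℝ, Coord n) (𝓘(ℝ, Coord n).prod 𝓘(ℝ, Coord n)) ∞
      (T% (coordField φ a)) φ.source := by
  intro x hx
  refine ContMDiffAt.contMDiffWithinAt ?_
  refine ContMDiffAt.mpullback_vectorField_preimage (n := ∞) ?_
    ((contMDiffOn_chart hφ).contMDiffAt (φ.open_source.mem_nhds hx))
    (isInvertible_chartDeriv hφ hx) (by simp)
  exact contMDiffAt_vectorSpace_iff_contDiffAt.2 contDiffAt_const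

theorem mdifferentiableAt_coordField (hφ : φ ∈ atlas (Coord n) M) (hx : x ∈ φ.source)
    (a : Coord n) : MDifferentiableAt 𝓘(ℝ, Coord n) (𝓘(ℝ, Coord n).prod 𝓘(ℝ, Coord n))
    (T% (coordField φ a)) x :=
  ((contMDiffOn_coordField hφ a).contMDiffAt (φ.open_source.mem_nhds hx)).mdifferentiableAt
    (by simp)

/-- Near any point of the chart domain, a coordinate vector field agrees with a global one. -/
theorem exists_smoothVectorField_eventuallyEq [T2Space M] (hφ : φ ∈ atlas (Coord n) M)
    (hx : x ∈ φ.source) (a : Coord n) :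
    ∃ Y : SmoothVectorField n M, ∀ᶠ z in 𝓝 x, Y z = coordField φ a z := by
  obtain ⟨f, -, hf⟩ := (SmoothBumpFunction.nhds_basis_tsupport (I := 𝓘(ℝ, Coord n)) x).mem_iff.1
    (φ.open_source.mem_nhds hx)
  refine ⟨⟨(f : M → ℝ) • coordField φ a, ContMDiffOn.smul_section_of_tsupport
    f.contMDiff.contMDiffOn φ.open_source hf (contMDiffOn_coordField hφ a)⟩, ?_⟩
  filter_upwards [f.eventuallyEq_one] with z hz
  change f z • coordField φ a z = _
  rw [hz]
  simp

theorem fderiv_transMap_chartDeriv (hφ : φ ∈ atlas (Coord n) M) (hφ' : φ' ∈ atlas (Coord n) M)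
    (hx : x ∈ φ.source) (hx' : x ∈ φ'.source) (u : TangentSpace 𝓘(ℝ, Coord n) x) :
    fderiv ℝ (transMap φ φ') (φ x) (chartDeriv φ x u) = chartDeriv φ' x u := by
  have h1 : (φ' : M → Coord n) =ᶠ[𝓝 x] transMap φ φ' ∘ φ := by
    filter_upwards [φ.open_source.mem_nhds hx] with z hz
    simp [transMap, φ.left_inv hz]
  have hd : MDifferentiableAt 𝓘(ℝ, Coord n) 𝓘(ℝ, Coord n) (transMap φ φ') (φ x) := by
    refine MDifferentiableAt.comp (φ x) (g := φ') ?_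
      ((mdifferentiable_chart hφ).mdifferentiableAt_symm (φ.map_source hx))
    rw [φ.left_inv hx]
    exact (mdifferentiable_chart hφ').mdifferentiableAt hx'
  have h2 := mfderiv_comp x hd ((mdifferentiable_chart hφ).mdifferentiableAt hx)
  rw [chartDeriv, chartDeriv, h1.mfderiv_eq, h2, ← mfderiv_eq_fderiv]
  rfl

theorem isCoordChange_transMap (hφ : φ ∈ atlas (Coord n) M) (hφ' : φ' ∈ atlas (Coord n) M) :
    IsCoordChange (φ.symm.trans φ').source (transMap φ φ')
      (fun y ↦ fderiv ℝ (transMap φ' φ) (transMap φ φ' y)) where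
  isOpen := (φ.symm.trans φ').open_source
  smooth := by
    rw [← contMDiffOn_iff_contDiffOn]
    exact (contMDiffOn_chart hφ').comp ((contMDiffOn_chart_symm hφ).mono
      fun y hy ↦ (mem_source_of_mem_trans hy).1) fun y hy ↦ (mem_source_of_mem_trans hy).2
  left_inv y hy := by
    obtain ⟨h1, h2⟩ := mem_source_of_mem_trans hy
    have hx := φ.map_target h1
    refine ContinuousLinearMap.ext fun a ↦ ?_
    have h3 := fderiv_transMap_chartDeriv hφ hφ' hx h2 (coordField φ a (φ.symm y))
    have h4 := fderiv_transMap_chartDeriv hφ' hφ h2 hx (coordField φ a (φ.symm y))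
    rw [chartDeriv_coordField hφ hx, φ.right_inv h1] at h3
    rw [chartDeriv_coordField hφ hx, ← h3] at h4
    exact h4
  right_inv y hy := by
    obtain ⟨h1, h2⟩ := mem_source_of_mem_trans hy
    have hx := φ.map_target h1
    refine ContinuousLinearMap.ext fun a ↦ ?_
    have h3 := fderiv_transMap_chartDeriv hφ hφ' hx h2 (coordField φ' a (φ.symm y))
    have h4 := fderiv_transMap_chartDeriv hφ' hφ h2 hx (coordField φ' a (φ.symm y))
    rw [chartDeriv_coordField hφ' h2] at h3 h4
    rw [← h4, φ.right_inv h1] at h3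
    exact h3

end Charts

/-! ### Christoffel symbols -/

section Christoffel

variable {n : ℕ} {M : Type*} [TopologicalSpace M] [ChartedSpace (Coord n) M]
  [IsManifold 𝓘(ℝ, Coord n) ∞ M] {φ φ' : OpenPartialHomeomorph M (Coord n)} {x : M}

/-- The coordinates of `∇_{∂ᵢ} ∂ⱼ` at `x`, in the chart `φ`. -/
def christoffelAt (D : TorsionFreeConnection n M) (φ : OpenPartialHomeomorph M (Coord n)) (x : M)
    (i j : Fin n) : Coord n :=
  chartDeriv φ x (D.cov (coordField φ (stdVec j)) x (coordField φ (stdVec i) x))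

theorem christoffel_eq (D : TorsionFreeConnection n M) (φ : OpenPartialHomeomorph M (Coord n))
    (y a b : Coord n) : christoffel D φ y a b
      = ∑ i, ∑ j, (a i * b j) • christoffelAt D φ (φ.symm y) i j := rfl

theorem exists_christoffel_eq_coeff (D : TorsionFreeConnection n M)
    (φ : OpenPartialHomeomorph M (Coord n)) :
    ∃ G : Coord n → Coord n →L[ℝ] Coord n →L[ℝ] Coord n, christoffel D φ = coeff G := by
  have h : ∀ y, ∃ B : Coord n →ₗ[ℝ] Coord n →ₗ[ℝ] Coord n, ∀ a b,
      B a b = christoffel D φ y a b := fun y ↦ by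
    refine ⟨LinearMap.mk₂ ℝ (christoffel D φ y) ?_ ?_ ?_ ?_, fun _ _ ↦ rfl⟩ <;> intros <;>
      simp only [christoffel_eq, ← Finset.sum_add_distrib, Finset.smul_sum] <;>
      refine Finset.sum_congr rfl fun i _ ↦ Finset.sum_congr rfl fun j _ ↦ ?_ <;>
      simp only [PiLp.add_apply, PiLp.smul_apply, smul_eq_mul] <;> module
  choose B hB using h
  exact ⟨fun y ↦ (B y).toContinuousBilinearMap, funext fun y ↦ funext fun a ↦ funext fun b ↦
    (hB y a b).symm⟩

theorem cov_congr (D : TorsionFreeConnection n M) {X Y : Π x : M, TangentSpace 𝓘(ℝ, Coord n) x}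
    (hX : MDifferentiableAt 𝓘(ℝ, Coord n) (𝓘(ℝ, Coord n).prod 𝓘(ℝ, Coord n)) (T% X) x)
    (hY : MDifferentiableAt 𝓘(ℝ, Coord n) (𝓘(ℝ, Coord n).prod 𝓘(ℝ, Coord n)) (T% Y) x)
    (h : ∀ᶠ z in 𝓝 x, X z = Y z) :
    D.cov X x = D.cov Y x :=
  D.cov.isCovariantDerivativeOnUniv.congr_of_eventuallyEq hX hY univ_mem h

theorem contDiffOn_christoffel [T2Space M] (D : TorsionFreeConnection n M)
    (hφ : φ ∈ atlas (Coord n) M) (a b : Coord n) :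
    ContDiffOn ℝ ∞ (fun y ↦ christoffel D φ y a b) φ.target := by
  simp only [christoffel_eq]
  refine ContDiffOn.sum fun i _ ↦ ContDiffOn.sum fun j _ ↦ ?_
  suffices h : ContDiffOn ℝ ∞ (fun y ↦ christoffelAt D φ (φ.symm y) i j) φ.target from
    (contDiffOn_const (c := a i * b j)).smul h
  intro y₀ hy₀
  refine ContDiffAt.contDiffWithinAt ?_
  have hx₀ := φ.map_target hy₀
  obtain ⟨Y, hY⟩ := exists_smoothVectorField_eventuallyEq hφ hx₀ (stdVec j)
  -- `∇_{∂ᵢ} Y` is a smooth vector field near the point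
  have h1 : ContMDiffAt 𝓘(ℝ, Coord n) (𝓘(ℝ, Coord n).prod 𝓘(ℝ, Coord n)) ∞
      (T% (fun x ↦ D.cov Y x (coordField φ (stdVec i) x))) (φ.symm y₀) :=
    ContMDiffAt.clm_bundle_apply
      ((D.smooth.contMDiff.contMDiff (σ := Y) Y.contMDiff.contMDiffOn).contMDiffAt univ_mem)
      ((contMDiffOn_coordField hφ (stdVec i)).contMDiffAt (φ.open_source.mem_nhds hx₀))
  have hinv : ∀ y ∈ φ.target, (mfderiv 𝓘(ℝ, Coord n) 𝓘(ℝ, Coord n) φ.symm y).IsInvertible :=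
    fun y hy ↦ ⟨(mdifferentiable_chart hφ).symm.mfderiv hy, rfl⟩
  have h2 := ContMDiffAt.mpullback_vectorField_preimage (n := ∞) h1
    ((contMDiffOn_chart_symm hφ).contMDiffAt (φ.open_target.mem_nhds hy₀)) (hinv y₀ hy₀) (by simp)
  refine (contMDiffAt_vectorSpace_iff_contDiffAt.1 h2).congr_of_eventuallyEq ?_
  have hY' : ∀ᶠ y in 𝓝 y₀, ∀ᶠ z in 𝓝 (φ.symm y), Y z = coordField φ (stdVec j) z :=
    (φ.continuousAt_symm hy₀).eventually (eventually_eventually_nhds.2 hY)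
  filter_upwards [φ.open_target.mem_nhds hy₀, hY'] with y hy hYy
  have hx := φ.map_target hy
  rw [christoffelAt, cov_congr D (mdifferentiableAt_coordField hφ hx (stdVec j))
    Y.mdifferentiableAt (hYy.mono fun z hz ↦ hz.symm), VectorField.mpullback_apply]
  symm
  refine ((hinv y hy).inverse_apply_eq).2 ?_
  have h3 := (mdifferentiable_chart hφ).symm_comp_deriv hx
  rw [φ.right_inv hy] at h3
  exact (DFunLike.congr_fun h3 _).symm

/-- The Christoffel symbols of projectively equivalent connections. -/
theorem christoffel_projEquiv [T2Space M] {D D' : TorsionFreeConnection n M} (h : ProjEquiv D D')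
    (hφ : φ ∈ atlas (Coord n) M) : ∃ Υ : Coord n → Coord n →ₗ[ℝ] ℝ, ∀ y ∈ φ.target, ∀ a b,
      christoffel D' φ y a b = christoffel D φ y a b + Υ y a • b + Υ y b • a := by
  obtain ⟨Υ, h⟩ := h
  let υ : ∀ x : M, TangentSpace 𝓘(ℝ, Coord n) x →L[ℝ] ℝ := fun x ↦ Υ x
  let Υ' : Coord n → Coord n →ₗ[ℝ] ℝ := fun y ↦
    (υ (φ.symm y) ∘L (chartDeriv φ (φ.symm y)).inverse).toLinearMap
  refine ⟨Υ', fun y hy a b ↦ ?_⟩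
  have hx := φ.map_target hy
  have key : ∀ i j, christoffelAt D' φ (φ.symm y) i j = christoffelAt D φ (φ.symm y) i j
      + Υ' y (stdVec i) • stdVec j + Υ' y (stdVec j) • stdVec i := by
    intro i j
    obtain ⟨Y, hY⟩ := exists_smoothVectorField_eventuallyEq hφ hx (stdVec j)
    have hY' := hY.mono fun z hz ↦ hz.symm
    have hd := mdifferentiableAt_coordField hφ hx (stdVec j)
    rw [christoffelAt, christoffelAt, cov_congr D hd Y.mdifferentiableAt hY',
      cov_congr D' hd Y.mdifferentiableAt hY', h,
      map_add, map_add, map_smul, map_smul, hY.self_of_nhds, chartDeriv_coordField hφ hx,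
      chartDeriv_coordField hφ hx]
    rfl
  simp only [christoffel_eq, key, smul_add, Finset.sum_add_distrib]
  have e1 : ∑ i, ∑ j, (a i * b j) • Υ' y (stdVec i) • (stdVec j : Coord n) = Υ' y a • b := by
    conv_rhs => rw [← sum_smul_stdVec a, ← sum_smul_stdVec b, map_sum, Finset.sum_smul_sum]
    refine Finset.sum_congr rfl fun i _ ↦ Finset.sum_congr rfl fun j _ ↦ ?_
    rw [map_smul, smul_eq_mul]
    module
  have e2 : ∑ i, ∑ j, (a i * b j) • Υ' y (stdVec j) • (stdVec i : Coord n) = Υ' y b • a := by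
    rw [Finset.sum_comm]
    conv_rhs => rw [← sum_smul_stdVec a, ← sum_smul_stdVec b, map_sum, Finset.sum_smul_sum]
    refine Finset.sum_congr rfl fun i _ ↦ Finset.sum_congr rfl fun j _ ↦ ?_
    rw [map_smul, smul_eq_mul]
    module
  rw [e1, e2]

/-- A coordinate field of one chart, expressed in another chart. -/
theorem coordField_eq_coordField (hφ : φ ∈ atlas (Coord n) M) (hφ' : φ' ∈ atlas (Coord n) M)
    (hx : x ∈ φ.source) (hx' : x ∈ φ'.source) (b : Coord n) :
    coordField φ b x = coordField φ' (fderiv ℝ (transMap φ φ') (φ x) b) x := by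
  have h1 := fderiv_transMap_chartDeriv hφ hφ' hx hx' (coordField φ b x)
  rw [chartDeriv_coordField hφ hx] at h1
  rw [h1, coordField_chartDeriv hφ' hx']

theorem cov_sum_smul (D : TorsionFreeConnection n M) {ι : Type*} (s : Finset ι)
    {f : ι → M → ℝ} {X : ι → Π x : M, TangentSpace 𝓘(ℝ, Coord n) x}
    {f' : ι → TangentSpace 𝓘(ℝ, Coord n) x →L[ℝ] ℝ}
    (hf : ∀ i, HasMFDerivAt 𝓘(ℝ, Coord n) 𝓘(ℝ, ℝ) (f i) x (f' i))
    (hX : ∀ i, MDifferentiableAt 𝓘(ℝ, Coord n) (𝓘(ℝ, Coord n).prod 𝓘(ℝ, Coord n)) (T% (X i)) x)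
    (u : TangentSpace 𝓘(ℝ, Coord n) x) :
    MDifferentiableAt 𝓘(ℝ, Coord n) (𝓘(ℝ, Coord n).prod 𝓘(ℝ, Coord n)) (T% (∑ i ∈ s, f i • X i)) x ∧
    D.cov (∑ i ∈ s, f i • X i) x u = ∑ i ∈ s, (f i x • D.cov (X i) x u + f' i u • X i x) := by
  classical
  have hs : ∀ i, MDifferentiableAt 𝓘(ℝ, Coord n) (𝓘(ℝ, Coord n).prod 𝓘(ℝ, Coord n))
    (T% (f i • X i)) x := fun i ↦
    (hf i).mdifferentiableAt.smul_section (hX i)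
  induction s using Finset.induction_on with
  | empty =>
    simp only [Finset.sum_empty]
    refine ⟨mdifferentiableAt_zeroSection .., ?_⟩
    rw [CovariantDerivative.zero]
    rfl
  | insert i s hi ih =>
    rw [Finset.sum_insert hi, Finset.sum_insert hi]
    refine ⟨mdifferentiableAt_add_section (hs i) ih.1, ?_⟩
    rw [D.cov.isCovariantDerivativeOnUniv.add (hs i) ih.1,
      D.cov.isCovariantDerivativeOnUniv.leibniz (hX i) (hf i).mdifferentiableAt, ← ih.2,
      ← (hf i).mfderiv]
    rfl

/-- The transformation law of the Christoffel symbols. -/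
theorem fderiv_transMap_christoffel (D : TorsionFreeConnection n M) (hφ : φ ∈ atlas (Coord n) M)
    (hφ' : φ' ∈ atlas (Coord n) M) {y : Coord n} (hy : y ∈ (φ.symm.trans φ').source)
    (a b : Coord n) : fderiv ℝ (transMap φ φ') y (christoffel D φ y a b)
      = christoffel D φ' (transMap φ φ' y) (fderiv ℝ (transMap φ φ') y a)
          (fderiv ℝ (transMap φ φ') y b)
        + fderiv ℝ (fderiv ℝ (transMap φ φ')) y a b := by
  obtain ⟨h1, hx'⟩ := mem_source_of_mem_trans hy
  have hx := φ.map_target h1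
  have hψ := isCoordChange_transMap hφ hφ'
  obtain ⟨x, hx0⟩ : ∃ x, x = φ.symm y := ⟨_, rfl⟩
  rw [← hx0] at hx hx'
  have hyx : φ x = y := by rw [hx0, φ.right_inv h1]
  obtain ⟨ψ, hψ0⟩ : ∃ ψ, ψ = transMap φ φ' := ⟨_, rfl⟩
  have hx'y : φ'.symm (ψ y) = x := by
    rw [hψ0, transMap, ← hx0, φ'.left_inv hx']
  rw [← hψ0] at hψ ⊢
  have key : ∀ i j, fderiv ℝ ψ y (christoffelAt D φ x i j)
      = christoffel D φ' (ψ y) (fderiv ℝ ψ y (stdVec i)) (fderiv ℝ ψ y (stdVec j))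
        + fderiv ℝ (fderiv ℝ ψ) y (stdVec i) (stdVec j) := by
    intro i j
    let f : Fin n → M → ℝ := fun l z ↦ (fderiv ℝ ψ (φ z) (stdVec j)) l
    let F' : Fin n → Coord n →L[ℝ] ℝ := fun l ↦
      EuclideanSpace.proj l ∘L (fderiv ℝ (fderiv ℝ ψ) y).flip (stdVec j)
    have hDψ := ContDiffOn.hasFDerivAt_of_mem hψ.isOpen hψ.contDiffOn_fderiv hy
    have hf : ∀ l, HasMFDerivAt 𝓘(ℝ, Coord n) 𝓘(ℝ, ℝ) (f l) x (F' l ∘L chartDeriv φ x) := by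
      intro l
      have h2 : HasFDerivAt (fun z ↦ (fderiv ℝ ψ z (stdVec j)) l) (F' l) (φ x) := by
        rw [hyx]
        have h3 := hDψ.clm_apply (hasFDerivAt_const (stdVec j) y)
        exact (EuclideanSpace.proj (𝕜 := ℝ) l).hasFDerivAt.comp y (by simpa using h3)
      exact h2.hasMFDerivAt.comp x
        ((mdifferentiable_chart hφ).mdifferentiableAt hx).hasMFDerivAt
    obtain ⟨hd, hcov⟩ := cov_sum_smul D Finset.univ
      (f' := fun l ↦ F' l ∘L chartDeriv φ x) hf
      (fun l ↦ mdifferentiableAt_coordField hφ' hx' (stdVec l)) (coordField φ (stdVec i) x)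
    have hev : ∀ᶠ z in 𝓝 x, coordField φ (stdVec j) z
        = (∑ l, f l • coordField φ' (stdVec l)) z := by
      filter_upwards [φ.open_source.mem_nhds hx, φ'.open_source.mem_nhds hx'] with z hz hz'
      rw [coordField_eq_coordField hφ hφ' hz hz', coordField_sum, Finset.sum_apply, ← hψ0]
      rfl
    have h4 := fderiv_transMap_chartDeriv hφ hφ' hx hx'
      (D.cov (coordField φ (stdVec j)) x (coordField φ (stdVec i) x))
    rw [hyx, ← hψ0] at h4
    rw [christoffelAt, h4, cov_congr D (mdifferentiableAt_coordField hφ hx (stdVec j)) hd hev,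
      hcov, map_sum, christoffel_eq, hx'y, Finset.sum_comm]
    have h6 : coordField φ (stdVec i) x
        = ∑ q, (fderiv ℝ ψ y (stdVec i)) q • coordField φ' (stdVec q) x := by
      rw [coordField_eq_coordField hφ hφ' hx hx', coordField_sum, hyx, ← hψ0]
    have h7 : ∀ l, chartDeriv φ' x (D.cov (coordField φ' (stdVec l)) x
        (coordField φ (stdVec i) x))
        = ∑ q, (fderiv ℝ ψ y (stdVec i)) q • christoffelAt D φ' x q l := by
      intro l
      rw [h6, map_sum, map_sum]
      refine Finset.sum_congr rfl fun q _ ↦ ?_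
      rw [map_smul, map_smul]
      rfl
    have h8 : ∑ l, F' l (stdVec i) • (stdVec l : Coord n)
        = fderiv ℝ (fderiv ℝ ψ) y (stdVec i) (stdVec j) := sum_smul_stdVec _
    rw [← h8, ← Finset.sum_add_distrib]
    refine Finset.sum_congr rfl fun l _ ↦ ?_
    rw [map_add, map_smul, map_smul, h7, chartDeriv_coordField hφ' hx', Finset.smul_sum,
      ContinuousLinearMap.comp_apply, chartDeriv_coordField hφ hx]
    congr 1
    refine Finset.sum_congr rfl fun q _ ↦ ?_
    rw [smul_smul, mul_comm, ← hyx]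
  obtain ⟨G', hG'⟩ := exists_christoffel_eq_coeff D φ'
  rw [christoffel_eq, map_sum, ← hx0]
  simp only [map_sum, map_smul, key]
  rw [hG']
  simp only [coeff]
  conv_rhs => rw [← sum_smul_stdVec a, ← sum_smul_stdVec b]
  simp only [map_sum, map_smul, sum_apply, smul_apply, Finset.smul_sum, smul_add,
    smul_smul, Finset.sum_add_distrib]
  congr 1
  all_goals
    rw [Finset.sum_comm]
    refine Finset.sum_congr rfl fun i _ ↦ Finset.sum_congr rfl fun j _ ↦ ?_
    rw [mul_comm]

end Christoffel

/-! ### Linearity and naturality of the Thomas operator and of the Young projection -/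

section Linearity

variable {n m r : ℕ} {U : Set (Coord n)}

theorem tractorDeriv_linearCombination {A : Coord n → Coord n →L[ℝ] Tr n →L[ℝ] Tr n}
    {V V' : Coord n → (Fin m → Tr n) → ℝ} (hU : IsOpen U) (hV : IsSmoothTensor U V)
    (hV' : IsSmoothTensor U V') (c c' : ℝ) {y : Coord n} (hy : y ∈ U) (a : Coord n)
    (v : Fin m → Tr n) : tractorDeriv A (fun z u ↦ c * V z u + c' * V' z u) y a v
      = c * tractorDeriv A V y a v + c' * tractorDeriv A V' y a v := by
  have h1 := hV.differentiableAt hU hy v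
  have h2 := hV'.differentiableAt hU hy v
  simp only [tractorDeriv]
  rw [fderiv_fun_add (h1.const_mul c) (h2.const_mul c'), fderiv_const_mul h1, fderiv_const_mul h2,
    Finset.sum_add_distrib, ← Finset.mul_sum, ← Finset.mul_sum]
  simp only [add_apply, smul_apply, smul_eq_mul]
  ring

theorem iterThomas_linearCombination {A : Coord n → Coord n →L[ℝ] Tr n →L[ℝ] Tr n}
    {V V' : Coord n → (Fin m → Tr n) → ℝ} (hU : IsOpen U) (hA : ContDiffOn ℝ ∞ A U)
    (hV : IsSmoothTensor U V) (hV' : IsSmoothTensor U V') (w c c' : ℝ) (j : ℕ) {y : Coord n}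
    (hy : y ∈ U) : iterThomas A w (fun z u ↦ c * V z u + c' * V' z u) j y
      = fun v ↦ c * iterThomas A w V j y v + c' * iterThomas A w V' j y v := by
  induction j generalizing y with
  | zero => rfl
  | succ j ih =>
    rw [iterThomas, thomas_congr hU (fun z hz ↦ ih hz) (fun _ _ ↦ rfl) _ hy]
    funext v
    rw [thomas, tractorDeriv_linearCombination hU (hV.iterThomas hU hA w j)
      (hV'.iterThomas hU hA w j) c c' hy, iterThomas, iterThomas, thomas, thomas]
    ring

theorem iterThomas_congr {A : Coord n → Coord n →L[ℝ] Tr n →L[ℝ] Tr n}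
    {V V' : Coord n → (Fin m → Tr n) → ℝ} (hU : IsOpen U) (hV : ∀ y ∈ U, V y = V' y) (w : ℝ)
    (j : ℕ) {y : Coord n} (hy : y ∈ U) : iterThomas A w V j y = iterThomas A w V' j y := by
  induction j generalizing y with
  | zero => exact hV y hy
  | succ j ih => exact thomas_congr hU (fun z hz ↦ ih hz) (fun _ _ ↦ rfl) _ hy

/-- The Young projection is linear, and commutes with linear maps of the underlying space. -/
theorem youngProj_linearCombination {F F' : Type*} (g : F → F') (S T : (Fin (r + r) → F') → ℝ)
    (c d : ℝ) : youngProj r (fun v ↦ c * S (fun i ↦ g (v i)) + d * T (fun i ↦ g (v i)))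
      = fun v ↦ c * youngProj r S (fun i ↦ g (v i)) + d * youngProj r T (fun i ↦ g (v i)) := by
  have hs : ∀ (s : Finset (Fin (r + r))) (S T : (Fin (r + r) → F') → ℝ),
      symmOver s (fun v ↦ c * S (fun i ↦ g (v i)) + d * T (fun i ↦ g (v i)))
      = fun v ↦ c * symmOver s S (fun i ↦ g (v i)) + d * symmOver s T (fun i ↦ g (v i)) := by
    intro s S T
    funext v
    simp only [symmOver, Finset.sum_add_distrib, ← Finset.mul_sum]
    simp only [Function.comp_def]
    ring
  have hl : ∀ l : List (Fin r),
      skewList l (fun v ↦ c * S (fun i ↦ g (v i)) + d * T (fun i ↦ g (v i)))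
      = fun v ↦ c * skewList l S (fun i ↦ g (v i)) + d * skewList l T (fun i ↦ g (v i)) := by
    intro l
    induction l with
    | nil => rfl
    | cons i l ih =>
      funext v
      rw [skewList_cons, ih, skewList_cons, skewList_cons]
      simp only [Function.comp_def]
      ring
  rw [youngProj_def, hl, hs, hs]
  rfl

theorem IsSmoothTensor.youngProj {T : Coord n → (Fin (r + r) → Tr n) → ℝ}
    (hT : IsSmoothTensor U T) : IsSmoothTensor U (fun y ↦ youngProj r (T y)) := by
  refine ⟨fun v ↦ ?_, fun y hy ↦ (hT.multilin y hy).isYoung_youngProj.multilin⟩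
  have hs : ∀ (s : Finset (Fin (r + r))) {T : Coord n → (Fin (r + r) → Tr n) → ℝ},
      (∀ v, ContDiffOn ℝ ∞ (fun y ↦ T y v) U) →
        ∀ v, ContDiffOn ℝ ∞ (fun y ↦ symmOver s (T y) v) U := fun s T hT v ↦
    contDiffOn_const.mul (ContDiffOn.sum fun σ _ ↦ hT _)
  have hl : ∀ (l : List (Fin r)) (v), ContDiffOn ℝ ∞ (fun y ↦ skewList l (T y) v) U := by
    intro l
    induction l with
    | nil => exact hT.smooth
    | cons i l ih => exact fun v ↦ ((ih v).sub (ih _)).div_const _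
  simp only [youngProj_def]
  exact hs _ (hs _ (hl _)) v

end Linearity

/-! ### The tractor connection of a flat projective structure -/

section TractorConnection

variable {n : ℕ} {M : Type*} [TopologicalSpace M] [ChartedSpace (Coord n) M]
  [IsManifold 𝓘(ℝ, Coord n) ∞ M]

/-- The connection forms `A` of the normal tractor connection of `p` in the charts of `M`: they
are computed by all connections in the class, and intertwined by the transition maps of `𝓣`. -/
structure IsTractorConnection (p : ProjectiveStructure n M)
    (A : atlas (Coord n) M → Coord n → Coord n →L[ℝ] Tr n →L[ℝ] Tr n) : Prop where
  normal : ∀ φ, ∀ D : TorsionFreeConnection n M, p.Contains D → ∃ G,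
    christoffel D φ.1 = coeff G ∧ IsNormalForm φ.1.target (coeff G) (A φ)
  gauge : ∀ φ φ' : atlas (Coord n) M, ∀ y ∈ (φ.1.symm.trans φ'.1).source, ∀ a v,
    gaugeDefect (A φ) (A φ') (transMap φ.1 φ'.1) (gaugeMap (transMap φ.1 φ'.1)) y a v = 0

theorem ProjectiveStructure.exists_contains (p : ProjectiveStructure n M) :
    ∃ D, p.Contains D := Quotient.exists_rep p

theorem ProjectiveStructure.IsFlat.exists_isTractorConnection [T2Space M] (hn : 2 ≤ n)
    {p : ProjectiveStructure n M} (hp : p.IsFlat) : ∃ A, IsTractorConnection p A := by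
  have h : ∀ (φ : atlas (Coord n) M) (D : TorsionFreeConnection n M), p.Contains D → ∃ G A,
      christoffel D φ.1 = coeff G ∧ IsNormalForm φ.1.target (coeff G) A := by
    intro φ D hD
    obtain ⟨G, hG⟩ := exists_christoffel_eq_coeff D φ.1
    have hs : ContDiffOn ℝ ∞ G φ.1.target := by
      rw [contDiffOn_clm_apply]
      intro a
      rw [contDiffOn_clm_apply]
      intro b
      have := contDiffOn_christoffel D φ.2 a b
      rwa [hG] at this
    obtain ⟨A, hA⟩ := exists_isNormalForm φ.1.open_target hs
      (fun y hy a b v ↦ hG ▸ hp D hD φ.1 φ.2 y hy a b v)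
    exact ⟨G, A, hG, hA⟩
  obtain ⟨D₀, hD₀⟩ := p.exists_contains
  choose G₀ A hG₀ hA using fun φ ↦ h φ D₀ hD₀
  refine ⟨A, fun φ D hD ↦ ?_, fun φ φ' y hy a v ↦ ?_⟩
  · obtain ⟨G, A', hG, hA'⟩ := h φ D hD
    refine ⟨G, hG, (hA φ).toIsFlatTractorForm, fun y hy a v ↦ ?_⟩
    have hrel : ProjEquiv D₀ D := Quotient.exact (hD₀.trans hD.symm)
    obtain ⟨Υ, hΥ⟩ := christoffel_projEquiv hrel φ.2
    rw [hG, hG₀ φ] at hΥ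
    rw [(hA φ).eq_of_projective_change hn hA' hΥ hy]
    exact hA'.apply_eq_form y hy a v
  · refine gaugeDefect_gaugeMap hn (isCoordChange_transMap φ.2 φ'.2) (hA φ) (hA φ')
      (fun z hz ↦ (mem_source_of_mem_trans hz).1) (fun z hz ↦ transMap_mem_target hz)
      (fun z hz a b ↦ ?_) hy a v
    have := fderiv_transMap_christoffel D₀ φ.2 φ'.2 hz a b
    rwa [hG₀ φ, hG₀ φ'] at this

end TractorConnection

/-! ### Sections of bundles from local representatives -/

section LocalFamilies

variable {n m : ℕ} {M : Type*} [TopologicalSpace M] [ChartedSpace (Coord n) M]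
  {F : Type*} [AddCommGroup F] [Module ℝ F]

open Classical in
/-- The family of local representatives with prescribed values on the targets of the charts. It is
`0` off the targets, as required of sections, and where the prescribed values are not
multilinear. -/
def localFamily (T : atlas (Coord n) M → Coord n → (Fin m → F) → ℝ) :
    LocalFamily (n := n) M F m := fun φ y ↦
  if h : y ∈ φ.1.target ∧ IsMultilin (T φ y) then h.2.choose else 0

theorem localFamily_apply {T : atlas (Coord n) M → Coord n → (Fin m → F) → ℝ}
    {φ : atlas (Coord n) M} {y : Coord n} (hy : y ∈ φ.1.target) (hT : IsMultilin (T φ y)) :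
    ⇑(localFamily T φ y) = T φ y := by
  rw [localFamily, dif_pos ⟨hy, hT⟩]
  exact hT.choose_spec

theorem localFamily_of_notMem (T : atlas (Coord n) M → Coord n → (Fin m → F) → ℝ)
    {φ : atlas (Coord n) M} {y : Coord n} (hy : y ∉ φ.1.target) : localFamily T φ y = 0 :=
  dif_neg fun h ↦ hy h.1

theorem localFamily_mem {T : atlas (Coord n) M → Coord n → (Fin m → F) → ℝ}
    {G : OpenPartialHomeomorph M (Coord n) → OpenPartialHomeomorph M (Coord n) →
      Coord n → F → F} {w : ℝ}
    (hs : ∀ φ v, ContDiffOn ℝ ∞ (fun y ↦ T φ y v) φ.1.target)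
    (hm : ∀ φ, ∀ y ∈ φ.1.target, IsMultilin (T φ y))
    (hT : ∀ φ φ', ∀ y ∈ (φ.1.symm.trans φ'.1).source, ∀ v, T φ y v = densTrans w φ.1 φ'.1 y
        * T φ' (transMap φ.1 φ'.1 y) (fun i ↦ G φ.1 φ'.1 y (v i))) :
    localFamily T ∈ tensorSections M G m w := by
  refine ⟨fun φ v ↦ (hs φ v).congr fun y hy ↦ congrFun (localFamily_apply hy (hm φ y hy)) v,
    fun φ y hy ↦ localFamily_of_notMem T hy, fun φ φ' y hy v ↦ ?_⟩
  have h1 := (mem_source_of_mem_trans hy).1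
  have h2 := transMap_mem_target hy
  rw [localFamily_apply h1 (hm φ y h1), localFamily_apply h2 (hm φ' _ h2)]
  exact hT φ φ' y hy v

theorem IsMultilin.map_smul_univ {T : (Fin m → F) → ℝ} (hT : IsMultilin T) (c : ℝ)
    (v : Fin m → F) : T (fun i ↦ c • v i) = c ^ m * T v := by
  obtain ⟨f, rfl⟩ := hT
  have := f.map_smul_univ (fun _ ↦ c) v
  simpa using this

end LocalFamilies

/-! ### Lifts of tensors and contractions of tractors -/

section LiftContraction

variable {n m r : ℕ} {M : Type*} [TopologicalSpace M] [ChartedSpace (Coord n) M]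

theorem densPow_natCast (ψ : Coord n → Coord n) (m : ℕ) (y : Coord n) :
    densPow ψ m y = densPow ψ 1 y ^ m := by
  rw [densPow_eq_rpow, Real.rpow_natCast]

theorem densPow_two_mul (ψ : Coord n → Coord n) (r : ℕ) (y : Coord n) :
    densPow ψ (2 * r) y = densPow ψ 1 y ^ (r + r) := by
  rw [← densPow_natCast]
  congr 1
  push_cast
  ring

theorem densPow_zero (ψ : Coord n → Coord n) (y : Coord n) : densPow ψ 0 y = 1 := by
  rw [densPow_eq_rpow, Real.rpow_zero]

theorem isSmoothTensor_of_mem {F : Type*} [NormedAddCommGroup F] [NormedSpace ℝ F]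
    {G : OpenPartialHomeomorph M (Coord n) → OpenPartialHomeomorph M (Coord n) →
      Coord n → F → F} {w : ℝ} {T : LocalFamily (n := n) M F m} (hT : T ∈ tensorSections M G m w)
    (φ : atlas (Coord n) M) : IsSmoothTensor φ.1.target (fun y ↦ ⇑(T φ y)) :=
  ⟨hT.1 φ, fun _ _ ↦ isMultilin_coe _⟩

theorem symmOn_of_mem (k : symTensors (n := n) M r (2 * r)) (φ : atlas (Coord n) M)
    (y : Coord n) : SymmOn Finset.univ (liftK (fun z ↦ ⇑(k.1 φ z)) y) :=
  SymmOn.liftK (k := fun z ↦ ⇑(k.1 φ z)) (symmOn_iff_symmOver_eq.2 (k.2.2 φ y))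

/-- As `Z` has weight `1`, `K = Z ⋯ Z k` has weight `r` if `k` has weight `2r`. -/
theorem liftK_transition {k : LocalFamily (n := n) M (Coord n) r}
    (hk : k ∈ tensorSections M tangentTrans r (2 * r)) {φ φ' : atlas (Coord n) M} {y : Coord n}
    (hy : y ∈ (φ.1.symm.trans φ'.1).source) (v : Fin r → Tr n) :
    liftK (fun z ↦ ⇑(k φ z)) y v = densPow (transMap φ.1 φ'.1) r y
      * liftK (fun z ↦ ⇑(k φ' z)) (transMap φ.1 φ'.1 y)
        (fun i ↦ gaugeMap (transMap φ.1 φ'.1) y (v i)) := by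
  simp only [liftK, gaugeMap_apply]
  rw [(isMultilin_coe _).map_smul_univ, hk.2.2 φ φ' y hy, densTrans_eq, densPow_two_mul,
    densPow_natCast, pow_add, mul_assoc]
  rfl

theorem isYoung_of_mem (hr : 0 < r) (L : youngTractors (n := n) M r) (φ : atlas (Coord n) M)
    (y : Coord n) : IsYoung (L.1 φ y) := (hasYoungSymmetry_iff hr (isMultilin_coe _)).1 (L.2.2 φ y)

theorem withX_self (v : Fin (r + r) → Tr n) : withX r v = v := by
  funext i
  simp [withX]

/-- The factor by which `𝓛` followed by contraction with `r` copies of `X` multiplies Killing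
tensors: `(r + 1) / 2 ^ r` comes from the Young projection, and `r!` from `𝔻^r`. -/
def splittingFactor (r : ℕ) : ℝ := ((r : ℝ) + 1) / 2 ^ r * ∏ l ∈ Finset.range r, ((r : ℝ) - l)

theorem splittingFactor_ne_zero (r : ℕ) : splittingFactor r ≠ 0 := by
  refine mul_ne_zero (by positivity) (Finset.prod_ne_zero_iff.2 fun l hl ↦ ?_)
  have h : l < r := Finset.mem_range.1 hl
  exact sub_ne_zero.2 (by exact_mod_cast h.ne')

/-- The tensor `k` with `𝓛 k = L`, if `L` is parallel, in the chart `φ`: a multiple of the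
contraction of `L` with `r` copies of `X`. Tangent vectors `u` are lifted to `(0, u)`; other lifts
give the same value by `IsYoung.withX_zero_congr`. -/
def localContraction (L : LocalFamily (n := n) M (Tr n) (r + r)) (φ : atlas (Coord n) M)
    (y : Coord n) (u : Fin r → Coord n) : ℝ :=
  (splittingFactor r)⁻¹ * L φ y (withX 0 (fun i ↦ (0, u i)))

theorem isSmoothTensor_localContraction (L : youngTractors (n := n) M r) (φ : atlas (Coord n) M) :
    IsSmoothTensor φ.1.target (localContraction L.1 φ) :=
  ⟨fun _ ↦ contDiffOn_const.mul (L.2.1.1 φ _), fun y _ ↦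
    (((isMultilin_coe (L.1 φ y)).withX (Nat.zero_le r)).compLinear
      fun _ ↦ LinearMap.inr ℝ ℝ (Coord n)).const_mul _⟩

theorem liftK_localContraction (hr : 0 < r) (L : youngTractors (n := n) M r)
    (φ : atlas (Coord n) M) {y : Coord n} (hy : y ∈ φ.1.target) :
    liftK (fun z ↦ ⇑(localFamily (localContraction L.1) φ z)) y
      = fun v ↦ (splittingFactor r)⁻¹ * L.1 φ y (withX 0 v) := by
  funext v
  rw [liftK, localFamily_apply hy ((isSmoothTensor_localContraction L φ).multilin y hy),
    localContraction, (isYoung_of_mem hr L φ y).withX_zero_congr v]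

end LiftContraction

/-! ### The splitting operator and its inverse on parallel tractors -/

section SplittingOperator

variable {n r : ℕ} {M : Type*} [TopologicalSpace M] [ChartedSpace (Coord n) M]
  [IsManifold 𝓘(ℝ, Coord n) ∞ M] {p : ProjectiveStructure n M}
  {A : atlas (Coord n) M → Coord n → Coord n →L[ℝ] Tr n →L[ℝ] Tr n}

theorem IsTractorConnection.isFlatTractorForm (hA : IsTractorConnection p A)
    (φ : atlas (Coord n) M) : IsFlatTractorForm φ.1.target (A φ) := by
  obtain ⟨D, hD⟩ := p.exists_contains
  obtain ⟨G, -, h⟩ := hA.normal φ D hD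
  exact h.toIsFlatTractorForm

/-- The expression of `𝓛 k` in the chart `φ`. -/
def localSplitting (A : atlas (Coord n) M → Coord n → Coord n →L[ℝ] Tr n →L[ℝ] Tr n)
    (k : LocalFamily (n := n) M (Coord n) r) (φ : atlas (Coord n) M) (y : Coord n) :
    (Fin (r + r) → Tr n) → ℝ :=
  youngProj r (iterThomas (A φ) r (liftK (fun z ↦ ⇑(k φ z))) r y)

theorem isSmoothTensor_localSplitting (hA : IsTractorConnection p A)
    {k : LocalFamily (n := n) M (Coord n) r} (hk : k ∈ tensorSections M tangentTrans r (2 * r))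
    (φ : atlas (Coord n) M) : IsSmoothTensor φ.1.target (localSplitting A k φ) :=
  ((isSmoothTensor_of_mem hk φ).liftK.iterThomas (hA.isFlatTractorForm φ).isOpen
    (hA.isFlatTractorForm φ).smooth r r).youngProj

theorem localSplitting_transition (hA : IsTractorConnection p A)
    {k : LocalFamily (n := n) M (Coord n) r} (hk : k ∈ tensorSections M tangentTrans r (2 * r))
    (φ φ' : atlas (Coord n) M) {y : Coord n} (hy : y ∈ (φ.1.symm.trans φ'.1).source)
    (v : Fin (r + r) → Tr n) : localSplitting A k φ y v = densTrans 0 φ.1 φ'.1 y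
      * localSplitting A k φ' (transMap φ.1 φ'.1 y) (fun i ↦ tractorTrans φ.1 φ'.1 y (v i)) := by
  have h := hA.isFlatTractorForm φ'
  have h1 := funext fun v ↦ iterThomas_coordChange (isCoordChange_transMap φ.2 φ'.2) h.isOpen
    (fun z hz ↦ transMap_mem_target hz) h.smooth (hA.gauge φ φ')
    (isSmoothTensor_of_mem hk φ').liftK (fun z hz u ↦ liftK_transition hk hz u) r hy v
  have h2 := congrFun (youngProj_linearCombination (gaugeMap (transMap φ.1 φ'.1) y)
    (iterThomas (A φ') r (liftK (fun z ↦ ⇑(k φ' z))) r (transMap φ.1 φ'.1 y))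
    0 1 0) v
  rw [localSplitting, h1, sub_self, densTrans_eq]
  simp only [densPow_zero, zero_mul, add_zero] at h2 ⊢
  exact h2

theorem localFamily_localSplitting_mem (hA : IsTractorConnection p A) (hr : 0 < r)
    {k : LocalFamily (n := n) M (Coord n) r} (hk : k ∈ tensorSections M tangentTrans r (2 * r)) :
    localFamily (localSplitting A k) ∈ youngTractors (n := n) M r := by
  have hs := isSmoothTensor_localSplitting hA hk
  refine ⟨localFamily_mem (fun φ ↦ (hs φ).smooth) (fun φ ↦ (hs φ).multilin)
    (fun φ φ' y hy v ↦ localSplitting_transition hA hk φ φ' hy v), fun φ y ↦ ?_⟩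
  by_cases hy : y ∈ φ.1.target
  · rw [localFamily_apply hy ((hs φ).multilin y hy), hasYoungSymmetry_iff hr
      ((hs φ).multilin y hy)]
    exact (((isSmoothTensor_of_mem hk φ).liftK.iterThomas (hA.isFlatTractorForm φ).isOpen
      (hA.isFlatTractorForm φ).smooth r r).multilin y hy).isYoung_youngProj
  · rw [localFamily_of_notMem _ hy]
    exact ⟨symmOver_zero _, symmOver_zero _, symmOver_zero _⟩

theorem localSplitting_linearCombination (hA : IsTractorConnection p A)
    {k k' : LocalFamily (n := n) M (Coord n) r} (hk : k ∈ tensorSections M tangentTrans r (2 * r))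
    (hk' : k' ∈ tensorSections M tangentTrans r (2 * r)) (c c' : ℝ) (φ : atlas (Coord n) M)
    {y : Coord n} (hy : y ∈ φ.1.target) (v : Fin (r + r) → Tr n) :
    localSplitting A (c • k + c' • k') φ y v
      = c * localSplitting A k φ y v + c' * localSplitting A k' φ y v := by
  have h := hA.isFlatTractorForm φ
  have h1 := iterThomas_linearCombination h.isOpen h.smooth (isSmoothTensor_of_mem hk φ).liftK
    (isSmoothTensor_of_mem hk' φ).liftK r c c' r hy
  have h2 := congrFun (youngProj_linearCombination id
    (iterThomas (A φ) r (liftK (fun z ↦ ⇑(k φ z))) r y)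
    (iterThomas (A φ) r (liftK (fun z ↦ ⇑(k' φ z))) r y) c c') v
  refine Eq.trans ?_ h2
  rw [localSplitting]
  refine congrFun (congrArg (youngProj r) ?_) v
  exact h1

/-- The splitting operator `𝓛`, computed with the connection forms `A` in the charts. -/
def splittingOperator (hA : IsTractorConnection p A) (hr : 0 < r) :
    symTensors (n := n) M r (2 * r) →ₗ[ℝ] youngTractors (n := n) M r :=
  IsLinearMap.mk' (fun k ↦ ⟨localFamily (localSplitting A k.1),
      localFamily_localSplitting_mem hA hr k.2.1⟩) <| by
    have key : ∀ (k k' : symTensors (n := n) M r (2 * r)) (c c' : ℝ),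
        localFamily (localSplitting A (c • k + c' • k').1)
          = c • localFamily (localSplitting A k.1) + c' • localFamily (localSplitting A k'.1) := by
      intro k k' c c'
      funext φ y
      ext v
      by_cases hy : y ∈ φ.1.target
      · have hs := fun k : symTensors (n := n) M r (2 * r) ↦
          localFamily_apply (T := localSplitting A k.1) hy
            ((isSmoothTensor_localSplitting hA k.2.1 φ).multilin y hy)
        rw [hs (c • k + c' • k')]
        simp only [Pi.add_apply, Pi.smul_apply, add_apply,
          smul_apply, hs, smul_eq_mul]
        exact localSplitting_linearCombination hA k.2.1 k'.2.1 c c' φ hy v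
      · simp [localFamily_of_notMem _ hy]
    refine ⟨fun k k' ↦ Subtype.ext ?_, fun c k ↦ Subtype.ext ?_⟩
    · simpa using key k k' 1 1
    · simpa using key k k c 0

theorem splittingOperator_apply (hA : IsTractorConnection p A) (hr : 0 < r)
    (k : symTensors (n := n) M r (2 * r)) {φ : atlas (Coord n) M} {y : Coord n}
    (hy : y ∈ φ.1.target) : ⇑((splittingOperator hA hr k).1 φ y) = localSplitting A k.1 φ y :=
  localFamily_apply hy ((isSmoothTensor_localSplitting hA k.2.1 φ).multilin y hy)

theorem isSplittingOperator_splittingOperator (hA : IsTractorConnection p A) (hr : 0 < r) :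
    IsSplittingOperator p r (splittingOperator hA hr) := by
  intro k D hD φ y hy v
  obtain ⟨G, hG, hN⟩ := hA.normal φ D hD
  rw [splittingOperator_apply hA hr k hy, hG, splittingFormula, iterThomasD_eq hN _ _ _ hy]
  rfl

theorem isKilling_iff (hA : IsTractorConnection p A) (k : symTensors (n := n) M r (2 * r)) :
    IsKilling p k ↔ ∀ φ : atlas (Coord n) M, ∀ y ∈ φ.1.target,
      DiagZero Finset.univ (thomas (A φ) r (liftK (fun z ↦ ⇑(k.1 φ z))) y) := by
  have key : ∀ D : TorsionFreeConnection n M, p.Contains D → ∀ φ : atlas (Coord n) M,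
      ∀ y ∈ φ.1.target, symmOver Finset.univ (fun v : Fin (r + 1) → Coord n ↦
        covDeriv (christoffel D φ.1) (densForm (christoffel D φ.1)) (2 * r)
          (fun z ↦ ⇑(k.1 φ z)) y (v 0) (Fin.tail v)) = 0
      ↔ DiagZero Finset.univ (thomas (A φ) r (liftK (fun z ↦ ⇑(k.1 φ z))) y) := by
    intro D hD φ y hy
    obtain ⟨G, hG, hN⟩ := hA.normal φ D hD
    rw [hG]
    exact symmOver_covDeriv_eq_zero_iff hN (isSmoothTensor_of_mem k.2.1 φ) hy
  obtain ⟨D₀, hD₀⟩ := p.exists_contains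
  exact ⟨fun h φ y hy ↦ (key D₀ hD₀ φ y hy).1 (h D₀ hD₀ φ y hy),
    fun h D hD φ y hy ↦ (key D hD φ y hy).2 (h φ y hy)⟩

theorem isParallel_iff (hA : IsTractorConnection p A) (L : youngTractors (n := n) M r) :
    IsParallel p L ↔ ∀ φ : atlas (Coord n) M, ∀ y ∈ φ.1.target, ∀ a v,
      tractorDeriv (A φ) (fun z ↦ ⇑(L.1 φ z)) y a v = 0 := by
  have key : ∀ D : TorsionFreeConnection n M, p.Contains D → ∀ φ : atlas (Coord n) M,
      ∀ y ∈ φ.1.target, ∀ a v,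
      covDeriv (tractorForm (christoffel D φ.1)) (densForm (christoffel D φ.1)) 0
        (fun z ↦ ⇑(L.1 φ z)) y a v = tractorDeriv (A φ) (fun z ↦ ⇑(L.1 φ z)) y a v := by
    intro D hD φ y hy a v
    obtain ⟨G, hG, hN⟩ := hA.normal φ D hD
    rw [hG]
    exact covDeriv_tractorForm hN _ hy _ a v
  obtain ⟨D₀, hD₀⟩ := p.exists_contains
  exact ⟨fun h φ y hy a v ↦ (key D₀ hD₀ φ y hy a v).symm.trans (h D₀ hD₀ φ y hy a v),
    fun h D hD φ y hy a v ↦ (key D hD φ y hy a v).trans (h φ y hy a v)⟩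

/-- On Killing tensors, `𝔻^r K` has Young symmetry already. -/
theorem splittingOperator_apply_of_isKilling (hA : IsTractorConnection p A) (hr : 0 < r)
    {k : symTensors (n := n) M r (2 * r)} (hk : IsKilling p k) {φ : atlas (Coord n) M}
    {y : Coord n} (hy : y ∈ φ.1.target) : ⇑((splittingOperator hA hr k).1 φ y)
      = fun v ↦ ((r : ℝ) + 1) / 2 ^ r * iterThomas (A φ) r (liftK (fun z ↦ ⇑(k.1 φ z))) r y v := by
  rw [splittingOperator_apply hA hr k hy, localSplitting]
  funext v
  exact (isYoung_iterThomas (hA.isFlatTractorForm φ) hr (isSmoothTensor_of_mem k.2.1 φ).liftK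
    (fun z _ ↦ symmOn_of_mem k φ z) ((isKilling_iff hA k).1 hk φ) hy).youngProj_apply v

theorem isParallel_splittingOperator (hA : IsTractorConnection p A) (hr : 0 < r)
    {k : symTensors (n := n) M r (2 * r)} (hk : IsKilling p k) :
    IsParallel p (splittingOperator hA hr k) := by
  rw [isParallel_iff hA]
  intro φ y hy a v
  have hF := hA.isFlatTractorForm φ
  have hK := (isSmoothTensor_of_mem k.2.1 φ).liftK
  have hS := hK.iterThomas hF.isOpen hF.smooth r r
  have h := tractorDeriv_linearCombination (A := A φ) hF.isOpen hS hS (((r : ℝ) + 1) / 2 ^ r) 0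
    hy a v
  rw [tractorDeriv_iterThomas_eq_zero hF hK (fun z _ ↦ symmOn_of_mem k φ z)
    ((isKilling_iff hA k).1 hk φ) hy] at h
  simp only [zero_mul, add_zero, mul_zero] at h
  rw [← h]
  refine congrFun (congrFun (tractorDeriv_congr hF.isOpen (fun z hz ↦ ?_) (fun _ _ ↦ rfl) hy) a) v
  exact splittingOperator_apply_of_isKilling hA hr hk hz

/-- Contraction of `𝓛 k` with `r` copies of `X` recovers a Killing tensor `k`, up to a non-zero
factor. -/
theorem splittingOperator_withX (hA : IsTractorConnection p A) (hr : 0 < r)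
    {k : symTensors (n := n) M r (2 * r)} (hk : IsKilling p k) {φ : atlas (Coord n) M}
    {y : Coord n} (hy : y ∈ φ.1.target) (u : Fin r → Coord n) :
    (splittingOperator hA hr k).1 φ y (withX 0 (fun i ↦ (0, u i)))
      = splittingFactor r * k.1 φ y u := by
  have hF := hA.isFlatTractorForm φ
  rw [splittingOperator_apply_of_isKilling hA hr hk hy]
  simp only
  rw [iterThomas_apply_one _ _ (isSmoothTensor_of_mem k.2.1 φ).liftK hy hF.isOpen hF.smooth _
    (fun i hi ↦ withX_of_lt _ (by simpa using hi)), ← mul_assoc, splittingFactor, liftK]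
  congr 2
  funext i
  have h : i.addNat r = withXPos 0 (Nat.zero_le r) i := by ext; simp [withXPos]
  rw [h, withX_withXPos]

theorem injOn_splittingOperator (hA : IsTractorConnection p A) (hr : 0 < r) :
    InjOn (splittingOperator hA hr) {k | IsKilling p k} := by
  intro k hk k' hk' h
  refine Subtype.ext (funext fun φ ↦ funext fun y ↦ ?_)
  by_cases hy : y ∈ φ.1.target
  · ext u
    have h1 := splittingOperator_withX hA hr hk hy u
    rw [h, splittingOperator_withX hA hr hk' hy u] at h1
    exact (mul_left_cancel₀ (splittingFactor_ne_zero r) h1).symm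
  · rw [k.2.1.2.1 φ y hy, k'.2.1.2.1 φ y hy]

theorem localContraction_transition (hr : 0 < r) (L : youngTractors (n := n) M r)
    (φ φ' : atlas (Coord n) M) {y : Coord n} (hy : y ∈ (φ.1.symm.trans φ'.1).source)
    (u : Fin r → Coord n) : localContraction L.1 φ y u = densTrans (2 * r) φ.1 φ'.1 y
      * localContraction L.1 φ' (transMap φ.1 φ'.1 y) (fun i ↦ tangentTrans φ.1 φ'.1 y (u i)) := by
  let δ := densTrans 1 φ.1 φ'.1 y
  -- up to the factor `δ`, the transition map fixes `X` and induces that of `TM` modulo `X`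
  have h : ∀ i, tractorTrans φ.1 φ'.1 y (withX 0 (fun i ↦ ((0 : ℝ), u i)) i)
      = δ • withX 0 (fun i ↦ (δ⁻¹ * fderiv ℝ (densTrans 1 φ.1 φ'.1) y (u i),
          tangentTrans φ.1 φ'.1 y (u i))) i := by
    have hδ : δ ≠ 0 := ((isCoordChange_transMap φ.2 φ'.2).densPow_pos hy 1).ne'
    intro i
    rw [withX, withX]
    split_ifs
    · simp [tractorTrans, tangentTrans, δ]
    · simp [tractorTrans, δ, mul_inv_cancel_left₀ hδ]
  have h1 := isYoung_of_mem hr L φ' (transMap φ.1 φ'.1 y)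
  rw [localContraction, localContraction, L.2.1.2.2 φ φ' y hy, funext h,
    (isMultilin_coe _).map_smul_univ, h1.withX_zero_congr, densTrans_eq 0,
    densTrans_eq (2 * r), densPow_zero, densPow_two_mul, one_mul, mul_left_comm]
  rfl

theorem localFamily_localContraction_mem (hr : 0 < r) (L : youngTractors (n := n) M r) :
    localFamily (localContraction L.1) ∈ symTensors (n := n) M r (2 * r) := by
  have hs := isSmoothTensor_localContraction L
  refine ⟨localFamily_mem (fun φ ↦ (hs φ).smooth) (fun φ ↦ (hs φ).multilin)
    (fun φ φ' y hy v ↦ localContraction_transition hr L φ φ' hy v), fun φ y ↦ ?_⟩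
  by_cases hy : y ∈ φ.1.target
  · rw [localFamily_apply hy ((hs φ).multilin y hy), ← symmOn_iff_symmOver_eq]
    intro σ hσ u
    exact congrArg ((splittingFactor r)⁻¹ * ·)
      ((isYoung_of_mem hr L φ y).withX_zero_symmOn σ hσ fun i ↦ (0, u i))
  · rw [localFamily_of_notMem _ hy]
    exact symmOver_zero _

/-- A parallel tractor `L` comes from its contraction with `r` copies of `X`: the iterates of `𝔻`
undo this contraction. -/
theorem surjOn_splittingOperator (hA : IsTractorConnection p A) (hr : 0 < r) :
    SurjOn (splittingOperator hA hr) {k | IsKilling p k} {L | IsParallel p L} := by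
  intro L hL
  have hp := (isParallel_iff hA L).1 hL
  let k : symTensors (n := n) M r (2 * r) := ⟨_, localFamily_localContraction_mem hr L⟩
  have hk : IsKilling p k := by
    refine (isKilling_iff hA k).2 fun φ y hy ↦ ?_
    have hF := hA.isFlatTractorForm φ
    rw [thomas_congr hF.isOpen (fun z hz ↦ liftK_localContraction hr L φ hz) (fun _ _ ↦ rfl) _ hy]
    exact thomas_withX_diagZero hF hr (isSmoothTensor_of_mem L.2.1 φ)
      (fun z _ ↦ isYoung_of_mem hr L φ z) (hp φ) _ hy
  refine ⟨k, hk, Subtype.ext (funext fun φ ↦ funext fun y ↦ ?_)⟩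
  by_cases hy : y ∈ φ.1.target
  · have hF := hA.isFlatTractorForm φ
    refine DFunLike.coe_injective ?_
    rw [splittingOperator_apply_of_isKilling hA hr hk hy, iterThomas_congr hF.isOpen
      (fun z hz ↦ liftK_localContraction hr L φ hz) _ _ hy, iterThomas_withX hF
      (isSmoothTensor_of_mem L.2.1 φ) (fun z _ ↦ (isYoung_of_mem hr L φ z).first) (hp φ) le_rfl _
        hy]
    funext v
    have h : ((r : ℝ) + 1) / 2 ^ r * ((splittingFactor r)⁻¹
        * ∏ l ∈ Finset.range r, ((r : ℝ) - l)) = 1 := by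
      rw [mul_left_comm]
      exact inv_mul_cancel₀ (splittingFactor_ne_zero r)
    simp only
    rw [withX_self, ← mul_assoc, h, one_mul]
  · rw [L.2.1.2.1 φ y hy]
    exact localFamily_of_notMem _ hy

theorem bijOn_splittingOperator (hA : IsTractorConnection p A) (hr : 0 < r) :
    BijOn (splittingOperator hA hr) {k | IsKilling p k} {L | IsParallel p L} :=
  ⟨fun _ hk ↦ isParallel_splittingOperator hA hr hk, injOn_splittingOperator hA hr,
    surjOn_splittingOperator hA hr⟩

end SplittingOperator

end ProjTractor

end

/-- On a projectively flat manifold, the splitting operator `𝓛 : Γ(Sʳ T*M (2r)) → Γ(𝓣_{(r,r)})`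
restricts to a linear isomorphism from the Killing tensors of rank `r` onto the sections of
`𝓣_{(r,r)}` that are parallel for the normal projective tractor connection. -/
theorem theorem3p6 (n : ℕ) (hn : 2 ≤ n) (M : Type*) [TopologicalSpace M] [T2Space M]
    [SecondCountableTopology M] [ChartedSpace (ProjTractor.Coord n) M]
    [IsManifold 𝓘(ℝ, ProjTractor.Coord n) ∞ M]
    (p : ProjTractor.ProjectiveStructure n M) (hp : p.IsFlat) (r : ℕ) (hr : 1 ≤ r) :
    ∃ 𝓛 : ProjTractor.symTensors (n := n) M r (2 * r) →ₗ[ℝ]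
        ProjTractor.youngTractors (n := n) M r,
      ProjTractor.IsSplittingOperator p r 𝓛 ∧
        Set.BijOn 𝓛 {k | ProjTractor.IsKilling p k} {L | ProjTractor.IsParallel p L} := by
  obtain ⟨A, hA⟩ := hp.exists_isTractorConnection hn
  exact ⟨ProjTractor.splittingOperator hA hr,
    ProjTractor.isSplittingOperator_splittingOperator hA hr,
    ProjTractor.bijOn_splittingOperator hA hr⟩
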